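/- Let $N,k\ge 1$ be integers, $\rho>1$, $1\le p<\infty$ with $p>\frac{N+2k}{2}(\rho-1)$, and let $u_0\in L^p(\mathbb R^{N+k})$ be real-valued. For $x,x_0\in\mathbb R^N$, $y\in\mathbb R^k$, $t>0$ put $$K(x,x_0,y;t)=\frac{1}{(2\pi)^{\frac{N+2k}{2}}}\int_{\mathbb R^k}\Big(\frac{|\xi|}{\sinh(|\xi|t)}\Big)^{\frac N2}e^{\,i\xi\cdot y-\frac{|\xi|}{2}\left((|x|^2+|x_0|^2)\coth(|\xi|t)-2x\cdot x_0\,\mathrm{csch}(|\xi|t)\right)}\,d\xi ,$$ the heat kernel of the Grushin operator $\Delta_{\mathcal G}=\frac12(\Delta_x+|x|^2\Delta_y)$, and let $S(t)\varphi(x,y)=\int_{\mathbb R^{N+k}}K(x,w,y-z;t)\varphi(w,z)\,d(w,z)$ for $t>0$, $S(0)\varphi=\varphi$. An $L^p$-mild solution on $[0,T]$ of $u_t-\Delta_{\mathcal G}u=|u|^{\rho-1}u$, $u(0)=u_0$, is a function $u\in C([0,T];L^p(\mathbb R^{N+k}))$ with $$u(t)=S(t)u_0+\int_0^tS(t-s)\,|u(s)|^{\rho-1}u(s)\,ds\qquad(0\le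 t\le T),$$ the integral being a Bochner integral in $L^p$. Let $\alpha=\frac{N+2k}{2\rho p}(\rho-1)$. By a solution on $[0,T]$, $T>0$, we mean an $L^p$-mild solution on $[0,T]$ with $u\in C((0,T];L^{\rho p}(\mathbb R^{N+k}))$ and $\sup_{t\in(0,T]}t^{\alpha}\|u(t)\|_{L^{\rho p}}<\infty$. A continuation of a solution $u$ on $[0,T]$ is a solution $v$ on some $[0,T']$ with $T'>T$ and $v=u$ on $[0,T]$. A maximal solution on $[0,T_m)$, $0<T_m\le\infty$, is a function on $[0,T_m)$ that is a solution on $[0,T]$ for every $0<T<T_m$ and that no $L^p$-mild solution on an interval $[0,T']$ with $T_m\le T'<\infty$ extends. Then there are $T>0$ and a solution on $[0,T]$, which is the only solution on $[0,T]$. Moreover, for every $T>0$ and every solution $u$ on $[0,T]$: 1. $u$ has a continuation, and any two continuations of $u$, on $[0,T_1]$ and $[0,T_2]$, coincide on $[0,\min\{T_1,T_2\}]$. 2. There are $T_m\in(T,\infty]$ and a maximal solution $U$ on $[0,T_m)$ with $U=u$ on $[0,T]$; both $T_m$ and $U$ are unique. 3. If $T_m<\infty$, then $\lim_{t\to T_m^-}\|U(t)\|_{L^{\rho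 p}}=+\infty$. -/

import Mathlib

open MeasureTheory Set Filter Topology
open scoped ENNReal

namespace Grushin

/-- The space `ℝ^{N+k} = ℝ^N × ℝ^k`, with points written `z = (x, y)`; its `volume` is Lebesgue
measure. -/
abbrev Space (N k : ℕ) : Type :=
  EuclideanSpace ℝ (Fin N) × EuclideanSpace ℝ (Fin k)

/-- The real Lebesgue space `L^p(ℝ^{N+k})`. -/
abbrev LpSpace (N k : ℕ) (p : ℝ) : Type :=
  Lp ℝ (ENNReal.ofReal p) (volume : Measure (Space N k))

/-- `(|ξ| / sinh(|ξ|t))^{N/2}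
  * exp(-(|ξ|/2) ((|x|² + |x₀|²) coth(|ξ|t) - 2 x·x₀ csch(|ξ|t)))`. -/
noncomputable def kernelSymbol {N k : ℕ} (t : ℝ) (x x₀ : EuclideanSpace ℝ (Fin N))
    (ξ : EuclideanSpace ℝ (Fin k)) : ℝ :=
  (‖ξ‖ / Real.sinh (‖ξ‖ * t)) ^ ((N : ℝ) / 2) *
    Real.exp (-(‖ξ‖ / 2) *
      ((‖x‖ ^ 2 + ‖x₀‖ ^ 2) * (Real.cosh (‖ξ‖ * t) / Real.sinh (‖ξ‖ * t)) -
        2 * inner ℝ x x₀ * (1 / Real.sinh (‖ξ‖ * t))))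

/-- The heat kernel of `Δ_𝒢 = (Δ_x + |x|² Δ_y) / 2`, as an inverse partial Fourier transform. -/
noncomputable def heatKernelC {N k : ℕ} (t : ℝ) (x x₀ : EuclideanSpace ℝ (Fin N))
    (y : EuclideanSpace ℝ (Fin k)) : ℂ :=
  (((2 * Real.pi) ^ (-(((N : ℝ) + 2 * k) / 2)) : ℝ) : ℂ) *
    ∫ ξ : EuclideanSpace ℝ (Fin k),
      (kernelSymbol t x x₀ ξ : ℂ) * Complex.exp (Complex.I * ((inner ℝ ξ y : ℝ) : ℂ))

/-- The heat kernel as a real number; see `heatKernel_coe`. -/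
noncomputable def heatKernel {N k : ℕ} (t : ℝ) (x x₀ : EuclideanSpace ℝ (Fin N))
    (y : EuclideanSpace ℝ (Fin k)) : ℝ :=
  (heatKernelC t x x₀ y).re

/-- The heat kernel is real-valued, so that passing to the real part loses nothing. -/
theorem heatKernel_coe {N k : ℕ} (t : ℝ) (x x₀ : EuclideanSpace ℝ (Fin N))
    (y : EuclideanSpace ℝ (Fin k)) :
    (heatKernel t x x₀ y : ℂ) = heatKernelC t x x₀ y := by
  refine Complex.conj_eq_iff_re.1 ?_
  unfold heatKernelC
  rw [map_mul, Complex.conj_ofReal, ← integral_conj,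
    ← integral_neg_eq_self (fun ξ : EuclideanSpace ℝ (Fin k) =>
      (kernelSymbol t x x₀ ξ : ℂ) * Complex.exp (Complex.I * ((inner ℝ ξ y : ℝ) : ℂ)))]
  congr 1
  refine integral_congr_ae (Eventually.of_forall fun ξ => ?_)
  have h : kernelSymbol t x x₀ (-ξ) = kernelSymbol t x x₀ ξ := by simp [kernelSymbol]
  simp only [h, map_mul, Complex.conj_ofReal, ← Complex.exp_conj, Complex.conj_I, inner_neg_left]
  push_cast
  ring_nf

/-- The semigroup generated by the Grushin operator:
`S(t)φ(x, y) = ∫ K(x, w, y - z; t) φ(w, z) d(w, z)` for `t > 0`, and `S(0)φ = φ`. -/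
noncomputable def semigroup {N k : ℕ} (t : ℝ) (φ : Space N k → ℝ) : Space N k → ℝ :=
  if 0 < t then
    fun z => ∫ w : Space N k, heatKernel t z.1 w.1 (z.2 - w.2) * φ w
  else φ

/-- The nonlinearity `|u|^{ρ-1} u`. -/
noncomputable def nonlin (ρ r : ℝ) : ℝ := |r| ^ (ρ - 1) * r

/-- `α = (N + 2k)(ρ - 1) / (2ρp)`. -/
noncomputable def alpha (N k : ℕ) (ρ p : ℝ) : ℝ :=
  ((N : ℝ) + 2 * k) / (2 * ρ * p) * (ρ - 1)

/-- `u(t) = S(t)u₀ + ∫₀ᵗ S(t-s) |u(s)|^{ρ-1}u(s) ds` at one time `t`. The time integral is a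
Bochner integral in `L^p`: the integrand, whose defining kernel integrals have to converge, must
be (the class of) an integrable function `g` of `s` with values in `L^p`. -/
def MildEqAt {N k : ℕ} (ρ p : ℝ) [Fact (1 ≤ ENNReal.ofReal p)]
    (u₀ : LpSpace N k p) (u : ℝ → LpSpace N k p) (t : ℝ) : Prop :=
  ∃ g : ℝ → LpSpace N k p,
    (∀ s ∈ Ioo 0 t,
      (∀ᵐ z : Space N k, Integrable fun w : Space N k =>
        heatKernel (t - s) z.1 w.1 (z.2 - w.2) * nonlin ρ (u s w)) ∧
      g s =ᵐ[volume] semigroup (t - s) (fun w => nonlin ρ (u s w))) ∧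
    IntervalIntegrable g volume 0 t ∧
    u t =ᵐ[volume] semigroup t u₀ + ((∫ s in (0 : ℝ)..t, g s : LpSpace N k p) : Space N k → ℝ)

/-- `L^p`-mild solution on `[0,T]`: a continuous function `[0,T] → L^p` that satisfies the
integral equation. (Functions of time are total; only the values on `[0,T]` matter.) -/
structure IsMildSolution {N k : ℕ} (ρ p : ℝ) [Fact (1 ≤ ENNReal.ofReal p)]
    (u₀ : LpSpace N k p) (T : ℝ) (u : ℝ → LpSpace N k p) : Prop where
  continuousOn : ContinuousOn u (Icc 0 T)
  eq : ∀ t ∈ Icc 0 T, MildEqAt ρ p u₀ u t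

/-- The class `X_α` on `(0,T]`: continuous with values in `L^{ρp}`, and
`sup_{t ∈ (0,T]} t^α ‖u(t)‖_{L^{ρp}} < ∞` (so that `u(t) ∈ L^{ρp}` for `t ∈ (0,T]`). -/
structure MemX {N k : ℕ} (ρ p : ℝ) (T : ℝ) (u : ℝ → LpSpace N k p) : Prop where
  tendsto : ∀ t₀ ∈ Ioc 0 T,
    Tendsto (fun t => eLpNorm (fun z => u t z - u t₀ z) (ENNReal.ofReal (ρ * p)) volume)
      (𝓝[Ioc 0 T] t₀) (𝓝 0)
  bound : ∃ M : ℝ, ∀ t ∈ Ioc 0 T,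
    ENNReal.ofReal (t ^ alpha N k ρ p) * eLpNorm (u t) (ENNReal.ofReal (ρ * p)) volume
      ≤ ENNReal.ofReal M

/-- An `L^p`-mild solution on `[0,T]`, `T > 0`, in the class `X_α ∩ C([0,T]; L^p)`. -/
structure IsSolution {N k : ℕ} (ρ p : ℝ) [Fact (1 ≤ ENNReal.ofReal p)]
    (u₀ : LpSpace N k p) (T : ℝ) (u : ℝ → LpSpace N k p) : Prop where
  pos : 0 < T
  mild : IsMildSolution ρ p u₀ T u
  memX : MemX ρ p T u

/-- `v` on `[0,T']` is a continuation of `u` on `[0,T]`. -/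
structure IsContinuation {N k : ℕ} (ρ p : ℝ) [Fact (1 ≤ ENNReal.ofReal p)]
    (u₀ : LpSpace N k p) (T : ℝ) (u : ℝ → LpSpace N k p)
    (T' : ℝ) (v : ℝ → LpSpace N k p) : Prop where
  lt : T < T'
  sol : IsSolution ρ p u₀ T' v
  eqOn : EqOn v u (Icc 0 T)

/-- `u` on `[0,T_m)`, `0 < T_m ≤ ∞`, is a maximal solution: it is a solution on every `[0,T]` with
`0 < T < T_m`, and no `L^p`-mild solution on an interval `[0,T']` with `T' ≥ T_m` (not even one
outside `X_α`) extends it. -/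
structure IsMaximalSolution {N k : ℕ} (ρ p : ℝ) [Fact (1 ≤ ENNReal.ofReal p)]
    (u₀ : LpSpace N k p) (Tm : EReal) (u : ℝ → LpSpace N k p) : Prop where
  pos : 0 < Tm
  sol : ∀ T : ℝ, 0 < T → (T : EReal) < Tm → IsSolution ρ p u₀ T u
  maximal : ¬ ∃ (T' : ℝ) (v : ℝ → LpSpace N k p), Tm ≤ (T' : EReal) ∧
    IsMildSolution ρ p u₀ T' v ∧ EqOn v u {t : ℝ | 0 ≤ t ∧ (t : EReal) < Tm}

end Grushin

/-! The argument is a weighted contraction in `L^p` with the auxiliary norm of `L^{ρp}`. It rests on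
four facts about the heat kernel: it is nonnegative, its mass is at most one, it is bounded by a
constant times `t^{-(N+2k)/2}`, and it obeys the semigroup law. Interpolating between mass and sup
bound yields `‖S(t)‖_{L^p → L^q} ≤ C t^{-((N+2k)/2)(1/p - 1/q)}`
(`IsSubMarkov.eLpNorm_integral_le`). For `q = ρp` the exponent is `α`, and the assumption on `p`
says exactly that `αρ < 1`.

The Fourier transform in `y` turns the operator into a harmonic oscillator of frequency `|ξ|`, whose
kernel is Mehler's Gaussian. The sup bound follows by a dilation in `ξ`. The semigroup law combines
Fourier inversion in `y` with the composition of Gaussians in `x`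
(`lintegral_heatKernel_mul_heatKernel`). Nonnegativity is hidden in an oscillatory integral; it
comes from Trotter's product. One symmetric Trotter step is itself an exact Mehler kernel and is
Gaussian in `ξ`, so its Fourier transform is positive. Products of steps keep this property
(`integral_trotter_nonneg`) and converge to the true symbol. Testing the kernel against Gaussians
expresses its mass as an average of `massFactor`, which is at most 1 and tends to 1 as `t → 0`;
hence contractivity and strong continuity.

The evolution problem is solved abstractly in a `SmoothingSystem`, with `E = L^p` and `F = L^{ρp}`.
On functions with `‖v(t)‖ ≤ M t^{-α}` the Duhamel integral is Lipschitz with constant of order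
`M^{ρ-1} T^{1-αρ}`, which gives existence by Picard iteration and uniqueness by advancing in short
steps. The existence time depends only on a bound for `t^α ‖R(t)φ‖`. Such a bound follows from a
bound on the current value either in `F` or in `E`. Restarting shortly before a finite lifespan is
therefore impossible while either norm stays bounded: the first gives blow-up in `L^{ρp}`
(`tendsto_norm_flow`), the second excludes an `L^p`-continuous extension, even one outside the
weighted class (`not_tendsto_mild_flow`). Finally `mildEqAt_iff` matches the concrete equation with
the abstract one. -/

namespace Grushin

/-! ### Gaussian integrals and the composition law of Mehler kernels. -/

section Mehler

variable {N : ℕ}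

/-- The Gaussian `b^{N/2} exp(-(a/2)(|x|² + |w|²) + b x·w)`. -/
noncomputable def mehler (a b : ℝ) (x w : EuclideanSpace ℝ (Fin N)) : ℝ :=
  b ^ ((N : ℝ) / 2) * Real.exp (-(a / 2) * (‖x‖ ^ 2 + ‖w‖ ^ 2) + b * inner ℝ x w)

theorem integrable_exp_quadratic {a : ℝ} (ha : 0 < a) (c : EuclideanSpace ℝ (Fin N)) :
    Integrable fun w : EuclideanSpace ℝ (Fin N) =>
      Real.exp (-(a / 2) * ‖w‖ ^ 2 + inner ℝ c w) := by
  have h := (GaussianFourier.integrable_cexp_neg_mul_sq_norm_add (V := EuclideanSpace ℝ (Fin N))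
    (b := ((a / 2 : ℝ) : ℂ)) (by simpa using ha) 1 c).re
  refine h.congr (Eventually.of_forall fun w => ?_)
  have : -(((a / 2 : ℝ)) : ℂ) * (‖w‖ : ℂ) ^ 2 + 1 * ((inner ℝ c w : ℝ) : ℂ)
      = ((-(a / 2) * ‖w‖ ^ 2 + inner ℝ c w : ℝ) : ℂ) := by push_cast; ring
  simp only [this, ← Complex.ofReal_exp]
  rfl

theorem integral_exp_quadratic {a : ℝ} (ha : 0 < a) (c : EuclideanSpace ℝ (Fin N)) :
    ∫ w : EuclideanSpace ℝ (Fin N), Real.exp (-(a / 2) * ‖w‖ ^ 2 + inner ℝ c w)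
      = (2 * Real.pi / a) ^ ((N : ℝ) / 2) * Real.exp (‖c‖ ^ 2 / (2 * a)) := by
  have h := GaussianFourier.integral_cexp_neg_mul_sq_norm_add (V := EuclideanSpace ℝ (Fin N))
    (b := ((a / 2 : ℝ) : ℂ)) (by simpa using ha) 1 c
  have e : ∀ w : EuclideanSpace ℝ (Fin N),
      -(((a / 2 : ℝ)) : ℂ) * (‖w‖ : ℂ) ^ 2 + 1 * ((inner ℝ c w : ℝ) : ℂ)
      = ((-(a / 2) * ‖w‖ ^ 2 + inner ℝ c w : ℝ) : ℂ) := fun w => by push_cast; ring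
  simp only [e, ← Complex.ofReal_exp] at h
  rw [integral_complex_ofReal] at h
  have h2 : ((Real.pi : ℂ) / ((a / 2 : ℝ) : ℂ)) ^ ((Module.finrank ℝ (EuclideanSpace ℝ (Fin N)) : ℂ) / 2)
      = (((2 * Real.pi / a) ^ ((N : ℝ) / 2) : ℝ) : ℂ) := by
    rw [Complex.ofReal_cpow (by positivity), finrank_euclideanSpace_fin]
    congr 1
    · push_cast; field_simp
    · push_cast; ring
  have h3 : Complex.exp (1 ^ 2 * (‖c‖ : ℂ) ^ 2 / (4 * ((a / 2 : ℝ) : ℂ)))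
      = ((Real.exp (‖c‖ ^ 2 / (2 * a)) : ℝ) : ℂ) := by
    rw [Complex.ofReal_exp]
    congr 1
    push_cast
    field_simp
    ring
  rw [h2, h3] at h
  exact_mod_cast h

theorem mehler_nonneg {a b : ℝ} (hb : 0 ≤ b) (x w : EuclideanSpace ℝ (Fin N)) :
    0 ≤ mehler a b x w := by
  unfold mehler; positivity

theorem mehler_comm (a b : ℝ) (x w : EuclideanSpace ℝ (Fin N)) :
    mehler a b x w = mehler a b w x := by
  unfold mehler; rw [real_inner_comm, add_comm (‖x‖ ^ 2)]

/-- For `a = b` the exponent is `-(b/2)|x - w|²`, and a larger `a` only lowers it. -/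
theorem mehler_le {a b : ℝ} (hb : 0 ≤ b) (hab : b ≤ a) (x w : EuclideanSpace ℝ (Fin N)) :
    mehler a b x w ≤ b ^ ((N : ℝ) / 2) := by
  unfold mehler
  refine mul_le_of_le_one_right (by positivity) (Real.exp_le_one_iff.2 ?_)
  have h1 := real_inner_le_norm x w
  have h2 : b * inner ℝ x w ≤ b * (‖x‖ * ‖w‖) := mul_le_mul_of_nonneg_left h1 hb
  nlinarith [mul_nonneg hb (sq_nonneg (‖x‖ - ‖w‖)), sq_nonneg ‖x‖, sq_nonneg ‖w‖,
    mul_nonneg (sub_nonneg.2 hab) (add_nonneg (sq_nonneg ‖x‖) (sq_nonneg ‖w‖))]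

theorem mehler_mul_gauss (a b κ : ℝ) (x z w : EuclideanSpace ℝ (Fin N)) :
    mehler a b x w * Real.exp (-(κ / 2) * ‖w - z‖ ^ 2) =
      b ^ ((N : ℝ) / 2) * Real.exp (-(a / 2) * ‖x‖ ^ 2 - (κ / 2) * ‖z‖ ^ 2) *
        Real.exp (-((a + κ) / 2) * ‖w‖ ^ 2 + inner ℝ (b • x + κ • z) w) := by
  unfold mehler
  rw [mul_assoc, mul_assoc, ← Real.exp_add, ← Real.exp_add, norm_sub_sq_real, inner_add_left,
    real_inner_smul_left, real_inner_smul_left, real_inner_comm w z]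
  ring_nf

theorem integrable_mehler_mul_gauss {a b κ : ℝ} (h : 0 < a + κ)
    (x z : EuclideanSpace ℝ (Fin N)) :
    Integrable fun w => mehler a b x w * Real.exp (-(κ / 2) * ‖w - z‖ ^ 2) := by
  simp only [mehler_mul_gauss]
  exact (integrable_exp_quadratic h _).const_mul _

/-- Completing the square, the exponent at `w`-integrated level is `((b + κ)² - (a + κ)²)|x|² / (2(a
+ κ))`, which factors as shown. -/
theorem integral_mehler_mul_gauss {a b κ : ℝ} (hb : 0 < b) (h : 0 < a + κ)
    (x : EuclideanSpace ℝ (Fin N)) :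
    ∫ w, mehler a b x w * Real.exp (-(κ / 2) * ‖w - x‖ ^ 2) =
      (2 * Real.pi) ^ ((N : ℝ) / 2) * ((b / (a + κ)) ^ ((N : ℝ) / 2) *
        Real.exp (-(‖x‖ ^ 2 / (2 * (a + κ))) * ((a ^ 2 - b ^ 2) + 2 * κ * (a - b)))) := by
  simp only [mehler_mul_gauss]
  rw [integral_const_mul, integral_exp_quadratic h, ← add_smul, norm_smul, mul_pow,
    Real.norm_eq_abs, sq_abs, Real.div_rpow (by positivity) h.le, Real.div_rpow hb.le h.le]
  have : ∀ A B C D E F : ℝ, E * F = D → A * E * (B / C * F) = B * (A / C * D) := by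
    intro A B C D E F h; rw [← h]; ring
  apply this
  rw [← Real.exp_add]
  congr 1
  field_simp
  ring

/-- The product is a Gaussian in `w` with quadratic coefficient `a₁ + a₂`. The invariant `hab` makes
the resulting coefficients of `|x|²` and `|z|²` equal, so that the integral is again of the
symmetric form `mehler`. -/
theorem mehler_comp {a₁ b₁ a₂ b₂ : ℝ} (ha₁ : 0 < a₁) (ha₂ : 0 < a₂) (hb₁ : 0 < b₁) (hb₂ : 0 < b₂)
    (hab : a₁ ^ 2 - b₁ ^ 2 = a₂ ^ 2 - b₂ ^ 2) (x z : EuclideanSpace ℝ (Fin N)) :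
    Integrable (fun w => mehler a₁ b₁ x w * mehler a₂ b₂ w z) ∧
    ∫ w, mehler a₁ b₁ x w * mehler a₂ b₂ w z =
      (2 * Real.pi) ^ ((N : ℝ) / 2) *
        mehler (a₁ - b₁ ^ 2 / (a₁ + a₂)) (b₁ * b₂ / (a₁ + a₂)) x z := by
  have hs : 0 < a₁ + a₂ := by positivity
  have e : ∀ w, mehler a₁ b₁ x w * mehler a₂ b₂ w z =
      b₁ ^ ((N : ℝ) / 2) * b₂ ^ ((N : ℝ) / 2) *
        Real.exp (-(a₁ / 2) * ‖x‖ ^ 2 - (a₂ / 2) * ‖z‖ ^ 2) *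
        Real.exp (-((a₁ + a₂) / 2) * ‖w‖ ^ 2 + inner ℝ (b₁ • x + b₂ • z) w) := by
    intro w
    unfold mehler
    rw [mul_mul_mul_comm, mul_assoc (b₁ ^ _ * _), ← Real.exp_add, ← Real.exp_add, inner_add_left,
      real_inner_smul_left, real_inner_smul_left, real_inner_comm w z]
    ring_nf
  simp only [e]
  refine ⟨(integrable_exp_quadratic hs _).const_mul _, ?_⟩
  rw [integral_const_mul, integral_exp_quadratic hs]
  unfold mehler
  rw [Real.div_rpow (by positivity) hs.le, Real.div_rpow (by positivity) hs.le,
    Real.mul_rpow hb₁.le hb₂.le]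
  have : ∀ A B C D E F G : ℝ, E * F = D → A * B * E * (G / C * F) = G * (A * B / C * D) := by
    intro A B C D E F G h; rw [← h]; ring
  apply this
  rw [← Real.exp_add]
  congr 1
  rw [norm_add_sq_real, norm_smul, norm_smul, real_inner_smul_left, real_inner_smul_right, mul_pow,
    mul_pow, Real.norm_eq_abs, Real.norm_eq_abs, sq_abs, sq_abs]
  have h2 : a₁ - b₁ ^ 2 / (a₁ + a₂) = a₂ - b₂ ^ 2 / (a₁ + a₂) := by
    field_simp; linarith
  rw [mul_add (-((a₁ - b₁ ^ 2 / (a₁ + a₂)) / 2))]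
  -- The coefficient of `‖z‖²` has to be read off from the second factor, that of `‖x‖²` from the
  -- first.
  nth_rewrite 2 [h2]
  field_simp
  ring

/-- The Gaussian `mehler` with hyperbolic parameters. -/
noncomputable def mehlerHyp (c σ : ℝ) (x w : EuclideanSpace ℝ (Fin N)) : ℝ :=
  mehler (c * (Real.cosh σ / Real.sinh σ)) (c / Real.sinh σ) x w

/-- Since `coth² - csch² = 1`, the invariant `a² - b²` equals `c²` for every angle, so `mehler_comp`
applies; the addition formulas then show that angles add while `c` is kept. -/
theorem mehlerHyp_comp {c σ τ : ℝ} (hc : 0 < c) (hσ : 0 < σ) (hτ : 0 < τ)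
    (x z : EuclideanSpace ℝ (Fin N)) :
    Integrable (fun w => mehlerHyp c σ x w * mehlerHyp c τ w z) ∧
    ∫ w, mehlerHyp c σ x w * mehlerHyp c τ w z =
      (2 * Real.pi) ^ ((N : ℝ) / 2) * mehlerHyp c (σ + τ) x z := by
  have h1 := Real.sinh_pos_iff.2 hσ
  have h2 := Real.sinh_pos_iff.2 hτ
  have h3 := Real.sinh_pos_iff.2 (add_pos hσ hτ)
  have c1 := Real.cosh_pos σ
  have c2 := Real.cosh_pos τ
  have e1 := Real.cosh_sq σ
  have e2 := Real.cosh_sq τ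
  have key := mehler_comp (N := N) (a₁ := c * (Real.cosh σ / Real.sinh σ)) (b₁ := c / Real.sinh σ)
    (a₂ := c * (Real.cosh τ / Real.sinh τ)) (b₂ := c / Real.sinh τ) (by positivity) (by positivity)
    (by positivity) (by positivity)
    (by rw [mul_pow, mul_pow, div_pow, div_pow, div_pow, div_pow, e1, e2]; field_simp; ring) x z
  have hA : c * (Real.cosh σ / Real.sinh σ) + c * (Real.cosh τ / Real.sinh τ)
      = c * Real.sinh (σ + τ) / (Real.sinh σ * Real.sinh τ) := by
    rw [Real.sinh_add]; field_simp; ring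
  refine ⟨key.1, key.2.trans ?_⟩
  unfold mehlerHyp
  rw [hA]
  congr 2
  · rw [Real.sinh_add] at h3 ⊢
    rw [Real.cosh_add]
    field_simp
    linear_combination Real.sinh τ * e1
  · field_simp

theorem mehlerHyp_le {c σ : ℝ} (hc : 0 ≤ c) (hσ : 0 ≤ σ) (x w : EuclideanSpace ℝ (Fin N)) :
    mehlerHyp c σ x w ≤ (c / Real.sinh σ) ^ ((N : ℝ) / 2) := by
  have h1 := Real.sinh_nonneg_iff.2 hσ
  refine mehler_le (by positivity) ?_ x w
  rw [div_eq_mul_one_div]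
  have := Real.one_le_cosh σ
  gcongr

theorem mehlerHyp_nonneg {c σ : ℝ} (hc : 0 ≤ c) (hσ : 0 ≤ σ) (x w : EuclideanSpace ℝ (Fin N)) :
    0 ≤ mehlerHyp c σ x w :=
  mehler_nonneg (div_nonneg hc (Real.sinh_nonneg_iff.2 hσ)) x w

theorem kernelSymbol_eq {k : ℕ} (t : ℝ) (x w : EuclideanSpace ℝ (Fin N))
    (ξ : EuclideanSpace ℝ (Fin k)) : kernelSymbol t x w ξ = mehlerHyp ‖ξ‖ (‖ξ‖ * t) x w := by
  unfold kernelSymbol mehlerHyp mehler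
  ring_nf

@[fun_prop]
theorem measurable_mehlerHyp {α : Type*} [MeasurableSpace α] {c σ : α → ℝ}
    {x w : α → EuclideanSpace ℝ (Fin N)} (hc : Measurable c) (hσ : Measurable σ)
    (hx : Measurable x) (hw : Measurable w) :
    Measurable fun q => mehlerHyp (c q) (σ q) (x q) (w q) := by
  unfold mehlerHyp mehler
  have := hx.inner (𝕜 := ℝ) hw
  fun_prop (disch := assumption)

end Mehler

/-! ### Positivity of the Fourier transform of Trotter products. -/

section Positivity

variable {N k : ℕ}

/-- The origin has to be excluded because the quotient `‖ξ‖ / sinh(‖ξ‖t)` takes the default value `0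
/ 0 = 0` there instead of its limit `1 / t`. -/
theorem ae_ne_zero (hk : 1 ≤ k) : ∀ᵐ ξ : EuclideanSpace ℝ (Fin k), ξ ≠ 0 := by
  have : Nonempty (Fin k) := ⟨⟨0, hk⟩⟩
  have : Nontrivial (EuclideanSpace ℝ (Fin k)) := inferInstance
  exact Measure.ae_ne volume 0

theorem integrable_gauss {ε : ℝ} (hε : 0 < ε) :
    Integrable fun ξ : EuclideanSpace ℝ (Fin k) => Real.exp (-ε * ‖ξ‖ ^ 2) := by
  have := integrable_exp_quadratic (a := 2 * ε) (by positivity) (0 : EuclideanSpace ℝ (Fin k))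
  simpa using this

theorem integral_gauss_cos {ε : ℝ} (hε : 0 < ε) (y : EuclideanSpace ℝ (Fin k)) :
    ∫ ξ : EuclideanSpace ℝ (Fin k), Real.exp (-ε * ‖ξ‖ ^ 2) * Real.cos (inner ℝ ξ y)
      = (Real.pi / ε) ^ ((k : ℝ) / 2) * Real.exp (-(1 / (4 * ε)) * ‖y‖ ^ 2) := by
  have h := GaussianFourier.integral_cexp_neg_mul_sq_norm_add (V := EuclideanSpace ℝ (Fin k))
    (b := (ε : ℂ)) (by simpa using hε) Complex.I y
  have hi := GaussianFourier.integrable_cexp_neg_mul_sq_norm_add (V := EuclideanSpace ℝ (Fin k))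
    (b := (ε : ℂ)) (by simpa using hε) Complex.I y
  have h2 : ((Real.pi : ℂ) / (ε : ℂ)) ^
      ((Module.finrank ℝ (EuclideanSpace ℝ (Fin k)) : ℂ) / 2)
      * Complex.exp (Complex.I ^ 2 * (‖y‖ : ℂ) ^ 2 / (4 * (ε : ℂ)))
      = (((Real.pi / ε) ^ ((k : ℝ) / 2) * Real.exp (-(1 / (4 * ε)) * ‖y‖ ^ 2) : ℝ) : ℂ) := by
    rw [Complex.ofReal_mul, Complex.ofReal_cpow (by positivity), finrank_euclideanSpace_fin,
      Complex.ofReal_exp, Complex.I_sq]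
    push_cast
    congr 2
    ring
  rw [h2] at h
  have h3 := congrArg Complex.re h
  rw [Complex.ofReal_re, ← RCLike.re_eq_complex_re, ← integral_re hi] at h3
  rw [← h3]
  refine integral_congr_ae (Eventually.of_forall fun ξ => ?_)
  simp only [RCLike.re_eq_complex_re]
  have : -(ε : ℂ) * (‖ξ‖ : ℂ) ^ 2 + Complex.I * ((inner ℝ y ξ : ℝ) : ℂ)
      = ((-ε * ‖ξ‖ ^ 2 : ℝ) : ℂ) + ((inner ℝ y ξ : ℝ) : ℂ) * Complex.I := by push_cast; ring
  rw [this, Complex.exp_add, ← Complex.ofReal_exp, Complex.re_ofReal_mul,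
    Complex.exp_ofReal_mul_I_re, real_inner_comm]

/-- The angle with `cosh θ = 1 + h²s²/2`. -/
noncomputable def trotterAngle (h s : ℝ) : ℝ := 2 * Real.arsinh (h * s / 2)

theorem cosh_trotterAngle (h s : ℝ) : Real.cosh (trotterAngle h s) = 1 + h ^ 2 * s ^ 2 / 2 := by
  rw [trotterAngle, Real.cosh_two_mul, Real.cosh_sq, Real.sinh_arsinh]; ring

theorem trotterAngle_pos {h s : ℝ} (hh : 0 < h) (hs : 0 < s) : 0 < trotterAngle h s := by
  have : 0 < Real.arsinh (h * s / 2) := Real.arsinh_pos_iff.2 (by positivity)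
  unfold trotterAngle; positivity

theorem sinh_trotterAngle (h s : ℝ) :
    Real.sinh (trotterAngle h s) = h * s * √(1 + (h * s / 2) ^ 2) := by
  rw [trotterAngle, Real.sinh_two_mul, Real.sinh_arsinh, Real.cosh_arsinh]; ring

@[fun_prop]
theorem measurable_trotterAngle (h : ℝ) : Measurable (trotterAngle h) := by
  unfold trotterAngle
  have : Continuous Real.arsinh := Real.continuous_arsinh
  fun_prop

/-- Up to normalization this is one symmetric Trotter step of length `h`: free heat flow between two
multiplications by `exp(-h s²|·|²/4)`. The angle is chosen so that the step is exactly a Mehler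
kernel, whose iterates `mehlerHyp_comp` computes, while its dependence on `s` is visibly Gaussian.
-/
theorem mehlerHyp_trotterAngle {h s : ℝ} (hh : 0 < h) (hs : 0 < s)
    (x w : EuclideanSpace ℝ (Fin N)) :
    mehlerHyp (Real.sinh (trotterAngle h s) / h) (trotterAngle h s) x w =
      (1 / h) ^ ((N : ℝ) / 2) * Real.exp (-(1 / h / 2) * ‖w - x‖ ^ 2) *
        Real.exp (-(h / 4 * (‖x‖ ^ 2 + ‖w‖ ^ 2)) * s ^ 2) := by
  have h1 := Real.sinh_pos_iff.2 (trotterAngle_pos hh hs)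
  unfold mehlerHyp mehler
  have e1 : Real.sinh (trotterAngle h s) / h / Real.sinh (trotterAngle h s) = 1 / h := by
    field_simp
  have e2 : Real.sinh (trotterAngle h s) / h *
      (Real.cosh (trotterAngle h s) / Real.sinh (trotterAngle h s)) =
      (1 + h ^ 2 * s ^ 2 / 2) / h := by
    rw [← cosh_trotterAngle]; field_simp
  rw [e1, e2, mul_assoc, ← Real.exp_add, norm_sub_sq_real, real_inner_comm]
  congr 2
  field_simp
  ring

/-- Superadditivity of `sinh` on the half-line, from `cosh ≥ 1`. -/
theorem nat_mul_sinh_le {θ : ℝ} (hθ : 0 ≤ θ) (n : ℕ) :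
    n * Real.sinh θ ≤ Real.sinh (n * θ) := by
  induction n with
  | zero => simp
  | succ n ih =>
    have h1 := Real.sinh_nonneg_iff.2 hθ
    have h2 : 0 ≤ Real.sinh (n * θ) := Real.sinh_nonneg_iff.2 (by positivity)
    push_cast
    rw [add_mul, one_mul, add_mul, one_mul, Real.sinh_add]
    nlinarith [Real.one_le_cosh θ, Real.one_le_cosh (n * θ)]

/-- The right side does not involve `θ`, hence not `ξ`. For `h = t / (n + 1)` it is `1 / t`, so all
Trotter approximations share one bound. -/
theorem trotter_rate_le {h θ : ℝ} (hh : 0 < h) (hθ : 0 < θ) (n : ℕ) :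
    Real.sinh θ / h / Real.sinh ((n + 1 : ℕ) * θ) ≤ 1 / (h * (n + 1 : ℕ)) := by
  have h1 := Real.sinh_pos_iff.2 hθ
  have h2 := nat_mul_sinh_le hθ.le (n + 1)
  have h3 : 0 < ((n + 1 : ℕ) : ℝ) := by positivity
  rw [div_div, div_le_div_iff₀ (by positivity) (by positivity)]
  nlinarith

theorem mehlerHyp_trotter_le {h s : ℝ} (hh : 0 < h) (hs : 0 < s) (n : ℕ)
    (x w : EuclideanSpace ℝ (Fin N)) :
    mehlerHyp (Real.sinh (trotterAngle h s) / h) ((n + 1 : ℕ) * trotterAngle h s) x w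
      ≤ (1 / (h * (n + 1 : ℕ))) ^ ((N : ℝ) / 2) := by
  have hθ := trotterAngle_pos hh hs
  have h1 := Real.sinh_pos_iff.2 hθ
  refine (mehlerHyp_le (by positivity) (by positivity) x w).trans ?_
  have h2 : 0 < Real.sinh ((n + 1 : ℕ) * trotterAngle h s) := Real.sinh_pos_iff.2 (by positivity)
  exact Real.rpow_le_rpow (by positivity) (trotter_rate_le hh hθ n) (by positivity)

theorem mehlerHyp_trotter_nonneg {h s : ℝ} (hh : 0 < h) (hs : 0 < s) (n : ℕ)
    (x w : EuclideanSpace ℝ (Fin N)) :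
    0 ≤ mehlerHyp (Real.sinh (trotterAngle h s) / h) ((n + 1 : ℕ) * trotterAngle h s) x w := by
  have hθ := trotterAngle_pos hh hs
  have h1 := Real.sinh_pos_iff.2 hθ
  exact mehlerHyp_nonneg (by positivity) (by positivity) x w

/-- A Gaussian has a positive Fourier transform. Splitting off the last Trotter step leaves, for
each intermediate point `w`, a positive constant times the integral for one step fewer, in which the
step's Gaussian in `ξ` has been absorbed into `ε`. -/
theorem integral_trotter_nonneg (hk : 1 ≤ k) {h : ℝ} (hh : 0 < h) (n : ℕ)
    (x z : EuclideanSpace ℝ (Fin N)) {ε : ℝ} (hε : 0 < ε) (y : EuclideanSpace ℝ (Fin k)) :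
    0 ≤ ∫ ξ : EuclideanSpace ℝ (Fin k),
      mehlerHyp (Real.sinh (trotterAngle h ‖ξ‖) / h) ((n + 1 : ℕ) * trotterAngle h ‖ξ‖) x z *
        (Real.exp (-ε * ‖ξ‖ ^ 2) * Real.cos (inner ℝ ξ y)) := by
  -- The split-off step replaces the endpoint `z` by `w` and enlarges `ε` by an amount depending on
  -- both.
  induction n generalizing z ε with
  | zero =>
    have e : ∀ᵐ ξ : EuclideanSpace ℝ (Fin k),
      mehlerHyp (Real.sinh (trotterAngle h ‖ξ‖) / h) ((0 + 1 : ℕ) * trotterAngle h ‖ξ‖) x z *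
        (Real.exp (-ε * ‖ξ‖ ^ 2) * Real.cos (inner ℝ ξ y)) =
      (1 / h) ^ ((N : ℝ) / 2) * Real.exp (-(1 / h / 2) * ‖z - x‖ ^ 2) *
        (Real.exp (-(h / 4 * (‖x‖ ^ 2 + ‖z‖ ^ 2) + ε) * ‖ξ‖ ^ 2) * Real.cos (inner ℝ ξ y)) := by
      filter_upwards [ae_ne_zero hk] with ξ hξ
      simp only [zero_add, Nat.cast_one, one_mul]
      rw [mehlerHyp_trotterAngle hh (norm_pos_iff.2 hξ), neg_add, add_mul _ _ (‖ξ‖ ^ 2),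
        Real.exp_add]
      ring
    rw [integral_congr_ae e, integral_const_mul, integral_gauss_cos (by positivity)]
    positivity
  | succ n ih =>
    set F : EuclideanSpace ℝ (Fin k) → EuclideanSpace ℝ (Fin N) → ℝ := fun ξ w =>
      mehlerHyp (Real.sinh (trotterAngle h ‖ξ‖) / h) ((n + 1 : ℕ) * trotterAngle h ‖ξ‖) x w *
        ((1 / h) ^ ((N : ℝ) / 2) * Real.exp (-(1 / h / 2) * ‖z - w‖ ^ 2) *
        Real.exp (-(h / 4 * (‖w‖ ^ 2 + ‖z‖ ^ 2)) * ‖ξ‖ ^ 2)) *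
        (Real.exp (-ε * ‖ξ‖ ^ 2) * Real.cos (inner ℝ ξ y)) with hF
    have e : ∀ᵐ ξ : EuclideanSpace ℝ (Fin k),
      mehlerHyp (Real.sinh (trotterAngle h ‖ξ‖) / h) ((n + 1 + 1 : ℕ) * trotterAngle h ‖ξ‖) x z *
        (Real.exp (-ε * ‖ξ‖ ^ 2) * Real.cos (inner ℝ ξ y)) =
        ((2 * Real.pi) ^ ((N : ℝ) / 2))⁻¹ * ∫ w, F ξ w := by
      filter_upwards [ae_ne_zero hk] with ξ hξ
      have hs := norm_pos_iff.2 hξ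
      have hθ := trotterAngle_pos hh hs
      have h1 := Real.sinh_pos_iff.2 hθ
      have key := (mehlerHyp_comp (c := Real.sinh (trotterAngle h ‖ξ‖) / h)
        (σ := (n + 1 : ℕ) * trotterAngle h ‖ξ‖) (τ := trotterAngle h ‖ξ‖) (by positivity)
        (by positivity) hθ x z).2
      simp only [hF, ← mehlerHyp_trotterAngle hh hs]
      rw [integral_mul_const, key]
      have : ((n + 1 : ℕ) : ℝ) * trotterAngle h ‖ξ‖ + trotterAngle h ‖ξ‖ =
        ((n + 1 + 1 : ℕ) : ℝ) * trotterAngle h ‖ξ‖ := by push_cast; ring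
      rw [this]
      field_simp
    rw [integral_congr_ae e, integral_const_mul]
    refine mul_nonneg (by positivity) ?_
    have hint : Integrable (Function.uncurry F) := by
      have hdom : Integrable (fun q : EuclideanSpace ℝ (Fin k) × EuclideanSpace ℝ (Fin N) =>
          Real.exp (-ε * ‖q.1‖ ^ 2) * ((1 / (h * (n + 1 : ℕ))) ^ ((N : ℝ) / 2) *
            ((1 / h) ^ ((N : ℝ) / 2) * Real.exp (-(1 / h / 2) * ‖z - q.2‖ ^ 2)))) := by
        have i1 : Integrable fun w : EuclideanSpace ℝ (Fin N) =>
            Real.exp (-(1 / h / 2) * ‖z - w‖ ^ 2) :=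
          (integrable_gauss (ε := 1 / h / 2) (by positivity)).comp_sub_left z
        exact (integrable_gauss hε).mul_prod ((i1.const_mul _).const_mul _)
      refine hdom.mono ?_ ?_
      · have hm : Measurable (Function.uncurry F) := by
          simp only [hF, Function.uncurry_def]
          fun_prop
        exact hm.aestronglyMeasurable
      · have hz : ∀ᵐ q : EuclideanSpace ℝ (Fin k) × EuclideanSpace ℝ (Fin N), q.1 ≠ 0 :=
          (Measure.quasiMeasurePreserving_fst (μ := (volume : Measure (EuclideanSpace ℝ (Fin k))))
            (ν := (volume : Measure (EuclideanSpace ℝ (Fin N))))).ae (ae_ne_zero hk)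
        filter_upwards [hz] with q hq
        have hs := norm_pos_iff.2 hq
        have b1 := mehlerHyp_trotter_le hh hs n x q.2
        have b0 := mehlerHyp_trotter_nonneg hh hs n x q.2
        simp only [hF, Function.uncurry_def]
        have b2 : 0 ≤ (1 / h) ^ ((N : ℝ) / 2) := by positivity
        have b3 : 0 ≤ (1 / (h * (n + 1 : ℕ))) ^ ((N : ℝ) / 2) := by positivity
        simp only [norm_mul, Real.norm_of_nonneg b0, Real.norm_of_nonneg b2,
          Real.norm_of_nonneg b3, Real.norm_of_nonneg (Real.exp_nonneg _)]
        have c1 : ‖Real.cos (inner ℝ q.1 y)‖ ≤ 1 := Real.abs_cos_le_one _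
        have c2 : Real.exp (-(h / 4 * (‖q.2‖ ^ 2 + ‖z‖ ^ 2)) * ‖q.1‖ ^ 2) ≤ 1 := by
          refine Real.exp_le_one_iff.2 ?_
          rw [neg_mul, neg_nonpos]
          positivity
        calc _ ≤ (1 / (h * (n + 1 : ℕ))) ^ ((N : ℝ) / 2) *
              ((1 / h) ^ ((N : ℝ) / 2) * Real.exp (-(1 / h / 2) * ‖z - q.2‖ ^ 2) * 1) *
              (Real.exp (-ε * ‖q.1‖ ^ 2) * 1) := by gcongr
          _ = _ := by ring
    rw [integral_integral_swap hint]
    refine integral_nonneg fun w => ?_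
    have e2 : ∀ ξ, F ξ w = (1 / h) ^ ((N : ℝ) / 2) * Real.exp (-(1 / h / 2) * ‖z - w‖ ^ 2) *
      (mehlerHyp (Real.sinh (trotterAngle h ‖ξ‖) / h) ((n + 1 : ℕ) * trotterAngle h ‖ξ‖) x w *
        (Real.exp (-(h / 4 * (‖w‖ ^ 2 + ‖z‖ ^ 2) + ε) * ‖ξ‖ ^ 2) * Real.cos (inner ℝ ξ y))) := by
      intro ξ
      simp only [hF]
      rw [neg_add, add_mul _ _ (‖ξ‖ ^ 2), Real.exp_add]
      ring
    simp only [e2]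
    rw [integral_const_mul]
    exact mul_nonneg (by positivity) (ih w (by positivity))

end Positivity

/-! ### Sup bound, nonnegativity and continuity of the heat kernel. -/

section KernelBounds

variable {N k : ℕ}

/-- With `E = e^{s/2}` one has `4 E⁻¹ sinh s = 2(E - E⁻³) ≥ s`, because `E ≥ 1 + s/2` and `E⁻³ ≤ 1`.
-/
theorem div_sinh_le {s : ℝ} (hs : 0 ≤ s) : s / Real.sinh s ≤ 4 * Real.exp (-(s / 2)) := by
  rcases hs.eq_or_lt with rfl | hs
  · simp
  have h0 := Real.sinh_pos_iff.2 hs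
  rw [div_le_iff₀ h0, Real.sinh_eq]
  have e1 : Real.exp s = Real.exp (s / 2) * Real.exp (s / 2) := by rw [← Real.exp_add]; ring_nf
  have e2 : Real.exp (-s) * Real.exp s = 1 := by rw [← Real.exp_add]; simp
  have e3 : Real.exp (-(s / 2)) * Real.exp (s / 2) = 1 := by rw [← Real.exp_add]; simp
  have p1 := Real.add_one_le_exp (s / 2)
  have p2 := Real.exp_pos (-(s / 2))
  have e4 : Real.exp (-s) = Real.exp (-(s / 2)) * Real.exp (-(s / 2)) := by
    rw [← Real.exp_add]; ring_nf
  set E := Real.exp (s / 2)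
  set e := Real.exp (-(s / 2))
  have : 4 * e * ((Real.exp s - Real.exp (-s)) / 2) = 2 * (E - e * (e * e)) := by
    rw [e1, e4]; linear_combination 2 * E * e3
  rw [this]
  have he : e ≤ 1 := Real.exp_le_one_iff.2 (by linarith)
  have : e * (e * e) ≤ 1 := mul_le_one₀ he (by positivity) (mul_le_one₀ he p2.le he)
  linarith

/-- From `e^x ≥ (1 + x/(k+1))^{k+1}` the function is at most a multiple of `(1 + ‖ξ‖)^{-(k+1)}`,
which is integrable in dimension `k`. -/
theorem integrable_exp_neg_norm {c : ℝ} (hc : 0 < c) :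
    Integrable fun ξ : EuclideanSpace ℝ (Fin k) => Real.exp (-(c * ‖ξ‖)) := by
  have h := integrable_one_add_norm (E := EuclideanSpace ℝ (Fin k)) (μ := volume)
    (r := ((k + 1 : ℕ) : ℝ)) (by rw [finrank_euclideanSpace_fin]; push_cast; linarith)
  refine (h.const_mul ((max 1 ((k + 1 : ℕ) / c)) ^ (k + 1))).mono (by fun_prop)
    (Eventually.of_forall fun ξ => ?_)
  rw [Real.norm_of_nonneg (by positivity), Real.norm_of_nonneg (by positivity), Real.exp_neg,
    Real.rpow_neg (by positivity), Real.rpow_natCast]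
  have hM : 0 < max 1 (((k + 1 : ℕ) : ℝ) / c) := lt_max_of_lt_left one_pos
  rw [inv_eq_one_div, div_le_iff₀ (Real.exp_pos _), mul_right_comm, ← div_eq_mul_inv,
    le_div_iff₀ (by positivity), one_mul]
  have e : Real.exp (c * ‖ξ‖) = Real.exp (c * ‖ξ‖ / (k + 1 : ℕ)) ^ (k + 1) := by
    rw [← Real.exp_nat_mul]; congr 1; field_simp
  rw [e, ← mul_pow]
  gcongr
  have h1 := Real.add_one_le_exp (c * ‖ξ‖ / (k + 1 : ℕ))
  have h2 : ((k + 1 : ℕ) : ℝ) / c ≤ max 1 (((k + 1 : ℕ) : ℝ) / c) := le_max_right _ _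
  have h3 : 1 ≤ max 1 (((k + 1 : ℕ) : ℝ) / c) := le_max_left _ _
  calc 1 + ‖ξ‖ = 1 + (((k + 1 : ℕ) : ℝ) / c) * (c * ‖ξ‖ / (k + 1 : ℕ)) := by field_simp
    _ ≤ max 1 (((k + 1 : ℕ) : ℝ) / c) * 1 +
      max 1 (((k + 1 : ℕ) : ℝ) / c) * (c * ‖ξ‖ / (k + 1 : ℕ)) := by
        rw [mul_one]; gcongr
    _ ≤ _ := by rw [← mul_add]; gcongr; linarith

theorem integrable_div_sinh_one (hN : 1 ≤ N) :
    Integrable fun ξ : EuclideanSpace ℝ (Fin k) =>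
      (‖ξ‖ / Real.sinh ‖ξ‖) ^ ((N : ℝ) / 2) := by
  have hN' : (1 : ℝ) ≤ N := by exact_mod_cast hN
  refine ((integrable_exp_neg_norm (k := k) (c := N / 4) (by positivity)).const_mul
    (4 ^ ((N : ℝ) / 2))).mono ?_ (Eventually.of_forall fun ξ => ?_)
  · have : Measurable fun ξ : EuclideanSpace ℝ (Fin k) =>
      (‖ξ‖ / Real.sinh ‖ξ‖) ^ ((N : ℝ) / 2) := by fun_prop
    exact this.aestronglyMeasurable
  · have h1 := Real.sinh_nonneg_iff.2 (norm_nonneg ξ)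
    rw [Real.norm_of_nonneg (by positivity), Real.norm_of_nonneg (by positivity)]
    refine (Real.rpow_le_rpow (by positivity) (div_sinh_le (norm_nonneg ξ))
      (by positivity)).trans_eq ?_
    rw [Real.mul_rpow (by positivity) (by positivity), ← Real.exp_mul]
    ring_nf

theorem div_sinh_scale {t : ℝ} (ht : 0 < t) (ξ : EuclideanSpace ℝ (Fin k)) :
    (‖ξ‖ / Real.sinh (‖ξ‖ * t)) ^ ((N : ℝ) / 2) = t ^ (-((N : ℝ) / 2)) *
      (‖t • ξ‖ / Real.sinh ‖t • ξ‖) ^ ((N : ℝ) / 2) := by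
  have h1 : 0 ≤ Real.sinh (t * ‖ξ‖) := Real.sinh_nonneg_iff.2 (by positivity)
  rw [norm_smul, Real.norm_of_nonneg ht.le, Real.rpow_neg ht.le, ← Real.inv_rpow ht.le,
    ← Real.mul_rpow (by positivity) (by positivity), mul_comm ‖ξ‖ t]
  congr 1
  field_simp

theorem integrable_div_sinh (hN : 1 ≤ N) {t : ℝ} (ht : 0 < t) :
    Integrable fun ξ : EuclideanSpace ℝ (Fin k) =>
      (‖ξ‖ / Real.sinh (‖ξ‖ * t)) ^ ((N : ℝ) / 2) := by
  simp only [div_sinh_scale ht]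
  exact ((integrable_div_sinh_one hN).comp_smul ht.ne').const_mul _

/-- Dilating `ξ` by `t` contributes `t^{-k}` on top of the factor `t^{-N/2}`; the sum of exponents
is half the homogeneous dimension `N + 2k`. -/
theorem integral_div_sinh {t : ℝ} (ht : 0 < t) :
    ∫ ξ : EuclideanSpace ℝ (Fin k), (‖ξ‖ / Real.sinh (‖ξ‖ * t)) ^ ((N : ℝ) / 2) =
      t ^ (-(((N : ℝ) + 2 * k) / 2)) *
        ∫ ξ : EuclideanSpace ℝ (Fin k), (‖ξ‖ / Real.sinh ‖ξ‖) ^ ((N : ℝ) / 2) := by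
  simp only [div_sinh_scale ht]
  rw [integral_const_mul, Measure.integral_comp_smul volume
    (fun ξ : EuclideanSpace ℝ (Fin k) => (‖ξ‖ / Real.sinh ‖ξ‖) ^ ((N : ℝ) / 2)),
    finrank_euclideanSpace_fin, abs_of_nonneg (by positivity), smul_eq_mul, ← mul_assoc]
  congr 1
  rw [← Real.rpow_natCast, ← Real.rpow_neg ht.le, ← Real.rpow_add ht]
  congr 1
  ring

theorem kernelSymbol_nonneg {t : ℝ} (ht : 0 ≤ t) (x w : EuclideanSpace ℝ (Fin N))
    (ξ : EuclideanSpace ℝ (Fin k)) : 0 ≤ kernelSymbol t x w ξ := by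
  rw [kernelSymbol_eq]
  exact mehlerHyp_nonneg (norm_nonneg _) (by positivity) x w

theorem kernelSymbol_le {t : ℝ} (ht : 0 ≤ t) (x w : EuclideanSpace ℝ (Fin N))
    (ξ : EuclideanSpace ℝ (Fin k)) :
    kernelSymbol t x w ξ ≤ (‖ξ‖ / Real.sinh (‖ξ‖ * t)) ^ ((N : ℝ) / 2) := by
  rw [kernelSymbol_eq]
  exact mehlerHyp_le (norm_nonneg _) (by positivity) x w

theorem measurable_kernelSymbol_right (t : ℝ) (x w : EuclideanSpace ℝ (Fin N)) :
    Measurable fun ξ : EuclideanSpace ℝ (Fin k) => kernelSymbol t x w ξ := by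
  simp only [kernelSymbol_eq]
  fun_prop

theorem integrable_kernelSymbol (hN : 1 ≤ N) {t : ℝ} (ht : 0 < t)
    (x w : EuclideanSpace ℝ (Fin N)) :
    Integrable fun ξ : EuclideanSpace ℝ (Fin k) => kernelSymbol t x w ξ := by
  refine (integrable_div_sinh hN ht).mono
    (measurable_kernelSymbol_right t x w).aestronglyMeasurable
    (Eventually.of_forall fun ξ => ?_)
  rw [Real.norm_of_nonneg (kernelSymbol_nonneg ht.le x w ξ)]
  exact (kernelSymbol_le ht.le x w ξ).trans (le_abs_self _)

theorem kernelSymbol_comm (t : ℝ) (x w : EuclideanSpace ℝ (Fin N))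
    (ξ : EuclideanSpace ℝ (Fin k)) : kernelSymbol t x w ξ = kernelSymbol t w x ξ := by
  rw [kernelSymbol_eq, kernelSymbol_eq]; exact mehler_comm _ _ _ _

theorem integrable_kernelSymbol_mul_cos (hN : 1 ≤ N) {t : ℝ} (ht : 0 < t)
    (x w : EuclideanSpace ℝ (Fin N)) (y : EuclideanSpace ℝ (Fin k)) :
    Integrable fun ξ : EuclideanSpace ℝ (Fin k) =>
      kernelSymbol t x w ξ * Real.cos (inner ℝ ξ y) := by
  refine (integrable_kernelSymbol hN ht x w).mul_bdd (c := 1) ?_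
    (Eventually.of_forall fun ξ => Real.abs_cos_le_one _)
  fun_prop

theorem heatKernel_eq (hN : 1 ≤ N) {t : ℝ} (ht : 0 < t) (x w : EuclideanSpace ℝ (Fin N))
    (y : EuclideanSpace ℝ (Fin k)) :
    heatKernel t x w y = (2 * Real.pi) ^ (-(((N : ℝ) + 2 * k) / 2)) *
      ∫ ξ : EuclideanSpace ℝ (Fin k), kernelSymbol t x w ξ * Real.cos (inner ℝ ξ y) := by
  unfold heatKernel heatKernelC
  rw [Complex.re_ofReal_mul]
  congr 1
  have hi : Integrable fun ξ : EuclideanSpace ℝ (Fin k) =>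
      (kernelSymbol t x w ξ : ℂ) * Complex.exp (Complex.I * ((inner ℝ ξ y : ℝ) : ℂ)) := by
    refine (integrable_kernelSymbol hN ht x w).ofReal.mul_bdd (c := 1) (by fun_prop)
      (Eventually.of_forall fun ξ => ?_)
    rw [mul_comm, Complex.norm_exp_ofReal_mul_I]
  rw [← RCLike.re_eq_complex_re, ← integral_re hi]
  refine integral_congr_ae (Eventually.of_forall fun ξ => ?_)
  simp only [RCLike.re_eq_complex_re]
  rw [Complex.re_ofReal_mul, mul_comm Complex.I, Complex.exp_ofReal_mul_I_re]

theorem heatKernel_comm (t : ℝ) (x w : EuclideanSpace ℝ (Fin N))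
    (y : EuclideanSpace ℝ (Fin k)) : heatKernel t x w y = heatKernel t w x y := by
  unfold heatKernel heatKernelC
  simp only [kernelSymbol_comm t x w]

theorem heatKernel_neg (hN : 1 ≤ N) {t : ℝ} (ht : 0 < t) (x w : EuclideanSpace ℝ (Fin N))
    (y : EuclideanSpace ℝ (Fin k)) : heatKernel t x w (-y) = heatKernel t x w y := by
  rw [heatKernel_eq hN ht, heatKernel_eq hN ht]
  simp only [inner_neg_right, Real.cos_neg]

/-- The constant in the uniform bound of the heat kernel. -/
noncomputable def kernelBound (N k : ℕ) : ℝ :=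
  (2 * Real.pi) ^ (-(((N : ℝ) + 2 * k) / 2)) *
    ∫ ξ : EuclideanSpace ℝ (Fin k), (‖ξ‖ / Real.sinh ‖ξ‖) ^ ((N : ℝ) / 2)

theorem kernelBound_nonneg (N k : ℕ) : 0 ≤ kernelBound N k := by
  unfold kernelBound
  refine mul_nonneg (by positivity) (integral_nonneg fun ξ => ?_)
  have := Real.sinh_nonneg_iff.2 (norm_nonneg ξ)
  positivity

theorem heatKernel_le (hN : 1 ≤ N) {t : ℝ} (ht : 0 < t) (x w : EuclideanSpace ℝ (Fin N))
    (y : EuclideanSpace ℝ (Fin k)) :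
    heatKernel t x w y ≤ kernelBound N k * t ^ (-(((N : ℝ) + 2 * k) / 2)) := by
  rw [heatKernel_eq hN ht, kernelBound, mul_assoc, mul_comm (∫ _, _), ← integral_div_sinh ht]
  gcongr
  · exact integrable_kernelSymbol_mul_cos hN ht x w y
  · exact integrable_div_sinh hN ht
  · intro ξ
    exact (mul_le_of_le_one_right (kernelSymbol_nonneg ht.le x w ξ) (Real.cos_le_one _)).trans
      (kernelSymbol_le ht.le x w ξ)

/-- The angle of a step is `hs + o(h)`, so `n + 1` steps of length `t/(n + 1)` accumulate `st`, and
`sinh θ / h` tends to `s`. Convergence of these two parameters suffices. -/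
theorem tendsto_trotter {s t : ℝ} (hs : 0 < s) (ht : 0 < t) (x w : EuclideanSpace ℝ (Fin N)) :
    Tendsto (fun n : ℕ => mehlerHyp (Real.sinh (trotterAngle (t / (n + 1 : ℕ)) s) /
      (t / (n + 1 : ℕ))) ((n + 1 : ℕ) * trotterAngle (t / (n + 1 : ℕ)) s) x w) atTop
      (𝓝 (mehlerHyp s (s * t) x w)) := by
  have hh : Tendsto (fun n : ℕ => t / ((n + 1 : ℕ) : ℝ)) atTop (𝓝 0) :=
    (tendsto_const_div_atTop_nhds_zero_nat t).comp (tendsto_add_atTop_nat 1)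
  have hc : Tendsto (fun n : ℕ => Real.sinh (trotterAngle (t / (n + 1 : ℕ)) s) /
      (t / (n + 1 : ℕ))) atTop (𝓝 s) := by
    have h1 : Tendsto (fun h : ℝ => s * √(1 + (h * s / 2) ^ 2)) (𝓝 0) (𝓝 s) := by
      have : Continuous fun h : ℝ => s * √(1 + (h * s / 2) ^ 2) := by fun_prop
      simpa using this.tendsto 0
    refine (h1.comp hh).congr fun n => ?_
    have : 0 < t / ((n + 1 : ℕ) : ℝ) := by positivity
    rw [Function.comp_apply, sinh_trotterAngle, eq_div_iff this.ne']
    ring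
  have hσ : Tendsto (fun n : ℕ => ((n + 1 : ℕ) : ℝ) * trotterAngle (t / (n + 1 : ℕ)) s) atTop
      (𝓝 (s * t)) := by
    have hd : HasDerivAt (fun h : ℝ => trotterAngle h s) s 0 := by
      have h1 : HasDerivAt (fun h : ℝ => h * s / 2) (s / 2) 0 := by
        simpa using ((hasDerivAt_id (0 : ℝ)).mul_const s).div_const 2
      exact ((h1.arsinh).const_mul 2).congr_deriv (by simp; ring)
    have h3 := hd.tendsto_slope_zero_right
    have h4 : Tendsto (fun n : ℕ => t / ((n + 1 : ℕ) : ℝ)) atTop (𝓝[>] 0) :=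
      tendsto_nhdsWithin_iff.2 ⟨hh, Eventually.of_forall fun n => by
        simp only [mem_Ioi]; positivity⟩
    refine ((h3.comp h4).mul_const t).congr fun n => ?_
    simp only [Function.comp_def, smul_eq_mul, zero_add]
    have : trotterAngle 0 s = 0 := by simp [trotterAngle]
    rw [this, sub_zero]
    field_simp
  have hsinh : Real.sinh (s * t) ≠ 0 := (Real.sinh_pos_iff.2 (by positivity)).ne'
  have hA := hc.mul (((Real.continuous_cosh.tendsto _).comp hσ).div
    ((Real.continuous_sinh.tendsto _).comp hσ) hsinh)
  have hB := hc.div ((Real.continuous_sinh.tendsto _).comp hσ) hsinh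
  unfold mehlerHyp mehler
  exact (hB.rpow_const (Or.inr (by positivity))).mul
    ((Real.continuous_exp.tendsto _).comp
      (((hA.div_const 2).neg.mul_const _).add (hB.mul_const _)))

/-- Limit of `integral_trotter_nonneg`. The Trotter kernels are bounded by `(1/t)^{N/2}` uniformly
in `n`, and the Gaussian factor supplies the decay in `ξ` that this bound lacks. -/
theorem integral_kernelSymbol_gauss_cos_nonneg (hk : 1 ≤ k) {t : ℝ} (ht : 0 < t)
    (x w : EuclideanSpace ℝ (Fin N)) {ε : ℝ} (hε : 0 < ε) (y : EuclideanSpace ℝ (Fin k)) :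
    0 ≤ ∫ ξ : EuclideanSpace ℝ (Fin k), kernelSymbol t x w ξ *
      (Real.exp (-ε * ‖ξ‖ ^ 2) * Real.cos (inner ℝ ξ y)) := by
  refine ge_of_tendsto' (f := fun n : ℕ => ∫ ξ : EuclideanSpace ℝ (Fin k),
      mehlerHyp (Real.sinh (trotterAngle (t / (n + 1 : ℕ)) ‖ξ‖) / (t / (n + 1 : ℕ)))
        ((n + 1 : ℕ) * trotterAngle (t / (n + 1 : ℕ)) ‖ξ‖) x w *
        (Real.exp (-ε * ‖ξ‖ ^ 2) * Real.cos (inner ℝ ξ y))) (x := atTop) ?_ fun n =>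
        integral_trotter_nonneg hk (by positivity) n x w hε y
  refine tendsto_integral_of_dominated_convergence
    (fun ξ => (1 / t) ^ ((N : ℝ) / 2) * Real.exp (-ε * ‖ξ‖ ^ 2)) (fun n => ?_)
    ((integrable_gauss hε).const_mul _) (fun n => ?_) ?_
  · refine Measurable.aestronglyMeasurable ?_
    fun_prop
  · filter_upwards [ae_ne_zero hk] with ξ hξ
    have hs := norm_pos_iff.2 hξ
    have hh : 0 < t / ((n + 1 : ℕ) : ℝ) := by positivity
    have b1 := mehlerHyp_trotter_le hh hs n x w
    have b0 := mehlerHyp_trotter_nonneg hh hs n x w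
    have : t / ((n + 1 : ℕ) : ℝ) * (n + 1 : ℕ) = t := by field_simp
    rw [this] at b1
    simp only [norm_mul, Real.norm_of_nonneg b0, Real.norm_of_nonneg (Real.exp_nonneg _)]
    have c1 : ‖Real.cos (inner ℝ ξ y)‖ ≤ 1 := Real.abs_cos_le_one _
    calc _ ≤ (1 / t) ^ ((N : ℝ) / 2) * (Real.exp (-ε * ‖ξ‖ ^ 2) * 1) := by gcongr
      _ = _ := by rw [mul_one]
  · filter_upwards [ae_ne_zero hk] with ξ hξ
    rw [kernelSymbol_eq]
    exact (tendsto_trotter (norm_pos_iff.2 hξ) ht x w).mul_const _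

/-- The damping is removed by letting `ε → 0`; now the integrable symbol itself dominates. -/
theorem heatKernel_nonneg (hN : 1 ≤ N) (hk : 1 ≤ k) {t : ℝ} (ht : 0 < t)
    (x w : EuclideanSpace ℝ (Fin N)) (y : EuclideanSpace ℝ (Fin k)) :
    0 ≤ heatKernel t x w y := by
  rw [heatKernel_eq hN ht]
  refine mul_nonneg (by positivity) ?_
  refine ge_of_tendsto' (f := fun n : ℕ => ∫ ξ : EuclideanSpace ℝ (Fin k), kernelSymbol t x w ξ *
      (Real.exp (-(1 / ((n : ℝ) + 1)) * ‖ξ‖ ^ 2) * Real.cos (inner ℝ ξ y))) (x := atTop) ?_ fun n =>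
        integral_kernelSymbol_gauss_cos_nonneg hk ht x w (by positivity) y
  have hm := measurable_kernelSymbol_right (k := k) t x w
  refine tendsto_integral_of_dominated_convergence (fun ξ => kernelSymbol t x w ξ) (fun n => ?_)
    (integrable_kernelSymbol hN ht x w) (fun n => Eventually.of_forall fun ξ => ?_)
    (Eventually.of_forall fun ξ => ?_)
  · refine Measurable.aestronglyMeasurable (hm.mul ?_)
    fun_prop
  · have b0 := kernelSymbol_nonneg ht.le x w ξ
    simp only [norm_mul, Real.norm_of_nonneg b0, Real.norm_of_nonneg (Real.exp_nonneg _)]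
    have c1 : ‖Real.cos (inner ℝ ξ y)‖ ≤ 1 := Real.abs_cos_le_one _
    have c2 : Real.exp (-(1 / ((n : ℝ) + 1)) * ‖ξ‖ ^ 2) ≤ 1 := by
      refine Real.exp_le_one_iff.2 ?_
      rw [neg_mul, neg_nonpos]
      positivity
    exact mul_le_of_le_one_right b0 (mul_le_one₀ c2 (norm_nonneg _) c1)
  · have h1 : Tendsto (fun n : ℕ => Real.exp (-(1 / ((n : ℝ) + 1)) * ‖ξ‖ ^ 2)) atTop (𝓝 1) := by
      have := (tendsto_one_div_add_atTop_nhds_zero_nat (𝕜 := ℝ)).neg.mul_const (‖ξ‖ ^ 2)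
      simpa [Function.comp_def] using (Real.continuous_exp.tendsto _).comp this
    simpa using (h1.mul_const (Real.cos (inner ℝ ξ y))).const_mul (kernelSymbol t x w ξ)

theorem continuous_kernelSymbol (t : ℝ) (ξ : EuclideanSpace ℝ (Fin k)) :
    Continuous fun q : EuclideanSpace ℝ (Fin N) × EuclideanSpace ℝ (Fin N) =>
      kernelSymbol t q.1 q.2 ξ := by
  unfold kernelSymbol
  fun_prop

theorem continuous_heatKernel (hN : 1 ≤ N) {t : ℝ} (ht : 0 < t) :
    Continuous fun q : (EuclideanSpace ℝ (Fin N) × EuclideanSpace ℝ (Fin N)) ×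
      EuclideanSpace ℝ (Fin k) => heatKernel t q.1.1 q.1.2 q.2 := by
  simp only [heatKernel_eq hN ht]
  refine continuous_const.mul (continuous_of_dominated
    (bound := fun ξ : EuclideanSpace ℝ (Fin k) => (‖ξ‖ / Real.sinh (‖ξ‖ * t)) ^ ((N : ℝ) / 2))
    (fun q => (integrable_kernelSymbol_mul_cos hN ht _ _ _).aestronglyMeasurable)
    (fun q => Eventually.of_forall fun ξ => ?_) (integrable_div_sinh hN ht)
    (Eventually.of_forall fun ξ => ?_))
  · have b0 := kernelSymbol_nonneg ht.le q.1.1 q.1.2 ξ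
    rw [norm_mul, Real.norm_of_nonneg b0]
    exact (mul_le_of_le_one_right b0 (Real.abs_cos_le_one _)).trans (kernelSymbol_le ht.le _ _ ξ)
  · have := (continuous_kernelSymbol (N := N) t ξ).comp
      (continuous_fst (X := EuclideanSpace ℝ (Fin N) × EuclideanSpace ℝ (Fin N))
        (Y := EuclideanSpace ℝ (Fin k)))
    exact this.mul (by fun_prop)

end KernelBounds

/-! ### Gaussian-weighted mass of the heat kernel. -/

section Mass

variable {N k : ℕ}

theorem _root_.Continuous.heatKernel (hN : 1 ≤ N) {t : ℝ} (ht : 0 < t) {X : Type*}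
    [TopologicalSpace X] {f g : X → EuclideanSpace ℝ (Fin N)} {h : X → EuclideanSpace ℝ (Fin k)}
    (hf : Continuous f) (hg : Continuous g) (hh : Continuous h) :
    Continuous fun q => Grushin.heatKernel t (f q) (g q) (h q) :=
  Continuous.comp (g := fun q : (EuclideanSpace ℝ (Fin N) × EuclideanSpace ℝ (Fin N)) ×
      EuclideanSpace ℝ (Fin k) => Grushin.heatKernel t q.1.1 q.1.2 q.2)
    (f := fun q => ((f q, g q), h q)) (continuous_heatKernel hN ht) ((hf.prodMk hg).prodMk hh)

theorem integrable_heatKernel_mul_gauss (hN : 1 ≤ N) (hk : 1 ≤ k) {t : ℝ} (ht : 0 < t)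
    (x w : EuclideanSpace ℝ (Fin N)) {ε : ℝ} (hε : 0 < ε) :
    Integrable fun y : EuclideanSpace ℝ (Fin k) =>
      heatKernel t x w y * Real.exp (-ε * ‖y‖ ^ 2) := by
  refine (integrable_gauss hε).bdd_mul (c := kernelBound N k * t ^ (-(((N : ℝ) + 2 * k) / 2)))
    ?_ (Eventually.of_forall fun y => ?_)
  · exact (Continuous.heatKernel hN ht continuous_const continuous_const
      continuous_id).aestronglyMeasurable
  · rw [Real.norm_of_nonneg (heatKernel_nonneg hN hk ht x w y)]
    exact heatKernel_le hN ht x w y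

/-- The Gaussian in `y` makes Fubini legitimate and is transformed into a Gaussian in `ξ` of inverse
width. -/
theorem integral_heatKernel_mul_gauss (hN : 1 ≤ N) {t : ℝ} (ht : 0 < t)
    (x w : EuclideanSpace ℝ (Fin N)) {ε : ℝ} (hε : 0 < ε) :
    ∫ y : EuclideanSpace ℝ (Fin k), heatKernel t x w y * Real.exp (-ε * ‖y‖ ^ 2) =
      (2 * Real.pi) ^ (-(((N : ℝ) + 2 * k) / 2)) * (Real.pi / ε) ^ ((k : ℝ) / 2) *
        ∫ ξ : EuclideanSpace ℝ (Fin k),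
          kernelSymbol t x w ξ * Real.exp (-(1 / (4 * ε)) * ‖ξ‖ ^ 2) := by
  have e1 : ∀ y : EuclideanSpace ℝ (Fin k), heatKernel t x w y * Real.exp (-ε * ‖y‖ ^ 2) =
      (2 * Real.pi) ^ (-(((N : ℝ) + 2 * k) / 2)) * ∫ ξ : EuclideanSpace ℝ (Fin k),
        kernelSymbol t x w ξ * (Real.exp (-ε * ‖y‖ ^ 2) * Real.cos (inner ℝ y ξ)) := by
    intro y
    rw [heatKernel_eq hN ht, mul_assoc, ← integral_mul_const]
    congr 2
    ext ξ
    rw [real_inner_comm]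
    ring
  simp only [e1]
  rw [integral_const_mul, mul_assoc]
  congr 1
  rw [integral_integral_swap, ← integral_const_mul]
  · congr 1
    ext ξ
    rw [integral_const_mul, integral_gauss_cos hε]
    ring
  · refine (((integrable_gauss (k := k) hε).mul_prod
      (integrable_kernelSymbol (k := k) hN ht x w))).mono ?_ (Eventually.of_forall fun q => ?_)
    · have hm : Measurable fun q : EuclideanSpace ℝ (Fin k) × EuclideanSpace ℝ (Fin k) =>
        kernelSymbol t x w q.2 := (measurable_kernelSymbol_right t x w).comp measurable_snd
      exact (hm.mul (by fun_prop)).aestronglyMeasurable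
    · simp only [Function.uncurry_def, norm_mul]
      have c1 : ‖Real.cos (inner ℝ q.1 q.2)‖ ≤ 1 := Real.abs_cos_le_one _
      calc _ ≤ ‖kernelSymbol t x w q.2‖ * (‖Real.exp (-ε * ‖q.1‖ ^ 2)‖ * 1) := by gcongr
        _ = _ := by ring

/-- The Gaussian-weighted mass of `kernelSymbol` in the second space variable, up to
`(2π)^{N/2}`. -/
noncomputable def massFactor (t κ : ℝ) (x : EuclideanSpace ℝ (Fin N))
    (ξ : EuclideanSpace ℝ (Fin k)) : ℝ :=
  (‖ξ‖ / Real.sinh (‖ξ‖ * t) / (‖ξ‖ * (Real.cosh (‖ξ‖ * t) / Real.sinh (‖ξ‖ * t)) + κ)) ^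
      ((N : ℝ) / 2) *
    Real.exp (-(‖x‖ ^ 2 / (2 * (‖ξ‖ * (Real.cosh (‖ξ‖ * t) / Real.sinh (‖ξ‖ * t)) + κ))) *
      (((‖ξ‖ * (Real.cosh (‖ξ‖ * t) / Real.sinh (‖ξ‖ * t))) ^ 2 -
        (‖ξ‖ / Real.sinh (‖ξ‖ * t)) ^ 2) +
        2 * κ * (‖ξ‖ * (Real.cosh (‖ξ‖ * t) / Real.sinh (‖ξ‖ * t)) -
          ‖ξ‖ / Real.sinh (‖ξ‖ * t))))

theorem div_sinh_le_mul_coth {t : ℝ} (ht : 0 ≤ t) (ξ : EuclideanSpace ℝ (Fin k)) :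
    ‖ξ‖ / Real.sinh (‖ξ‖ * t) ≤ ‖ξ‖ * (Real.cosh (‖ξ‖ * t) / Real.sinh (‖ξ‖ * t)) := by
  have h1 : 0 ≤ Real.sinh (‖ξ‖ * t) := Real.sinh_nonneg_iff.2 (by positivity)
  rw [div_eq_mul_one_div]
  have := Real.one_le_cosh (‖ξ‖ * t)
  gcongr

theorem massFactor_nonneg {t κ : ℝ} (ht : 0 ≤ t) (hκ : 0 ≤ κ) (x : EuclideanSpace ℝ (Fin N))
    (ξ : EuclideanSpace ℝ (Fin k)) : 0 ≤ massFactor t κ x ξ := by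
  have h1 : 0 ≤ Real.sinh (‖ξ‖ * t) := Real.sinh_nonneg_iff.2 (by positivity)
  have h2 := Real.cosh_pos (‖ξ‖ * t)
  unfold massFactor
  positivity

/-- With `a = |ξ| coth(|ξ|t)` and `b = |ξ| csch(|ξ|t)`, the inequality `b ≤ a` bounds the base `b/(a
+ κ)` by one and makes the exponent nonpositive. -/
theorem massFactor_le_one {t κ : ℝ} (ht : 0 ≤ t) (hκ : 0 ≤ κ) (x : EuclideanSpace ℝ (Fin N))
    (ξ : EuclideanSpace ℝ (Fin k)) : massFactor t κ x ξ ≤ 1 := by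
  have h1 : 0 ≤ Real.sinh (‖ξ‖ * t) := Real.sinh_nonneg_iff.2 (by positivity)
  have h2 := Real.cosh_pos (‖ξ‖ * t)
  have h3 := div_sinh_le_mul_coth ht ξ
  have h4 : 0 ≤ ‖ξ‖ / Real.sinh (‖ξ‖ * t) := by positivity
  unfold massFactor
  set a := ‖ξ‖ * (Real.cosh (‖ξ‖ * t) / Real.sinh (‖ξ‖ * t))
  set b := ‖ξ‖ / Real.sinh (‖ξ‖ * t)
  have ha : 0 ≤ a := h4.trans h3
  refine mul_le_one₀ (Real.rpow_le_one (by positivity) (div_le_one_of_le₀ (by linarith)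
    (by positivity)) (by positivity)) (by positivity) (Real.exp_le_one_iff.2 ?_)
  rw [neg_mul, neg_nonpos]
  refine mul_nonneg (by positivity) (add_nonneg ?_ (mul_nonneg (by positivity) (by linarith)))
  nlinarith

@[fun_prop]
theorem measurable_massFactor (t κ : ℝ) (x : EuclideanSpace ℝ (Fin N)) :
    Measurable fun ξ : EuclideanSpace ℝ (Fin k) => massFactor t κ x ξ := by
  unfold massFactor
  fun_prop

theorem lintegral_kernelSymbol_mul_gauss {t κ : ℝ} (ht : 0 < t) (hκ : 0 ≤ κ)
    (x : EuclideanSpace ℝ (Fin N)) {ξ : EuclideanSpace ℝ (Fin k)} (hξ : ξ ≠ 0) :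
    ∫⁻ w, ENNReal.ofReal (kernelSymbol t x w ξ * Real.exp (-(κ / 2) * ‖w - x‖ ^ 2)) =
      ENNReal.ofReal ((2 * Real.pi) ^ ((N : ℝ) / 2) * massFactor t κ x ξ) := by
  have hs := norm_pos_iff.2 hξ
  have h1 : 0 < Real.sinh (‖ξ‖ * t) := Real.sinh_pos_iff.2 (by positivity)
  have h2 := Real.cosh_pos (‖ξ‖ * t)
  have hnn : ∀ w, 0 ≤ kernelSymbol t x w ξ * Real.exp (-(κ / 2) * ‖w - x‖ ^ 2) := fun w =>
    mul_nonneg (kernelSymbol_nonneg ht.le x w ξ) (Real.exp_nonneg _)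
  have hi := integrable_mehler_mul_gauss (b := ‖ξ‖ / Real.sinh (‖ξ‖ * t))
    (a := ‖ξ‖ * (Real.cosh (‖ξ‖ * t) / Real.sinh (‖ξ‖ * t))) (κ := κ) (by positivity) x x
  have hv := integral_mehler_mul_gauss (b := ‖ξ‖ / Real.sinh (‖ξ‖ * t))
    (a := ‖ξ‖ * (Real.cosh (‖ξ‖ * t) / Real.sinh (‖ξ‖ * t))) (κ := κ) (by positivity)
    (by positivity) x
  simp only [kernelSymbol_eq] at hnn ⊢
  exact (ofReal_integral_eq_lintegral_ofReal hi (Eventually.of_forall hnn)).symm.trans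
    (congrArg _ hv)

/-- Nonnegativity of kernel and symbol lets the integrals be exchanged by Tonelli. By
`gauss_normalization` the right side is an average of `massFactor` against a probability density in
`ξ`, so mass questions reduce to pointwise facts on `massFactor`. -/
theorem lintegral_heatKernel_mul_gauss (hN : 1 ≤ N) (hk : 1 ≤ k) {t κ ε : ℝ} (ht : 0 < t)
    (hκ : 0 ≤ κ) (hε : 0 < ε) (x : EuclideanSpace ℝ (Fin N)) :
    ∫⁻ w : Space N k, ENNReal.ofReal (heatKernel t x w.1 w.2 * Real.exp (-ε * ‖w.2‖ ^ 2) *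
        Real.exp (-(κ / 2) * ‖w.1 - x‖ ^ 2)) =
      ENNReal.ofReal ((2 * Real.pi) ^ (-(k : ℝ)) * (Real.pi / ε) ^ ((k : ℝ) / 2) *
        ∫ ξ : EuclideanSpace ℝ (Fin k),
          massFactor t κ x ξ * Real.exp (-(1 / (4 * ε)) * ‖ξ‖ ^ 2)) := by
  have hmeas : Measurable fun w : Space N k => ENNReal.ofReal
      (heatKernel t x w.1 w.2 * Real.exp (-ε * ‖w.2‖ ^ 2) *
        Real.exp (-(κ / 2) * ‖w.1 - x‖ ^ 2)) := by
    have : Continuous fun w : Space N k => heatKernel t x w.1 w.2 :=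
      Continuous.heatKernel hN ht continuous_const continuous_fst continuous_snd
    exact ((this.mul (by fun_prop)).mul (by fun_prop)).measurable.ennreal_ofReal
  rw [Measure.volume_eq_prod, lintegral_prod _ hmeas.aemeasurable]
  set A : ℝ := (2 * Real.pi) ^ (-(((N : ℝ) + 2 * k) / 2)) * (Real.pi / ε) ^ ((k : ℝ) / 2)
  have hA : 0 ≤ A := by positivity
  have hg : Integrable fun ξ : EuclideanSpace ℝ (Fin k) =>
      Real.exp (-(1 / (4 * ε)) * ‖ξ‖ ^ 2) := integrable_gauss (by positivity)
  have inner_eq : ∀ v : EuclideanSpace ℝ (Fin N),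
      ∫⁻ y : EuclideanSpace ℝ (Fin k), ENNReal.ofReal
        (heatKernel t x v y * Real.exp (-ε * ‖y‖ ^ 2) * Real.exp (-(κ / 2) * ‖v - x‖ ^ 2)) =
      ENNReal.ofReal A * ∫⁻ ξ : EuclideanSpace ℝ (Fin k),
        ENNReal.ofReal (kernelSymbol t x v ξ * Real.exp (-(κ / 2) * ‖v - x‖ ^ 2)) *
          ENNReal.ofReal (Real.exp (-(1 / (4 * ε)) * ‖ξ‖ ^ 2)) := by
    intro v
    rw [← ofReal_integral_eq_lintegral_ofReal
      ((integrable_heatKernel_mul_gauss hN hk ht x v hε).mul_const _)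
      (Eventually.of_forall fun y => mul_nonneg (mul_nonneg (heatKernel_nonneg hN hk ht x v y)
        (Real.exp_nonneg _)) (Real.exp_nonneg _)), integral_mul_const,
      integral_heatKernel_mul_gauss hN ht x v hε, mul_assoc A, ENNReal.ofReal_mul hA,
      ← integral_mul_const, ofReal_integral_eq_lintegral_ofReal]
    · congr 2
      ext ξ
      rw [← ENNReal.ofReal_mul (mul_nonneg (kernelSymbol_nonneg ht.le x v ξ) (Real.exp_nonneg _))]
      ring_nf
    · refine Integrable.mul_const ?_ _
      refine (integrable_kernelSymbol hN ht x v).mul_bdd (c := 1) (by fun_prop)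
        (Eventually.of_forall fun ξ => ?_)
      rw [Real.norm_of_nonneg (Real.exp_nonneg _)]
      refine Real.exp_le_one_iff.2 ?_
      rw [neg_mul, neg_nonpos]
      positivity
    · exact Eventually.of_forall fun ξ => mul_nonneg (mul_nonneg (kernelSymbol_nonneg ht.le x v ξ)
        (Real.exp_nonneg _)) (Real.exp_nonneg _)
  simp only [inner_eq]
  have hmS : Measurable fun q : EuclideanSpace ℝ (Fin N) × EuclideanSpace ℝ (Fin k) =>
      kernelSymbol t x q.1 q.2 := by
    simp only [kernelSymbol_eq]
    fun_prop
  have hmS2 : Measurable fun q : EuclideanSpace ℝ (Fin N) × EuclideanSpace ℝ (Fin k) =>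
      ENNReal.ofReal (kernelSymbol t x q.1 q.2 * Real.exp (-(κ / 2) * ‖q.1 - x‖ ^ 2)) *
          ENNReal.ofReal (Real.exp (-(1 / (4 * ε)) * ‖q.2‖ ^ 2)) :=
    (hmS.mul (by fun_prop)).ennreal_ofReal.mul (by fun_prop)
  rw [lintegral_const_mul' _ _ ENNReal.ofReal_ne_top,
    lintegral_lintegral_swap hmS2.aemeasurable]
  have outer_eq : ∀ᵐ ξ : EuclideanSpace ℝ (Fin k), (∫⁻ v : EuclideanSpace ℝ (Fin N),
        ENNReal.ofReal (kernelSymbol t x v ξ * Real.exp (-(κ / 2) * ‖v - x‖ ^ 2)) *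
          ENNReal.ofReal (Real.exp (-(1 / (4 * ε)) * ‖ξ‖ ^ 2))) =
      ENNReal.ofReal ((2 * Real.pi) ^ ((N : ℝ) / 2)) *
      ENNReal.ofReal (massFactor t κ x ξ * Real.exp (-(1 / (4 * ε)) * ‖ξ‖ ^ 2)) := by
    filter_upwards [ae_ne_zero hk] with ξ hξ
    rw [lintegral_mul_const' _ _ ENNReal.ofReal_ne_top, lintegral_kernelSymbol_mul_gauss ht hκ x hξ,
      ENNReal.ofReal_mul (by positivity), mul_assoc,
      ← ENNReal.ofReal_mul (massFactor_nonneg ht.le hκ x ξ)]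
  rw [lintegral_congr_ae outer_eq, lintegral_const_mul' _ _ ENNReal.ofReal_ne_top,
    ← ofReal_integral_eq_lintegral_ofReal, ← ENNReal.ofReal_mul (by positivity),
    ← ENNReal.ofReal_mul hA, ← mul_assoc]
  · congr 2
    have : (2 * Real.pi) ^ (-(k : ℝ)) = (2 * Real.pi) ^ (-(((N : ℝ) + 2 * k) / 2)) *
        (2 * Real.pi) ^ ((N : ℝ) / 2) := by
      rw [← Real.rpow_add (by positivity)]; congr 1; ring
    rw [this]
    ring
  · refine hg.bdd_mul (c := 1) (measurable_massFactor t κ x).aestronglyMeasurable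
      (Eventually.of_forall fun ξ => ?_)
    rw [Real.norm_of_nonneg (massFactor_nonneg ht.le hκ x ξ)]
    exact massFactor_le_one ht.le hκ x ξ
  · exact Eventually.of_forall fun ξ => mul_nonneg (massFactor_nonneg ht.le hκ x ξ)
      (Real.exp_nonneg _)

theorem gauss_normalization {ε : ℝ} (hε : 0 < ε) :
    (2 * Real.pi) ^ (-(k : ℝ)) * (Real.pi / ε) ^ ((k : ℝ) / 2) *
      ∫ ξ : EuclideanSpace ℝ (Fin k), Real.exp (-(1 / (4 * ε)) * ‖ξ‖ ^ 2) = 1 := by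
  have h := integral_gauss_cos (k := k) (ε := 1 / (4 * ε)) (by positivity) 0
  simp only [inner_zero_right, Real.cos_zero, mul_one, norm_zero] at h
  rw [h]
  simp only [ne_eq, OfNat.ofNat_ne_zero, not_false_eq_true, zero_pow, mul_zero, Real.exp_zero,
    mul_one]
  rw [mul_assoc, ← Real.mul_rpow (by positivity) (by positivity)]
  have : Real.pi / ε * (Real.pi / (1 / (4 * ε))) = (2 * Real.pi) ^ (2 : ℝ) := by
    rw [Real.rpow_two]; field_simp; ring
  rw [this, ← Real.rpow_mul (by positivity), ← Real.rpow_add (by positivity)]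
  rw [show -(k : ℝ) + 2 * ((k : ℝ) / 2) = 0 by ring, Real.rpow_zero]

/-- Fatou's lemma along `ε = 1/(n + 1)`: a bound that survives all Gaussian dampings holds without
damping. -/
theorem lintegral_le_of_gauss {α : Type*} [MeasurableSpace α] {μ : Measure α} {f g : α → ℝ}
    (hf : Measurable f) (hg : Measurable g) {C : ℝ≥0∞}
    (h : ∀ ε > 0, ∫⁻ a, ENNReal.ofReal (f a * Real.exp (-ε * g a)) ∂μ ≤ C) :
    ∫⁻ a, ENNReal.ofReal (f a) ∂μ ≤ C := by
  have ht : ∀ a, Tendsto (fun n : ℕ => ENNReal.ofReal (f a * Real.exp (-(1 / ((n : ℝ) + 1)) * g a)))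
      atTop (𝓝 (ENNReal.ofReal (f a))) := by
    intro a
    refine ENNReal.tendsto_ofReal ?_
    have h1 := (tendsto_one_div_add_atTop_nhds_zero_nat (𝕜 := ℝ)).neg.mul_const (g a)
    have h2 := ((Real.continuous_exp.tendsto _).comp h1).const_mul (f a)
    simpa [Function.comp_def] using h2
  calc ∫⁻ a, ENNReal.ofReal (f a) ∂μ = ∫⁻ a, liminf (fun n : ℕ =>
        ENNReal.ofReal (f a * Real.exp (-(1 / ((n : ℝ) + 1)) * g a))) atTop ∂μ := by
        congr 1; ext a; exact (ht a).liminf_eq.symm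
    _ ≤ liminf (fun n : ℕ => ∫⁻ a, ENNReal.ofReal
        (f a * Real.exp (-(1 / ((n : ℝ) + 1)) * g a)) ∂μ) atTop :=
        lintegral_liminf_le fun n => by fun_prop
    _ ≤ C := by
      refine liminf_le_of_frequently_le' (Eventually.of_forall fun n => ?_).frequently
      exact h _ (by positivity)

theorem lintegral_heatKernel_le_one (hN : 1 ≤ N) (hk : 1 ≤ k) {t : ℝ} (ht : 0 < t)
    (x : EuclideanSpace ℝ (Fin N)) :
    ∫⁻ w : Space N k, ENNReal.ofReal (heatKernel t x w.1 w.2) ≤ 1 := by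
  have hc : Continuous fun w : Space N k => heatKernel t x w.1 w.2 :=
    Continuous.heatKernel hN ht continuous_const continuous_fst continuous_snd
  refine lintegral_le_of_gauss (g := fun w : Space N k => ‖w.2‖ ^ 2) hc.measurable
    (by fun_prop) fun ε hε => ?_
  have h := lintegral_heatKernel_mul_gauss hN hk ht le_rfl hε x
  simp only [zero_div, neg_zero, zero_mul, Real.exp_zero, mul_one] at h
  rw [h, ← ENNReal.ofReal_one]
  refine ENNReal.ofReal_le_ofReal ?_
  refine le_of_le_of_eq ?_ (gauss_normalization (k := k) hε)
  have hg : Integrable fun ξ : EuclideanSpace ℝ (Fin k) =>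
      Real.exp (-(1 / (4 * ε)) * ‖ξ‖ ^ 2) := integrable_gauss (by positivity)
  gcongr
  · refine hg.bdd_mul (c := 1) (measurable_massFactor t 0 x).aestronglyMeasurable
      (Eventually.of_forall fun ξ => ?_)
    rw [Real.norm_of_nonneg (massFactor_nonneg ht.le le_rfl x ξ)]
    exact massFactor_le_one ht.le le_rfl x ξ
  · intro ξ
    exact mul_le_of_le_one_left (Real.exp_nonneg _) (massFactor_le_one ht.le le_rfl x ξ)

/-- Clearing the factor `sinh(‖ξ‖t)` removes the singularities at `t = 0`; the identity `a² - b² =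
‖ξ‖²` simplifies the exponent beforehand. -/
theorem tendsto_massFactor {κ : ℝ} (x : EuclideanSpace ℝ (Fin N))
    {ξ : EuclideanSpace ℝ (Fin k)} (hξ : ξ ≠ 0) :
    Tendsto (fun t => massFactor t κ x ξ) (𝓝[>] 0) (𝓝 1) := by
  have hs := norm_pos_iff.2 hξ
  have cS : Tendsto (fun t : ℝ => Real.sinh (‖ξ‖ * t)) (𝓝[>] 0) (𝓝 0) := by
    have : Continuous fun t : ℝ => Real.sinh (‖ξ‖ * t) := by fun_prop
    simpa using (this.tendsto 0).mono_left nhdsWithin_le_nhds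
  have cC : Tendsto (fun t : ℝ => Real.cosh (‖ξ‖ * t)) (𝓝[>] 0) (𝓝 1) := by
    have : Continuous fun t : ℝ => Real.cosh (‖ξ‖ * t) := by fun_prop
    simpa using (this.tendsto 0).mono_left nhdsWithin_le_nhds
  have hden : Tendsto (fun t : ℝ => ‖ξ‖ * Real.cosh (‖ξ‖ * t) + κ * Real.sinh (‖ξ‖ * t)) (𝓝[>] 0)
      (𝓝 ‖ξ‖) := by
    simpa using (cC.const_mul ‖ξ‖).add (cS.const_mul κ)
  have h1 : Tendsto (fun t : ℝ => (‖ξ‖ / (‖ξ‖ * Real.cosh (‖ξ‖ * t) +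
      κ * Real.sinh (‖ξ‖ * t))) ^ ((N : ℝ) / 2)) (𝓝[>] 0) (𝓝 1) := by
    have := ((tendsto_const_nhds (x := ‖ξ‖)).div hden hs.ne').rpow_const (p := (N : ℝ) / 2) (Or.inr (by positivity))
    simpa [div_self hs.ne'] using this
  have h2 : Tendsto (fun t : ℝ => -(‖x‖ ^ 2 / (2 * (‖ξ‖ * Real.cosh (‖ξ‖ * t) +
      κ * Real.sinh (‖ξ‖ * t)))) * (‖ξ‖ ^ 2 * Real.sinh (‖ξ‖ * t) +
        2 * κ * (‖ξ‖ * (Real.cosh (‖ξ‖ * t) - 1)))) (𝓝[>] 0) (𝓝 0) := by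
    have := ((tendsto_const_nhds (x := ‖x‖ ^ 2)).div (hden.const_mul 2) (by positivity)).neg.mul
      ((cS.const_mul (‖ξ‖ ^ 2)).add (((cC.sub_const 1).const_mul ‖ξ‖).const_mul (2 * κ)))
    simpa using this
  have h3 := h1.mul ((Real.continuous_exp.tendsto _).comp h2)
  rw [Real.exp_zero, mul_one] at h3
  refine h3.congr' ?_
  filter_upwards [self_mem_nhdsWithin] with t ht
  have hS : 0 < Real.sinh (‖ξ‖ * t) := Real.sinh_pos_iff.2 (mul_pos hs ht)
  have hsum : ‖ξ‖ * (Real.cosh (‖ξ‖ * t) / Real.sinh (‖ξ‖ * t)) + κ =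
      (‖ξ‖ * Real.cosh (‖ξ‖ * t) + κ * Real.sinh (‖ξ‖ * t)) / Real.sinh (‖ξ‖ * t) := by
    field_simp
  unfold massFactor
  rw [hsum]
  simp only [Function.comp_apply]
  congr 2
  · rw [div_div_div_cancel_right₀ hS.ne']
  · have hsq : (‖ξ‖ * (Real.cosh (‖ξ‖ * t) / Real.sinh (‖ξ‖ * t))) ^ 2 -
        (‖ξ‖ / Real.sinh (‖ξ‖ * t)) ^ 2 = ‖ξ‖ ^ 2 := by
      rw [mul_pow, div_pow, div_pow, Real.cosh_sq]; field_simp; ring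
    rw [hsq]
    have : ‖ξ‖ * (Real.cosh (‖ξ‖ * t) / Real.sinh (‖ξ‖ * t)) - ‖ξ‖ / Real.sinh (‖ξ‖ * t) =
      ‖ξ‖ * (Real.cosh (‖ξ‖ * t) - 1) / Real.sinh (‖ξ‖ * t) := by field_simp
    rw [this]
    generalize ‖ξ‖ * Real.cosh (‖ξ‖ * t) + κ * Real.sinh (‖ξ‖ * t) = D
    -- Vanishing of `D` need not be excluded: with `x / 0 = 0` both sides agree.
    by_cases hD : D = 0
    · simp [hD]
    · field_simp

/-- As the total mass is at most one, weighted mass tending to one forces both the full mass to tend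
to one and the mass to concentrate where the weight is near one. The choice `ε = 1`, `κ = 2` is only
for convenience. -/
theorem tendsto_lintegral_heatKernel_mul_gauss (hN : 1 ≤ N) (hk : 1 ≤ k)
    (x : EuclideanSpace ℝ (Fin N)) :
    Tendsto (fun t => ∫⁻ w : Space N k, ENNReal.ofReal (heatKernel t x w.1 w.2 *
      Real.exp (-1 * ‖w.2‖ ^ 2) * Real.exp (-(2 / 2) * ‖w.1 - x‖ ^ 2))) (𝓝[>] 0) (𝓝 1) := by
  have hg : Integrable fun ξ : EuclideanSpace ℝ (Fin k) =>
      Real.exp (-(1 / (4 * 1)) * ‖ξ‖ ^ 2) := integrable_gauss (by positivity)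
  have h : Tendsto (fun t => ∫ ξ : EuclideanSpace ℝ (Fin k),
      massFactor t 2 x ξ * Real.exp (-(1 / (4 * 1)) * ‖ξ‖ ^ 2)) (𝓝[>] 0)
      (𝓝 (∫ ξ : EuclideanSpace ℝ (Fin k), Real.exp (-(1 / (4 * 1)) * ‖ξ‖ ^ 2))) := by
    refine tendsto_integral_filter_of_dominated_convergence
      (fun ξ => Real.exp (-(1 / (4 * 1)) * ‖ξ‖ ^ 2)) (Eventually.of_forall fun t => ?_) ?_ hg ?_
    · exact ((measurable_massFactor t 2 x).mul (by fun_prop)).aestronglyMeasurable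
    · filter_upwards [self_mem_nhdsWithin] with t (ht : 0 < t)
      refine Eventually.of_forall fun ξ => ?_
      rw [norm_mul, Real.norm_of_nonneg (massFactor_nonneg ht.le zero_le_two x ξ),
        Real.norm_of_nonneg (Real.exp_nonneg _)]
      exact mul_le_of_le_one_left (Real.exp_nonneg _) (massFactor_le_one ht.le zero_le_two x ξ)
    · filter_upwards [ae_ne_zero hk] with ξ hξ
      have := (tendsto_massFactor (κ := 2) x hξ).mul_const (Real.exp (-(1 / (4 * 1)) * ‖ξ‖ ^ 2))
      rwa [one_mul] at this
  have h2 := ENNReal.tendsto_ofReal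
    (h.const_mul ((2 * Real.pi) ^ (-(k : ℝ)) * (Real.pi / 1) ^ ((k : ℝ) / 2)))
  rw [gauss_normalization one_pos, ENNReal.ofReal_one] at h2
  refine h2.congr' ?_
  filter_upwards [self_mem_nhdsWithin] with t (ht : 0 < t)
  exact (lintegral_heatKernel_mul_gauss hN hk ht zero_le_two one_pos x).symm

end Mass

/-! ### Fourier inversion in `y` and the Chapman–Kolmogorov identity. -/

section ChapmanKolmogorov

open scoped FourierTransform

variable {N k : ℕ}

theorem div_sinh_le_inv {t s : ℝ} (ht : 0 < t) (hs : 0 ≤ s) : s / Real.sinh (s * t) ≤ 1 / t := by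
  rcases hs.eq_or_lt with rfl | hs
  · simp [ht.le]
  have h := Real.self_le_sinh_iff.2 (mul_pos hs ht).le
  rw [div_le_div_iff₀ (Real.sinh_pos_iff.2 (by positivity)) ht, one_mul]
  exact h

/-- A nonnegative function with a bounded transform is integrable: its Gaussian-damped integrals are
Gaussian averages of the symbol, hence bounded by `(1/t)^{N/2}` up to a constant, and
`lintegral_le_of_gauss` removes the damping. -/
theorem integrable_heatKernel (hN : 1 ≤ N) (hk : 1 ≤ k) {t : ℝ} (ht : 0 < t)
    (x w : EuclideanSpace ℝ (Fin N)) :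
    Integrable fun y : EuclideanSpace ℝ (Fin k) => heatKernel t x w y := by
  have hc : Continuous fun y : EuclideanSpace ℝ (Fin k) => heatKernel t x w y :=
    Continuous.heatKernel hN ht continuous_const continuous_const continuous_id
  refine ⟨hc.aestronglyMeasurable, ?_⟩
  rw [hasFiniteIntegral_iff_ofReal (Eventually.of_forall fun y => heatKernel_nonneg hN hk ht x w y)]
  set B : ℝ := (2 * Real.pi) ^ (-((N : ℝ) / 2)) * (1 / t) ^ ((N : ℝ) / 2)
  refine (lintegral_le_of_gauss (g := fun y : EuclideanSpace ℝ (Fin k) => ‖y‖ ^ 2)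
    (C := ENNReal.ofReal B) hc.measurable (by fun_prop) fun ε hε => ?_).trans_lt
    ENNReal.ofReal_lt_top
  rw [← ofReal_integral_eq_lintegral_ofReal (integrable_heatKernel_mul_gauss hN hk ht x w hε)
    (Eventually.of_forall fun y => mul_nonneg (heatKernel_nonneg hN hk ht x w y)
      (Real.exp_nonneg _)), integral_heatKernel_mul_gauss hN ht x w hε]
  refine ENNReal.ofReal_le_ofReal ?_
  have hg : Integrable fun ξ : EuclideanSpace ℝ (Fin k) =>
      Real.exp (-(1 / (4 * ε)) * ‖ξ‖ ^ 2) := integrable_gauss (by positivity)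
  have h1 : ∀ ξ : EuclideanSpace ℝ (Fin k), kernelSymbol t x w ξ ≤ (1 / t) ^ ((N : ℝ) / 2) := by
    intro ξ
    have := Real.sinh_nonneg_iff.2 (mul_nonneg (norm_nonneg ξ) ht.le)
    exact (kernelSymbol_le ht.le x w ξ).trans
      (Real.rpow_le_rpow (by positivity) (div_sinh_le_inv ht (norm_nonneg ξ)) (by positivity))
  have h2 : ∫ ξ : EuclideanSpace ℝ (Fin k),
      kernelSymbol t x w ξ * Real.exp (-(1 / (4 * ε)) * ‖ξ‖ ^ 2) ≤
      (1 / t) ^ ((N : ℝ) / 2) * ∫ ξ : EuclideanSpace ℝ (Fin k),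
        Real.exp (-(1 / (4 * ε)) * ‖ξ‖ ^ 2) := by
    rw [← integral_const_mul]
    refine integral_mono ?_ (hg.const_mul _) fun ξ =>
      mul_le_mul_of_nonneg_right (h1 ξ) (Real.exp_nonneg _)
    refine hg.bdd_mul (c := (1 / t) ^ ((N : ℝ) / 2))
      (measurable_kernelSymbol_right t x w).aestronglyMeasurable (Eventually.of_forall fun ξ => ?_)
    rw [Real.norm_of_nonneg (kernelSymbol_nonneg ht.le x w ξ)]
    exact h1 ξ
  have h3 : (2 * Real.pi) ^ (-(((N : ℝ) + 2 * k) / 2)) =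
      (2 * Real.pi) ^ (-((N : ℝ) / 2)) * (2 * Real.pi) ^ (-(k : ℝ)) := by
    rw [← Real.rpow_add (by positivity)]; congr 1; ring
  calc _ ≤ (2 * Real.pi) ^ (-(((N : ℝ) + 2 * k) / 2)) * (Real.pi / ε) ^ ((k : ℝ) / 2) *
        ((1 / t) ^ ((N : ℝ) / 2) * ∫ ξ : EuclideanSpace ℝ (Fin k),
          Real.exp (-(1 / (4 * ε)) * ‖ξ‖ ^ 2)) := by gcongr
    _ = B * ((2 * Real.pi) ^ (-(k : ℝ)) * (Real.pi / ε) ^ ((k : ℝ) / 2) *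
        ∫ ξ : EuclideanSpace ℝ (Fin k), Real.exp (-(1 / (4 * ε)) * ‖ξ‖ ^ 2)) := by
      rw [h3]; ring
    _ = B := by rw [gauss_normalization hε, mul_one]

theorem continuousAt_kernelSymbol {t : ℝ} (ht : 0 < t) (x w : EuclideanSpace ℝ (Fin N))
    {ξ : EuclideanSpace ℝ (Fin k)} (hξ : ξ ≠ 0) :
    ContinuousAt (fun ξ : EuclideanSpace ℝ (Fin k) => kernelSymbol t x w ξ) ξ := by
  have h1 : Real.sinh (‖ξ‖ * t) ≠ 0 :=
    (Real.sinh_pos_iff.2 (mul_pos (norm_pos_iff.2 hξ) ht)).ne'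
  unfold kernelSymbol
  have h2 : ContinuousAt (fun ξ : EuclideanSpace ℝ (Fin k) => ‖ξ‖ / Real.sinh (‖ξ‖ * t)) ξ := by
    fun_prop (disch := assumption)
  refine (h2.rpow_const (Or.inr (by positivity))).mul ?_
  fun_prop (disch := assumption)

/-- The library's transform has phase `2πi⟨v, ξ⟩`, hence the rescaled argument. -/
theorem heatKernel_two_pi_smul (t : ℝ) (x w : EuclideanSpace ℝ (Fin N))
    (v : EuclideanSpace ℝ (Fin k)) :
    (heatKernel t x w ((2 * Real.pi) • v) : ℂ) =
      (((2 * Real.pi) ^ (-(((N : ℝ) + 2 * k) / 2)) : ℝ) : ℂ) *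
        𝓕⁻ (fun ξ : EuclideanSpace ℝ (Fin k) => (kernelSymbol t x w ξ : ℂ)) v := by
  rw [heatKernel_coe, heatKernelC, Real.fourierInv_eq']
  congr 2
  ext ξ
  rw [smul_eq_mul, mul_comm, inner_smul_right, mul_comm Complex.I]

/-- Fourier inversion at a point of continuity: the symbol and its transform, which is the heat
kernel up to scaling, are both integrable. The origin is excluded because of the default value of
the symbol there. -/
theorem integral_heatKernel_mul_cexp (hN : 1 ≤ N) (hk : 1 ≤ k) {t : ℝ} (ht : 0 < t)
    (x w : EuclideanSpace ℝ (Fin N)) {ξ : EuclideanSpace ℝ (Fin k)} (hξ : ξ ≠ 0) :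
    ∫ y : EuclideanSpace ℝ (Fin k),
      Complex.exp (((-inner ℝ y ξ : ℝ) : ℂ) * Complex.I) * (heatKernel t x w y : ℂ) =
      (((2 * Real.pi) ^ (-((N : ℝ) / 2)) * kernelSymbol t x w ξ : ℝ) : ℂ) := by
  set m : EuclideanSpace ℝ (Fin k) → ℂ := fun ξ => (kernelSymbol t x w ξ : ℂ) with hm
  set C : ℝ := (2 * Real.pi) ^ (-(((N : ℝ) + 2 * k) / 2)) with hC
  have hC0 : C ≠ 0 := by positivity
  have hC0' : (C : ℂ) ≠ 0 := by exact_mod_cast hC0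
  have hmi : Integrable m := (integrable_kernelSymbol hN ht x w).ofReal
  have hFinv : 𝓕⁻ m = fun v => (C : ℂ)⁻¹ * (heatKernel t x w ((2 * Real.pi) • v) : ℂ) := by
    ext v
    rw [heatKernel_two_pi_smul, inv_mul_cancel_left₀ hC0']
  -- The kernel is even in `y`, so the two transforms coincide and the explicit formula serves both.
  have hF : 𝓕 m = 𝓕⁻ m := by
    ext v
    have h1 : 𝓕 m v = 𝓕⁻ m (-v) := by rw [Real.fourierInv_eq_fourier_neg, neg_neg]
    rw [h1, hFinv]
    simp only [smul_neg, heatKernel_neg hN ht]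
  have hFi : Integrable (𝓕 m) := by
    rw [hF, hFinv]
    refine Integrable.const_mul ?_ _
    exact ((integrable_heatKernel (k := k) hN hk ht x w).comp_smul
      (by positivity : (2 * Real.pi) ≠ 0)).ofReal
  have hcont : ContinuousAt m ξ :=
    Complex.continuous_ofReal.continuousAt.comp (continuousAt_kernelSymbol ht x w hξ)
  have hinv := hmi.fourier_fourierInv_eq hFi hcont
  rw [hFinv, Real.fourier_eq'] at hinv
  set G : EuclideanSpace ℝ (Fin k) → ℂ := fun y =>
    Complex.exp (((-inner ℝ y ξ : ℝ) : ℂ) * Complex.I) * (heatKernel t x w y : ℂ) with hG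
  have h2 : ∀ v : EuclideanSpace ℝ (Fin k),
      Complex.exp (((-2 * Real.pi * inner ℝ v ξ : ℝ) : ℂ) * Complex.I) •
        ((C : ℂ)⁻¹ * (heatKernel t x w ((2 * Real.pi) • v) : ℂ)) =
      (C : ℂ)⁻¹ * G ((2 * Real.pi) • v) := by
    intro v
    simp only [hG]
    rw [real_inner_smul_left, smul_eq_mul]
    ring_nf
  simp only [h2] at hinv
  rw [integral_const_mul, Measure.integral_comp_smul, finrank_euclideanSpace_fin,
    abs_of_nonneg (by positivity), Complex.real_smul] at hinv
  have h3 : C * (2 * Real.pi) ^ k = (2 * Real.pi) ^ (-((N : ℝ) / 2)) := by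
    rw [hC, ← Real.rpow_natCast, ← Real.rpow_add (by positivity)]; congr 1; ring
  rw [← h3]
  push_cast at hinv ⊢
  have h4 : ((kernelSymbol t x w ξ : ℝ) : ℂ) = m ξ := rfl
  rw [h4, ← hinv]
  have hpi : (Real.pi : ℂ) ≠ 0 := by exact_mod_cast Real.pi_ne_zero
  field_simp

/-- After a translation the cosine is expanded by the addition formula. The sine integral vanishes,
being the imaginary part of a real transform. -/
theorem integral_heatKernel_sub_mul_cos (hN : 1 ≤ N) (hk : 1 ≤ k) {t : ℝ} (ht : 0 < t)
    (x w : EuclideanSpace ℝ (Fin N)) {ξ : EuclideanSpace ℝ (Fin k)} (hξ : ξ ≠ 0)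
    (y z : EuclideanSpace ℝ (Fin k)) :
    ∫ v : EuclideanSpace ℝ (Fin k), heatKernel t x w (y - v) * Real.cos (inner ℝ ξ (v - z)) =
      (2 * Real.pi) ^ (-((N : ℝ) / 2)) * kernelSymbol t x w ξ * Real.cos (inner ℝ ξ (y - z)) := by
  have hi := integrable_heatKernel (k := k) hN hk ht x w
  have hc := integral_heatKernel_mul_cexp hN hk ht x w hξ
  have hci : Integrable fun y : EuclideanSpace ℝ (Fin k) =>
      Complex.exp (((-inner ℝ y ξ : ℝ) : ℂ) * Complex.I) * (heatKernel t x w y : ℂ) := by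
    refine hi.ofReal.bdd_mul (c := 1) (by fun_prop) (Eventually.of_forall fun ξ => ?_)
    rw [Complex.norm_exp_ofReal_mul_I]
  have hre := congrArg Complex.re hc
  have him := congrArg Complex.im hc
  rw [← RCLike.re_eq_complex_re, ← integral_re hci] at hre
  rw [← RCLike.im_eq_complex_im, ← integral_im hci] at him
  simp only [RCLike.re_eq_complex_re, RCLike.im_eq_complex_im, Complex.ofReal_re, Complex.ofReal_im,
    Complex.re_mul_ofReal, Complex.im_mul_ofReal, Complex.exp_ofReal_mul_I_re,
    Complex.exp_ofReal_mul_I_im, Real.cos_neg, Real.sin_neg] at hre him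
  have hcos : Integrable fun v : EuclideanSpace ℝ (Fin k) =>
      Real.cos (inner ℝ v ξ) * heatKernel t x w v :=
    hi.bdd_mul (c := 1) (by fun_prop) (Eventually.of_forall fun ξ => Real.abs_cos_le_one _)
  have hsin : Integrable fun v : EuclideanSpace ℝ (Fin k) =>
      -Real.sin (inner ℝ v ξ) * heatKernel t x w v :=
    hi.bdd_mul (c := 1) (by fun_prop) (Eventually.of_forall fun ξ => by
      rw [norm_neg]; exact Real.abs_sin_le_one _)
  rw [← integral_sub_left_eq_self _ volume y]
  have e : ∀ v : EuclideanSpace ℝ (Fin k),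
      heatKernel t x w (y - (y - v)) * Real.cos (inner ℝ ξ (y - v - z)) =
      Real.cos (inner ℝ ξ (y - z)) * (Real.cos (inner ℝ v ξ) * heatKernel t x w v) -
      Real.sin (inner ℝ ξ (y - z)) * (-Real.sin (inner ℝ v ξ) * heatKernel t x w v) := by
    intro v
    rw [sub_sub_cancel, sub_right_comm, inner_sub_right ξ (y - z), Real.cos_sub,
      real_inner_comm ξ v]
    ring
  simp only [e]
  rw [integral_sub (hcos.const_mul _) (hsin.const_mul _), integral_const_mul, integral_const_mul,
    hre, him]
  ring

/-- Convolution in `y` multiplies the symbols. Only the second kernel is written as a Fourier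
integral; the first stays integrable in `u`, which justifies Fubini. -/
theorem integral_heatKernel_mul_heatKernel (hN : 1 ≤ N) (hk : 1 ≤ k) {t s : ℝ} (ht : 0 < t)
    (hs : 0 < s) (x v w : EuclideanSpace ℝ (Fin N)) (y z : EuclideanSpace ℝ (Fin k)) :
    ∫ u : EuclideanSpace ℝ (Fin k), heatKernel t x v (y - u) * heatKernel s v w (u - z) =
      (2 * Real.pi) ^ (-(((N : ℝ) + 2 * k) / 2)) * (2 * Real.pi) ^ (-((N : ℝ) / 2)) *
        ∫ ξ : EuclideanSpace ℝ (Fin k), kernelSymbol t x v ξ * kernelSymbol s v w ξ *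
          Real.cos (inner ℝ ξ (y - z)) := by
  have hi : Integrable fun u => heatKernel t x v (y - u) :=
    (integrable_heatKernel (k := k) hN hk ht x v).comp_sub_left y
  have e : ∀ u : EuclideanSpace ℝ (Fin k), heatKernel t x v (y - u) * heatKernel s v w (u - z) =
      (2 * Real.pi) ^ (-(((N : ℝ) + 2 * k) / 2)) * ∫ ξ : EuclideanSpace ℝ (Fin k),
        kernelSymbol s v w ξ * (heatKernel t x v (y - u) * Real.cos (inner ℝ ξ (u - z))) := by
    intro u
    rw [heatKernel_eq hN hs, mul_left_comm, ← integral_const_mul]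
    congr 2
    ext ξ
    ring
  simp only [e]
  rw [integral_const_mul, mul_assoc]
  congr 1
  rw [integral_integral_swap, ← integral_const_mul]
  · refine integral_congr_ae ?_
    filter_upwards [ae_ne_zero hk] with ξ hξ
    rw [integral_const_mul, integral_heatKernel_sub_mul_cos hN hk ht x v hξ]
    ring
  · refine (hi.mul_prod (integrable_kernelSymbol (k := k) hN hs v w)).mono ?_
      (Eventually.of_forall fun q => ?_)
    · have hm : Measurable fun q : EuclideanSpace ℝ (Fin k) × EuclideanSpace ℝ (Fin k) =>
        kernelSymbol s v w q.2 := (measurable_kernelSymbol_right s v w).comp measurable_snd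
      have hc : Continuous fun q : EuclideanSpace ℝ (Fin k) × EuclideanSpace ℝ (Fin k) =>
          heatKernel t x v (y - q.1) * Real.cos (inner ℝ q.2 (q.1 - z)) :=
        (Continuous.heatKernel hN ht continuous_const continuous_const (by fun_prop)).mul
          (by fun_prop)
      exact (hm.mul hc.measurable).aestronglyMeasurable
    · simp only [Function.uncurry_def, norm_mul]
      have c1 : ‖Real.cos (inner ℝ q.2 (q.1 - z))‖ ≤ 1 := Real.abs_cos_le_one _
      calc _ ≤ ‖kernelSymbol s v w q.2‖ * (‖heatKernel t x v (y - q.1)‖ * 1) := by gcongr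
        _ = _ := by ring

/-- The second symbol is replaced by its integrable majorant in `ξ`, and the first has mass at most
`(2π)^{N/2}` in `v` for each `ξ ≠ 0`. -/
theorem integrable_kernelSymbol_mul (hN : 1 ≤ N) (hk : 1 ≤ k) {t s : ℝ} (ht : 0 < t)
    (hs : 0 < s) (x w : EuclideanSpace ℝ (Fin N)) (y : EuclideanSpace ℝ (Fin k)) :
    Integrable fun q : EuclideanSpace ℝ (Fin N) × EuclideanSpace ℝ (Fin k) =>
      kernelSymbol t x q.1 q.2 * kernelSymbol s q.1 w q.2 * Real.cos (inner ℝ q.2 y) := by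
  have hm1 : Measurable fun q : EuclideanSpace ℝ (Fin N) × EuclideanSpace ℝ (Fin k) =>
      kernelSymbol t x q.1 q.2 := by
    simp only [kernelSymbol_eq]; fun_prop
  have hm2 : Measurable fun q : EuclideanSpace ℝ (Fin N) × EuclideanSpace ℝ (Fin k) =>
      kernelSymbol s q.1 w q.2 := by
    simp only [kernelSymbol_eq]; fun_prop
  have hfin : Integrable fun q : EuclideanSpace ℝ (Fin N) × EuclideanSpace ℝ (Fin k) =>
      kernelSymbol t x q.1 q.2 * (‖q.2‖ / Real.sinh (‖q.2‖ * s)) ^ ((N : ℝ) / 2) := by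
    have hm3 : Measurable fun q : EuclideanSpace ℝ (Fin N) × EuclideanSpace ℝ (Fin k) =>
      kernelSymbol t x q.1 q.2 * (‖q.2‖ / Real.sinh (‖q.2‖ * s)) ^ ((N : ℝ) / 2) :=
      hm1.mul (by fun_prop)
    have hb0 : ∀ ξ : EuclideanSpace ℝ (Fin k),
        0 ≤ (‖ξ‖ / Real.sinh (‖ξ‖ * s)) ^ ((N : ℝ) / 2) := fun ξ => by
      have := Real.sinh_nonneg_iff.2 (mul_nonneg (norm_nonneg ξ) hs.le)
      positivity
    refine ⟨hm3.aestronglyMeasurable, ?_⟩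
    have hnn : ∀ q : EuclideanSpace ℝ (Fin N) × EuclideanSpace ℝ (Fin k),
        0 ≤ kernelSymbol t x q.1 q.2 * (‖q.2‖ / Real.sinh (‖q.2‖ * s)) ^ ((N : ℝ) / 2) := fun q =>
      mul_nonneg (kernelSymbol_nonneg ht.le x q.1 q.2) (hb0 q.2)
    rw [hasFiniteIntegral_iff_ofReal (Eventually.of_forall hnn), Measure.volume_eq_prod,
      lintegral_prod_symm _ hm3.ennreal_ofReal.aemeasurable]
    have e : ∀ᵐ ξ : EuclideanSpace ℝ (Fin k), (∫⁻ v : EuclideanSpace ℝ (Fin N), ENNReal.ofReal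
        (kernelSymbol t x v ξ * (‖ξ‖ / Real.sinh (‖ξ‖ * s)) ^ ((N : ℝ) / 2))) ≤
        ENNReal.ofReal ((2 * Real.pi) ^ ((N : ℝ) / 2)) *
          ENNReal.ofReal ((‖ξ‖ / Real.sinh (‖ξ‖ * s)) ^ ((N : ℝ) / 2)) := by
      filter_upwards [ae_ne_zero hk] with ξ hξ
      have h := lintegral_kernelSymbol_mul_gauss ht le_rfl x hξ
      simp only [zero_div, neg_zero, zero_mul, Real.exp_zero, mul_one] at h
      simp only [fun v => ENNReal.ofReal_mul (q := (‖ξ‖ / Real.sinh (‖ξ‖ * s)) ^ ((N : ℝ) / 2))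
        (kernelSymbol_nonneg ht.le x v ξ)]
      rw [lintegral_mul_const' _ _ ENNReal.ofReal_ne_top, h]
      gcongr
      exact mul_le_of_le_one_right (by positivity) (massFactor_le_one ht.le le_rfl x ξ)
    refine (lintegral_mono_ae e).trans_lt ?_
    rw [lintegral_const_mul' _ _ ENNReal.ofReal_ne_top,
      ← ofReal_integral_eq_lintegral_ofReal (integrable_div_sinh hN hs)
      (Eventually.of_forall hb0)]
    exact ENNReal.mul_lt_top ENNReal.ofReal_lt_top ENNReal.ofReal_lt_top
  refine hfin.mono ((hm1.mul hm2).mul (by fun_prop)).aestronglyMeasurable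
    (Eventually.of_forall fun q => ?_)
  have b1 := kernelSymbol_nonneg ht.le x q.1 q.2
  have b2 := kernelSymbol_nonneg hs.le q.1 w q.2
  have c1 : ‖Real.cos (inner ℝ q.2 y)‖ ≤ 1 := Real.abs_cos_le_one _
  rw [norm_mul, norm_mul, norm_mul, Real.norm_of_nonneg b1, Real.norm_of_nonneg b2, mul_assoc]
  refine mul_le_mul_of_nonneg_left ?_ b1
  exact (mul_le_of_le_one_right b2 c1).trans
    ((kernelSymbol_le hs.le q.1 w q.2).trans (le_abs_self _))

theorem integral_kernelSymbol_mul {t s : ℝ} (ht : 0 < t)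
    (hs : 0 < s) (x w : EuclideanSpace ℝ (Fin N)) {ξ : EuclideanSpace ℝ (Fin k)} (hξ : ξ ≠ 0) :
    ∫ v, kernelSymbol t x v ξ * kernelSymbol s v w ξ =
      (2 * Real.pi) ^ ((N : ℝ) / 2) * kernelSymbol (t + s) x w ξ := by
  have hn := norm_pos_iff.2 hξ
  simp only [kernelSymbol_eq]
  rw [(mehlerHyp_comp hn (mul_pos hn ht) (mul_pos hn hs) x w).2, mul_add]

/-- The Chapman–Kolmogorov identity for the Grushin heat kernel. -/
theorem lintegral_heatKernel_mul_heatKernel (hN : 1 ≤ N) (hk : 1 ≤ k) {t s : ℝ} (ht : 0 < t)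
    (hs : 0 < s) (z w : Space N k) :
    ∫⁻ q : Space N k, ENNReal.ofReal (heatKernel t z.1 q.1 (z.2 - q.2)) *
        ENNReal.ofReal (heatKernel s q.1 w.1 (q.2 - w.2)) =
      ENNReal.ofReal (heatKernel (t + s) z.1 w.1 (z.2 - w.2)) := by
  have hc1 : Continuous fun q : Space N k => heatKernel t z.1 q.1 (z.2 - q.2) :=
    Continuous.heatKernel hN ht continuous_const continuous_fst (by fun_prop)
  have hc2 : Continuous fun q : Space N k => heatKernel s q.1 w.1 (q.2 - w.2) :=
    Continuous.heatKernel hN hs continuous_fst continuous_const (by fun_prop)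
  set A : ℝ := (2 * Real.pi) ^ (-(((N : ℝ) + 2 * k) / 2)) * (2 * Real.pi) ^ (-((N : ℝ) / 2))
    with hA
  have hA0 : 0 ≤ A := by positivity
  have hm : Measurable fun q : Space N k => ENNReal.ofReal (heatKernel t z.1 q.1 (z.2 - q.2)) *
      ENNReal.ofReal (heatKernel s q.1 w.1 (q.2 - w.2)) :=
    hc1.measurable.ennreal_ofReal.mul hc2.measurable.ennreal_ofReal
  rw [Measure.volume_eq_prod, lintegral_prod _ hm.aemeasurable]
  have e1 : ∀ v : EuclideanSpace ℝ (Fin N), ∫⁻ u : EuclideanSpace ℝ (Fin k),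
      ENNReal.ofReal (heatKernel t z.1 v (z.2 - u)) * ENNReal.ofReal (heatKernel s v w.1 (u - w.2))
      = ENNReal.ofReal (A * ∫ ξ : EuclideanSpace ℝ (Fin k), kernelSymbol t z.1 v ξ *
          kernelSymbol s v w.1 ξ * Real.cos (inner ℝ ξ (z.2 - w.2))) := by
    intro v
    rw [← integral_heatKernel_mul_heatKernel hN hk ht hs, ofReal_integral_eq_lintegral_ofReal]
    · simp only [ENNReal.ofReal_mul (heatKernel_nonneg hN hk ht _ _ _)]
    · have hcs : Continuous fun u : EuclideanSpace ℝ (Fin k) => heatKernel s v w.1 (u - w.2) :=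
        Continuous.heatKernel hN hs continuous_const continuous_const (by fun_prop)
      refine ((integrable_heatKernel (k := k) hN hk ht z.1 v).comp_sub_left z.2).mul_bdd
        (c := kernelBound N k * s ^ (-(((N : ℝ) + 2 * k) / 2))) hcs.aestronglyMeasurable
        (Eventually.of_forall fun u => ?_)
      rw [Real.norm_of_nonneg (heatKernel_nonneg hN hk hs _ _ _)]
      exact heatKernel_le hN hs _ _ _
    · exact Eventually.of_forall fun u => mul_nonneg (heatKernel_nonneg hN hk ht _ _ _)
        (heatKernel_nonneg hN hk hs _ _ _)
  have hnn : ∀ v : EuclideanSpace ℝ (Fin N), 0 ≤ A * ∫ ξ : EuclideanSpace ℝ (Fin k),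
      kernelSymbol t z.1 v ξ * kernelSymbol s v w.1 ξ * Real.cos (inner ℝ ξ (z.2 - w.2)) := by
    intro v
    rw [← integral_heatKernel_mul_heatKernel hN hk ht hs]
    exact integral_nonneg fun u => mul_nonneg (heatKernel_nonneg hN hk ht _ _ _)
        (heatKernel_nonneg hN hk hs _ _ _)
  have hint := integrable_kernelSymbol_mul hN hk ht hs z.1 w.1 (z.2 - w.2)
  simp only [e1]
  rw [← ofReal_integral_eq_lintegral_ofReal (hint.integral_prod_left.const_mul A)
    (Eventually.of_forall hnn), integral_const_mul, integral_integral_swap hint,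
    heatKernel_eq hN (add_pos ht hs)]
  have e2 : ∀ᵐ ξ : EuclideanSpace ℝ (Fin k), (∫ v : EuclideanSpace ℝ (Fin N),
      kernelSymbol t z.1 v ξ * kernelSymbol s v w.1 ξ * Real.cos (inner ℝ ξ (z.2 - w.2))) =
      (2 * Real.pi) ^ ((N : ℝ) / 2) * (kernelSymbol (t + s) z.1 w.1 ξ *
        Real.cos (inner ℝ ξ (z.2 - w.2))) := by
    filter_upwards [ae_ne_zero hk] with ξ hξ
    rw [integral_mul_const, integral_kernelSymbol_mul ht hs _ _ hξ, mul_assoc]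
  rw [integral_congr_ae e2, integral_const_mul, ← mul_assoc, hA, mul_assoc (_ ^ _),
    ← Real.rpow_add (by positivity), neg_add_cancel, Real.rpow_zero, mul_one]

end ChapmanKolmogorov

/-! ### Integral operators with sub-Markovian kernels on `L^p`. -/

section SubMarkov

/-- A nonnegative kernel bounded by `B` all of whose rows and columns have mass at most one. -/
structure IsSubMarkov {X : Type*} [MeasurableSpace X] (μ : Measure X) (K : X → X → ℝ) (B : ℝ) :
    Prop where
  measurable : Measurable (Function.uncurry K)
  nonneg : ∀ z w, 0 ≤ K z w
  le : ∀ z w, K z w ≤ B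
  row : ∀ z, ∫⁻ w, ENNReal.ofReal (K z w) ∂μ ≤ 1
  col : ∀ w, ∫⁻ z, ENNReal.ofReal (K z w) ∂μ ≤ 1

variable {X : Type*} [MeasurableSpace X] {μ : Measure X} {K : X → X → ℝ} {B : ℝ}

namespace IsSubMarkov

theorem measurable_left (hK : IsSubMarkov μ K B) (z : X) : Measurable (K z) :=
  hK.measurable.comp measurable_prodMk_left

/-- Jensen's inequality for the measure `K(z, ·)μ`, whose mass is at most one. -/
theorem lintegral_rpow_le (hK : IsSubMarkov μ K B) {p : ℝ} (hp : 1 ≤ p) {φ : X → ℝ}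
    (hφ : AEStronglyMeasurable φ μ) (z : X) :
    (∫⁻ w, ENNReal.ofReal (K z w) * ‖φ w‖ₑ ∂μ) ^ p ≤
      ∫⁻ w, ENNReal.ofReal (K z w) * ‖φ w‖ₑ ^ p ∂μ := by
  have hm := (hK.measurable_left z).ennreal_ofReal
  set ν := μ.withDensity fun w => ENNReal.ofReal (K z w)
  have hφν : AEStronglyMeasurable φ ν := hφ.mono_ac (withDensity_absolutelyContinuous μ _)
  have h := eLpNorm'_le_eLpNorm'_mul_rpow_measure_univ (μ := ν) one_pos hp hφν
  have hν : ν univ ≤ 1 := by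
    rw [withDensity_apply _ MeasurableSet.univ, Measure.restrict_univ]
    exact hK.row z
  have hp0 : 0 < p := by linarith
  have e1 : ∫⁻ w, ENNReal.ofReal (K z w) * ‖φ w‖ₑ ∂μ = eLpNorm' φ 1 ν := by
    rw [eLpNorm'_eq_lintegral_enorm]
    simp only [ENNReal.rpow_one, div_one]
    exact (lintegral_withDensity_eq_lintegral_mul₀ hm.aemeasurable hφ.enorm).symm
  have e2 : ∫⁻ w, ENNReal.ofReal (K z w) * ‖φ w‖ₑ ^ p ∂μ = (eLpNorm' φ p ν) ^ p := by
    rw [eLpNorm'_eq_lintegral_enorm, ← ENNReal.rpow_mul, one_div, inv_mul_cancel₀ hp0.ne',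
      ENNReal.rpow_one]
    exact (lintegral_withDensity_eq_lintegral_mul₀ hm.aemeasurable (hφ.enorm.pow_const p)).symm
  rw [e1, e2]
  refine ENNReal.rpow_le_rpow (h.trans ?_) hp0.le
  refine mul_le_of_le_one_right' (ENNReal.rpow_le_one hν ?_)
  rw [sub_nonneg, div_le_div_iff₀ hp0 one_pos]
  linarith

theorem lintegral_mul_rpow_le (hK : IsSubMarkov μ K B) {p : ℝ} (φ : X → ℝ) (z : X) :
    ∫⁻ w, ENNReal.ofReal (K z w) * ‖φ w‖ₑ ^ p ∂μ ≤
      ENNReal.ofReal B * ∫⁻ w, ‖φ w‖ₑ ^ p ∂μ := by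
  rw [← lintegral_const_mul' _ _ ENNReal.ofReal_ne_top]
  gcongr with w
  exact hK.le z w

theorem lintegral_lintegral_mul_rpow_le [SFinite μ] (hK : IsSubMarkov μ K B) {p : ℝ} {φ : X → ℝ}
    (hφ : AEStronglyMeasurable φ μ) :
    ∫⁻ z, ∫⁻ w, ENNReal.ofReal (K z w) * ‖φ w‖ₑ ^ p ∂μ ∂μ ≤ ∫⁻ w, ‖φ w‖ₑ ^ p ∂μ := by
  rw [lintegral_lintegral_swap]
  · refine lintegral_mono fun w => ?_
    have hm : Measurable fun z => ENNReal.ofReal (K z w) :=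
      (hK.measurable.comp measurable_prodMk_right).ennreal_ofReal
    rw [lintegral_mul_const _ hm]
    exact mul_le_of_le_one_left' (hK.col w)
  · exact hK.measurable.ennreal_ofReal.aemeasurable.mul (hφ.enorm.pow_const p).comp_snd

theorem lintegral_enorm_lt_top (hK : IsSubMarkov μ K B) {p : ℝ} (hp : 1 ≤ p) {φ : X → ℝ}
    (hφ : MemLp φ (ENNReal.ofReal p) μ) (z : X) :
    ∫⁻ w, ENNReal.ofReal (K z w) * ‖φ w‖ₑ ∂μ < ∞ := by
  have hp0 : 0 < p := by linarith
  have h1 := (hK.lintegral_rpow_le hp hφ.1 z).trans (hK.lintegral_mul_rpow_le φ z)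
  have h2 := lintegral_rpow_enorm_lt_top_of_eLpNorm_lt_top (by simpa using hp0)
    ENNReal.ofReal_ne_top hφ.2
  rw [ENNReal.toReal_ofReal hp0.le] at h2
  exact (ENNReal.rpow_lt_top_iff_of_pos hp0).1
    (h1.trans_lt (ENNReal.mul_lt_top ENNReal.ofReal_lt_top h2))

theorem integrable_mul (hK : IsSubMarkov μ K B) {p : ℝ} (hp : 1 ≤ p) {φ : X → ℝ}
    (hφ : MemLp φ (ENNReal.ofReal p) μ) (z : X) : Integrable (fun w => K z w * φ w) μ := by
  refine ⟨(hK.measurable_left z).aestronglyMeasurable.mul hφ.1, ?_⟩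
  refine (lintegral_mono fun w => ?_).trans_lt (hK.lintegral_enorm_lt_top hp hφ z)
  rw [enorm_mul, Real.enorm_of_nonneg (hK.nonneg z w)]

theorem enorm_integral_le (hK : IsSubMarkov μ K B) (φ : X → ℝ) (z : X) :
    ‖∫ w, K z w * φ w ∂μ‖ₑ ≤ ∫⁻ w, ENNReal.ofReal (K z w) * ‖φ w‖ₑ ∂μ := by
  refine (enorm_integral_le_lintegral_enorm _).trans (lintegral_mono fun w => ?_)
  rw [enorm_mul, Real.enorm_of_nonneg (hK.nonneg z w)]

theorem aestronglyMeasurable_integral [SFinite μ] (hK : IsSubMarkov μ K B) {φ : X → ℝ}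
    (hφ : AEStronglyMeasurable φ μ) : AEStronglyMeasurable (fun z => ∫ w, K z w * φ w ∂μ) μ :=
  (hK.measurable.aestronglyMeasurable.mul hφ.comp_snd).integral_prod_right'
    (f := fun q : X × X => K q.1 q.2 * φ q.2)

/-- One writes `|Kφ|^q = (|Kφ|^p)^{q/p - 1} |Kφ|^p`. In the first factor `|Kφ|^p ≤ B‖φ‖_p^p` by
Jensen and the sup bound; the second is integrated with Jensen and the column masses. -/
theorem eLpNorm_integral_le [SFinite μ] (hK : IsSubMarkov μ K B) {p q : ℝ} (hp : 1 ≤ p)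
    (hpq : p ≤ q) {φ : X → ℝ} (hφ : AEStronglyMeasurable φ μ) :
    eLpNorm (fun z => ∫ w, K z w * φ w ∂μ) (ENNReal.ofReal q) μ ≤
      ENNReal.ofReal B ^ (1 / p - 1 / q) * eLpNorm φ (ENNReal.ofReal p) μ := by
  have hp0 : 0 < p := by linarith
  have hq0 : 0 < q := by linarith
  rw [eLpNorm_eq_lintegral_rpow_enorm_toReal (by simpa using hq0) ENNReal.ofReal_ne_top,
    eLpNorm_eq_lintegral_rpow_enorm_toReal (by simpa using hp0) ENNReal.ofReal_ne_top,
    ENNReal.toReal_ofReal hp0.le, ENNReal.toReal_ofReal hq0.le]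
  set I := ∫⁻ w, ‖φ w‖ₑ ^ p ∂μ
  have hqp : 0 ≤ q / p - 1 := by rw [sub_nonneg, le_div_iff₀ hp0]; linarith
  have hmul : ∀ a : ℝ≥0∞, a ^ (q / p - 1) * a = a ^ (q / p) := by
    intro a
    nth_rewrite 2 [← ENNReal.rpow_one a]
    rw [← ENNReal.rpow_add_of_nonneg _ _ hqp zero_le_one, sub_add_cancel]
  have key : ∀ z, ‖∫ w, K z w * φ w ∂μ‖ₑ ^ q ≤ (ENNReal.ofReal B * I) ^ (q / p - 1) *
      ∫⁻ w, ENNReal.ofReal (K z w) * ‖φ w‖ₑ ^ p ∂μ := by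
    intro z
    have h1 := (ENNReal.rpow_le_rpow (hK.enorm_integral_le φ z) hp0.le).trans
      (hK.lintegral_rpow_le hp hφ z)
    have h2 := hK.lintegral_mul_rpow_le (p := p) φ z
    have e : ‖∫ w, K z w * φ w ∂μ‖ₑ ^ q = (‖∫ w, K z w * φ w ∂μ‖ₑ ^ p) ^ (q / p - 1) *
        ‖∫ w, K z w * φ w ∂μ‖ₑ ^ p := by
      rw [hmul, ← ENNReal.rpow_mul, mul_div_cancel₀ _ hp0.ne']
    rw [e]
    gcongr
    exact h1.trans h2
  have h3 : ∫⁻ z, ‖∫ w, K z w * φ w ∂μ‖ₑ ^ q ∂μ ≤ (ENNReal.ofReal B * I) ^ (q / p - 1) * I := by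
    refine (lintegral_mono key).trans ?_
    rw [lintegral_const_mul'']
    · gcongr
      exact hK.lintegral_lintegral_mul_rpow_le hφ
    · exact (hK.measurable.ennreal_ofReal.aemeasurable.mul
        (hφ.enorm.pow_const p).comp_snd).lintegral_prod_right'
        (f := fun q : X × X => ENNReal.ofReal (K q.1 q.2) * ‖φ q.2‖ₑ ^ p)
  refine (ENNReal.rpow_le_rpow h3 (by positivity)).trans_eq ?_
  have e : (ENNReal.ofReal B * I) ^ (q / p - 1) * I = ENNReal.ofReal B ^ (q / p - 1) * I ^ (q / p) := by
    rw [ENNReal.mul_rpow_of_nonneg _ _ hqp, mul_assoc, hmul]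
  rw [e, ENNReal.mul_rpow_of_nonneg _ _ (by positivity), ← ENNReal.rpow_mul, ← ENNReal.rpow_mul]
  congr 2
  · field_simp
  · field_simp

theorem memLp_integral [SFinite μ] (hK : IsSubMarkov μ K B) {p q : ℝ} (hp : 1 ≤ p)
    (hpq : p ≤ q) {φ : X → ℝ} (hφ : MemLp φ (ENNReal.ofReal p) μ) :
    MemLp (fun z => ∫ w, K z w * φ w ∂μ) (ENNReal.ofReal q) μ := by
  refine ⟨hK.aestronglyMeasurable_integral hφ.1, (hK.eLpNorm_integral_le hp hpq hφ.1).trans_lt ?_⟩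
  refine ENNReal.mul_lt_top (ENNReal.rpow_lt_top_of_nonneg ?_ ENNReal.ofReal_ne_top) hφ.2
  rw [sub_nonneg]
  exact one_div_le_one_div_of_le (by linarith) hpq

/-- The operator with kernel `K` from `L^p` to `L^q`, `p ≤ q`. -/
noncomputable def toCLM [SFinite μ] (hK : IsSubMarkov μ K B) {p q : ℝ}
    [Fact (1 ≤ ENNReal.ofReal p)] [Fact (1 ≤ ENNReal.ofReal q)] (hp : 1 ≤ p) (hpq : p ≤ q) :
    Lp ℝ (ENNReal.ofReal p) μ →L[ℝ] Lp ℝ (ENNReal.ofReal q) μ :=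
  LinearMap.mkContinuous
    { toFun := fun φ => (hK.memLp_integral hp hpq (Lp.memLp φ)).toLp _
      map_add' := fun φ ψ => by
        rw [← MemLp.toLp_add, MemLp.toLp_eq_toLp_iff]
        refine Eventually.of_forall fun z => ?_
        have h : (fun w => K z w * (φ + ψ : Lp ℝ (ENNReal.ofReal p) μ) w) =ᵐ[μ]
            fun w => K z w * φ w + K z w * ψ w := by
          filter_upwards [Lp.coeFn_add φ ψ] with w hw
          rw [hw, Pi.add_apply, mul_add]
        simp only [Pi.add_apply]
        rw [integral_congr_ae h, integral_add (hK.integrable_mul hp (Lp.memLp φ) z)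
          (hK.integrable_mul hp (Lp.memLp ψ) z)]
      map_smul' := fun c φ => by
        rw [RingHom.id_apply, ← MemLp.toLp_const_smul, MemLp.toLp_eq_toLp_iff]
        refine Eventually.of_forall fun z => ?_
        have h : (fun w => K z w * (c • φ : Lp ℝ (ENNReal.ofReal p) μ) w) =ᵐ[μ]
            fun w => c * (K z w * φ w) := by
          filter_upwards [Lp.coeFn_smul c φ] with w hw
          rw [hw, Pi.smul_apply, smul_eq_mul, mul_left_comm]
        simp only [Pi.smul_apply, smul_eq_mul]
        rw [integral_congr_ae h, integral_const_mul] }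
    ((ENNReal.ofReal B ^ (1 / p - 1 / q)).toReal) fun φ => by
      simp only [LinearMap.coe_mk, AddHom.coe_mk]
      rw [Lp.norm_toLp, Lp.norm_def, ← ENNReal.toReal_mul]
      refine ENNReal.toReal_mono (ENNReal.mul_ne_top (ENNReal.rpow_ne_top_of_nonneg ?_
        ENNReal.ofReal_ne_top) (Lp.eLpNorm_ne_top φ))
        (hK.eLpNorm_integral_le hp hpq (Lp.aestronglyMeasurable φ))
      rw [sub_nonneg]
      exact one_div_le_one_div_of_le (by linarith) hpq

section

variable [SFinite μ] {p q : ℝ} [Fact (1 ≤ ENNReal.ofReal p)] [Fact (1 ≤ ENNReal.ofReal q)]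

theorem coeFn_toCLM (hK : IsSubMarkov μ K B) (hp : 1 ≤ p) (hpq : p ≤ q)
    (φ : Lp ℝ (ENNReal.ofReal p) μ) :
    hK.toCLM (q := q) hp hpq φ =ᵐ[μ] fun z => ∫ w, K z w * φ w ∂μ :=
  MemLp.coeFn_toLp (hK.memLp_integral hp hpq (Lp.memLp φ))

theorem norm_toCLM_le (hK : IsSubMarkov μ K B) (hB : 0 ≤ B) (hp : 1 ≤ p) (hpq : p ≤ q) :
    ‖hK.toCLM (p := p) (q := q) hp hpq‖ ≤ B ^ (1 / p - 1 / q) := by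
  refine (LinearMap.mkContinuous_norm_le _ ENNReal.toReal_nonneg _).trans_eq ?_
  rw [← ENNReal.toReal_rpow, ENNReal.toReal_ofReal hB]

theorem norm_toCLM_le_one (hK : IsSubMarkov μ K B) (hB : 0 ≤ B) (hp : 1 ≤ p) :
    ‖hK.toCLM (p := p) (q := p) hp le_rfl‖ ≤ 1 := by
  simpa using hK.norm_toCLM_le (p := p) (q := p) hB hp le_rfl

end

/-- The kernel identity `h` serves twice: it makes the double integral absolutely convergent, with
value the finite integral of `K₃|φ|`, and it evaluates the inner integral after Fubini. -/
theorem integral_integral_mul [SFinite μ] {K₁ K₂ K₃ : X → X → ℝ} {B₁ B₂ B₃ : ℝ}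
    (h₁ : IsSubMarkov μ K₁ B₁) (h₂ : IsSubMarkov μ K₂ B₂) (h₃ : IsSubMarkov μ K₃ B₃)
    (h : ∀ z w, ∫⁻ v, ENNReal.ofReal (K₁ z v) * ENNReal.ofReal (K₂ v w) ∂μ =
      ENNReal.ofReal (K₃ z w)) {p : ℝ} (hp : 1 ≤ p) {φ : X → ℝ}
    (hφ : MemLp φ (ENNReal.ofReal p) μ) (z : X) :
    ∫ v, K₁ z v * ∫ w, K₂ v w * φ w ∂μ ∂μ = ∫ w, K₃ z w * φ w ∂μ := by
  have hm1 : Measurable fun q : X × X => K₁ z q.1 := (h₁.measurable_left z).comp measurable_fst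
  have hmeas : AEStronglyMeasurable (fun q : X × X => K₁ z q.1 * (K₂ q.1 q.2 * φ q.2))
      (μ.prod μ) :=
    hm1.aestronglyMeasurable.mul (h₂.measurable.aestronglyMeasurable.mul hφ.1.comp_snd)
  have hsplit : ∀ v w, ‖K₁ z v * (K₂ v w * φ w)‖ₑ =
      ENNReal.ofReal (K₁ z v) * ENNReal.ofReal (K₂ v w) * ‖φ w‖ₑ := by
    intro v w
    rw [enorm_mul, enorm_mul, Real.enorm_of_nonneg (h₁.nonneg z v),
      Real.enorm_of_nonneg (h₂.nonneg v w), mul_assoc]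
  have hmw : ∀ w, Measurable fun v => ENNReal.ofReal (K₁ z v) * ENNReal.ofReal (K₂ v w) :=
    fun w => (h₁.measurable_left z).ennreal_ofReal.mul
      (h₂.measurable.comp measurable_prodMk_right).ennreal_ofReal
  have hint : Integrable (fun q : X × X => K₁ z q.1 * (K₂ q.1 q.2 * φ q.2)) (μ.prod μ) := by
    refine ⟨hmeas, ?_⟩
    rw [hasFiniteIntegral_iff_enorm, lintegral_prod_symm _ hmeas.enorm]
    refine (lintegral_mono fun w => ?_).trans_lt (h₃.lintegral_enorm_lt_top hp hφ z)
    simp only [hsplit]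
    rw [lintegral_mul_const _ (hmw w), h z w]
  calc ∫ v, K₁ z v * ∫ w, K₂ v w * φ w ∂μ ∂μ
      = ∫ v, ∫ w, K₁ z v * (K₂ v w * φ w) ∂μ ∂μ := by simp only [integral_const_mul]
    _ = ∫ w, ∫ v, K₁ z v * (K₂ v w * φ w) ∂μ ∂μ := integral_integral_swap hint
    _ = ∫ w, K₃ z w * φ w ∂μ := by
      congr 1
      ext w
      simp only [← mul_assoc]
      rw [integral_mul_const, integral_eq_lintegral_of_nonneg_ae
        (Eventually.of_forall fun v => mul_nonneg (h₁.nonneg z v) (h₂.nonneg v w))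
        ((h₁.measurable_left z).mul
          (h₂.measurable.comp measurable_prodMk_right)).aestronglyMeasurable]
      simp only [ENNReal.ofReal_mul (h₁.nonneg z _)]
      rw [h z w, ENNReal.toReal_ofReal (h₃.nonneg z w)]

end IsSubMarkov

end SubMarkov

/-! ### The heat semigroup on `L^p`: contractivity, smoothing, strong continuity. -/

section HeatSemigroup

variable {N k : ℕ}

/-- The heat kernel as a function on pairs of points of `ℝ^{N+k}`. -/
noncomputable def pairKernel (t : ℝ) (z w : Space N k) : ℝ := heatKernel t z.1 w.1 (z.2 - w.2)

theorem lintegral_comp_snd_sub {f : Space N k → ℝ≥0∞} (hf : Measurable f)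
    (y : EuclideanSpace ℝ (Fin k)) :
    ∫⁻ w : Space N k, f (w.1, y - w.2) = ∫⁻ w : Space N k, f w := by
  have hm : Measurable fun w : Space N k => f (w.1, y - w.2) := hf.comp (by fun_prop)
  rw [Measure.volume_eq_prod, lintegral_prod _ hm.aemeasurable, lintegral_prod _ hf.aemeasurable]
  congr 1
  ext x
  exact lintegral_sub_left_eq_self (fun u => f (x, u)) y

theorem pairKernel_comm (hN : 1 ≤ N) {t : ℝ} (ht : 0 < t) (z w : Space N k) :
    pairKernel t z w = pairKernel t w z := by
  unfold pairKernel
  rw [heatKernel_comm, ← heatKernel_neg hN ht, neg_sub]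

theorem isSubMarkov_pairKernel (hN : 1 ≤ N) (hk : 1 ≤ k) {t : ℝ} (ht : 0 < t) :
    IsSubMarkov (volume : Measure (Space N k)) (pairKernel t)
      (kernelBound N k * t ^ (-(((N : ℝ) + 2 * k) / 2))) := by
  have hrow : ∀ z : Space N k, ∫⁻ w : Space N k, ENNReal.ofReal (pairKernel t z w) ≤ 1 := by
    intro z
    have hc : Continuous fun w : Space N k => heatKernel t z.1 w.1 w.2 :=
      Continuous.heatKernel hN ht continuous_const continuous_fst continuous_snd
    exact (lintegral_comp_snd_sub hc.measurable.ennreal_ofReal z.2).trans_le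
      (lintegral_heatKernel_le_one hN hk ht z.1)
  refine ⟨?_, fun z w => heatKernel_nonneg hN hk ht _ _ _, fun z w => heatKernel_le hN ht _ _ _,
    hrow, fun w => ?_⟩
  · have hc : Continuous fun q : Space N k × Space N k =>
        heatKernel t q.1.1 q.2.1 (q.1.2 - q.2.2) :=
      Continuous.heatKernel hN ht (by fun_prop) (by fun_prop) (by fun_prop)
    exact hc.measurable
  · simp only [fun z => pairKernel_comm hN ht z w]
    exact hrow w

/-- A Gaussian weight centred at `z`. -/
noncomputable def gaussWeight (z w : Space N k) : ℝ :=
  Real.exp (-1 * ‖z.2 - w.2‖ ^ 2) * Real.exp (-(2 / 2) * ‖w.1 - z.1‖ ^ 2)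

theorem gaussWeight_le_one (z w : Space N k) : gaussWeight z w ≤ 1 := by
  unfold gaussWeight
  rw [← Real.exp_add, Real.exp_le_one_iff]
  nlinarith [sq_nonneg ‖z.2 - w.2‖, sq_nonneg ‖w.1 - z.1‖]

theorem gaussWeight_nonneg (z w : Space N k) : 0 ≤ gaussWeight z w := by
  unfold gaussWeight; positivity

theorem gaussWeight_le {z w : Space N k} {δ : ℝ} (hδ : 0 ≤ δ) (h : δ ≤ dist w z) :
    gaussWeight z w ≤ Real.exp (-δ ^ 2) := by
  unfold gaussWeight
  rw [← Real.exp_add, Real.exp_le_exp]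
  rw [Prod.dist_eq, le_max_iff, dist_eq_norm, dist_eq_norm, norm_sub_rev w.2] at h
  rcases h with h | h
  · nlinarith [sq_nonneg ‖z.2 - w.2‖, pow_le_pow_left₀ hδ h 2]
  · nlinarith [sq_nonneg ‖w.1 - z.1‖, pow_le_pow_left₀ hδ h 2]

theorem continuous_gaussWeight (z : Space N k) : Continuous (gaussWeight z) := by
  unfold gaussWeight; fun_prop

theorem integrable_pairKernel (hN : 1 ≤ N) (hk : 1 ≤ k) {t : ℝ} (ht : 0 < t) (z : Space N k) :
    Integrable (pairKernel t z) := by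
  have hK := isSubMarkov_pairKernel hN hk ht (N := N) (k := k)
  refine ⟨(hK.measurable_left z).aestronglyMeasurable, ?_⟩
  rw [hasFiniteIntegral_iff_ofReal (Eventually.of_forall (hK.nonneg z))]
  exact (hK.row z).trans_lt ENNReal.one_lt_top

theorem integral_pairKernel_le_one (hN : 1 ≤ N) (hk : 1 ≤ k) {t : ℝ} (ht : 0 < t)
    (z : Space N k) : ∫ w, pairKernel t z w ≤ 1 := by
  have hK := isSubMarkov_pairKernel hN hk ht (N := N) (k := k)
  rw [integral_eq_lintegral_of_nonneg_ae (Eventually.of_forall (hK.nonneg z))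
    (hK.measurable_left z).aestronglyMeasurable]
  exact ENNReal.toReal_le_of_le_ofReal zero_le_one (by simpa using hK.row z)

theorem tendsto_integral_pairKernel_mul_gaussWeight (hN : 1 ≤ N) (hk : 1 ≤ k) (z : Space N k) :
    Tendsto (fun t => ∫ w, pairKernel t z w * gaussWeight z w) (𝓝[>] 0) (𝓝 1) := by
  have h := (ENNReal.tendsto_toReal ENNReal.one_ne_top).comp
    (tendsto_lintegral_heatKernel_mul_gauss hN hk z.1)
  refine h.congr' ?_
  filter_upwards [self_mem_nhdsWithin] with t (ht : 0 < t)
  have hK := isSubMarkov_pairKernel hN hk ht (N := N) (k := k)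
  rw [integral_eq_lintegral_of_nonneg_ae (Eventually.of_forall fun w =>
    mul_nonneg (hK.nonneg z w) (gaussWeight_nonneg z w))
    ((hK.measurable_left z).mul (continuous_gaussWeight z).measurable).aestronglyMeasurable]
  have hc : Continuous fun w : Space N k => heatKernel t z.1 w.1 w.2 *
      Real.exp (-1 * ‖w.2‖ ^ 2) * Real.exp (-(2 / 2) * ‖w.1 - z.1‖ ^ 2) :=
    ((Continuous.heatKernel hN ht continuous_const continuous_fst continuous_snd).mul
      (by fun_prop)).mul (by fun_prop)
  refine congrArg ENNReal.toReal
    ((lintegral_comp_snd_sub hc.measurable.ennreal_ofReal z.2).symm.trans ?_)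
  refine lintegral_congr fun w => ?_
  simp only [pairKernel, gaussWeight, mul_assoc]

theorem integrable_pairKernel_mul (hN : 1 ≤ N) (hk : 1 ≤ k) {t : ℝ} (ht : 0 < t) (z : Space N k)
    {φ : Space N k → ℝ} (hφ : Continuous φ) {M : ℝ} (hM : ∀ w, |φ w| ≤ M) :
    Integrable fun w => pairKernel t z w * φ w :=
  (integrable_pairKernel hN hk ht z).mul_bdd (c := M) hφ.aestronglyMeasurable
    (Eventually.of_forall hM)

/-- An approximate-identity argument that uses only mass at most one and weighted mass tending to
one. Off a small ball `1 - gaussWeight` is bounded below, so it controls the oscillation of `φ`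
there. -/
theorem tendsto_integral_pairKernel_mul (hN : 1 ≤ N) (hk : 1 ≤ k) {φ : Space N k → ℝ}
    (hφ : Continuous φ) {M : ℝ} (hM : ∀ w, |φ w| ≤ M) (z : Space N k) :
    Tendsto (fun t => ∫ w, pairKernel t z w * φ w) (𝓝[>] 0) (𝓝 (φ z)) := by
  have hM0 : 0 ≤ M := (abs_nonneg _).trans (hM z)
  have hW := tendsto_integral_pairKernel_mul_gaussWeight hN hk z
  rw [Metric.tendsto_nhds]
  intro ε hε
  obtain ⟨δ, hδ, hφδ⟩ := Metric.continuous_iff.1 hφ z (ε / 2) (by positivity)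
  have hexp : Real.exp (-δ ^ 2) < 1 := by rw [Real.exp_lt_one_iff]; nlinarith
  -- `c` bounds `1 - gaussWeight` from below outside the ball of radius `δ`, which turns the crude
  -- bound `2M` into `(2M/c)(1 - gaussWeight)`.
  set c := 1 - Real.exp (-δ ^ 2) with hc
  have hc0 : 0 < c := by rw [hc]; linarith
  have hsmall : Tendsto (fun t => ε / 2 + (2 * M / c + M) *
      (1 - ∫ w, pairKernel t z w * gaussWeight z w)) (𝓝[>] 0) (𝓝 (ε / 2)) := by
    simpa using ((hW.const_sub 1).const_mul (2 * M / c + M)).const_add (ε / 2)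
  filter_upwards [self_mem_nhdsWithin, hsmall.eventually_lt_const (half_lt_self hε)]
    with t (ht : 0 < t) hlt
  refine lt_of_le_of_lt ?_ hlt
  have hK := isSubMarkov_pairKernel hN hk ht (N := N) (k := k)
  have hi := integrable_pairKernel hN hk ht z
  have hm := integral_pairKernel_le_one hN hk ht z
  have hiG : Integrable fun w => pairKernel t z w * gaussWeight z w :=
    integrable_pairKernel_mul hN hk ht z (continuous_gaussWeight z) (M := 1) fun w => by
      rw [abs_of_nonneg (gaussWeight_nonneg z w)]; exact gaussWeight_le_one z w
  have hiφ := integrable_pairKernel_mul hN hk ht z hφ hM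
  have hid : Integrable fun w => pairKernel t z w - pairKernel t z w * gaussWeight z w := hi.sub hiG
  have hWm : ∫ w, pairKernel t z w * gaussWeight z w ≤ ∫ w, pairKernel t z w :=
    integral_mono hiG hi fun w => mul_le_of_le_one_right (hK.nonneg z w) (gaussWeight_le_one z w)
  have hpt : ∀ w, |φ w - φ z| ≤ ε / 2 + 2 * M / c * (1 - gaussWeight z w) := by
    intro w
    have h1 := gaussWeight_le_one z w
    rcases lt_or_ge (dist w z) δ with h | h
    · have h2 := hφδ w h
      rw [Real.dist_eq] at h2
      have : 0 ≤ 2 * M / c * (1 - gaussWeight z w) := mul_nonneg (by positivity) (by linarith)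
      linarith
    · have h2 := gaussWeight_le hδ.le h
      have h3 : 2 * M / c * c ≤ 2 * M / c * (1 - gaussWeight z w) := by
        refine mul_le_mul_of_nonneg_left ?_ (by positivity)
        rw [hc]; linarith
      rw [div_mul_cancel₀ _ hc0.ne'] at h3
      have h4 := abs_sub (φ w) (φ z)
      linarith [hM w, hM z]
  have hdiff : |∫ w, pairKernel t z w * (φ w - φ z)| ≤
      ε / 2 * (∫ w, pairKernel t z w) + 2 * M / c * ((∫ w, pairKernel t z w) -
        ∫ w, pairKernel t z w * gaussWeight z w) := by
    have hR : ε / 2 * (∫ w, pairKernel t z w) + 2 * M / c * ((∫ w, pairKernel t z w) -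
        ∫ w, pairKernel t z w * gaussWeight z w) =
        ∫ w, (ε / 2 * pairKernel t z w + 2 * M / c *
          (pairKernel t z w - pairKernel t z w * gaussWeight z w)) := by
      rw [integral_add (hi.const_mul _) (hid.const_mul _), integral_const_mul,
        integral_const_mul, integral_sub hi hiG]
    rw [hR]
    refine (abs_integral_le_integral_abs).trans (integral_mono_of_nonneg
      (Eventually.of_forall fun w => abs_nonneg _)
      ((hi.const_mul _).add (hid.const_mul _)) (Eventually.of_forall fun w => ?_))
    have := mul_le_mul_of_nonneg_left (hpt w) (hK.nonneg z w)
    simp only [abs_mul, abs_of_nonneg (hK.nonneg z w)]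
    refine this.trans_eq ?_
    ring
  have hsplit : (∫ w, pairKernel t z w * φ w) - φ z =
      (∫ w, pairKernel t z w * (φ w - φ z)) - φ z * (1 - ∫ w, pairKernel t z w) := by
    simp only [mul_sub]
    rw [integral_sub hiφ (hi.mul_const _), integral_mul_const]
    ring
  rw [Real.dist_eq, hsplit]
  set m := ∫ w, pairKernel t z w
  set W := ∫ w, pairKernel t z w * gaussWeight z w
  have h5 : |φ z * (1 - m)| ≤ M * (1 - W) := by
    rw [abs_mul, abs_of_nonneg (by linarith : 0 ≤ 1 - m)]
    exact mul_le_mul (hM z) (by linarith) (by linarith) hM0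
  have h6 : ε / 2 * m ≤ ε / 2 := mul_le_of_le_one_right (by positivity) hm
  have h7 : 2 * M / c * (m - W) ≤ 2 * M / c * (1 - W) :=
    mul_le_mul_of_nonneg_left (by linarith) (by positivity)
  have h8 := abs_sub (∫ w, pairKernel t z w * (φ w - φ z)) (φ z * (1 - m))
  linarith

theorem integral_pairKernel_mul_nonneg (hN : 1 ≤ N) (hk : 1 ≤ k) {t : ℝ} (ht : 0 < t)
    {φ : Space N k → ℝ} (h0 : ∀ w, 0 ≤ φ w) (z : Space N k) :
    0 ≤ ∫ w, pairKernel t z w * φ w :=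
  integral_nonneg fun w => mul_nonneg (heatKernel_nonneg hN hk ht _ _ _) (h0 w)

theorem integrable_integral_pairKernel_mul (hN : 1 ≤ N) (hk : 1 ≤ k) {t : ℝ} (ht : 0 < t)
    {φ : Space N k → ℝ} (hφ : Integrable φ) :
    Integrable fun z => ∫ w, pairKernel t z w * φ w := by
  have := (isSubMarkov_pairKernel hN hk ht (N := N) (k := k)).memLp_integral le_rfl le_rfl
    (φ := φ) (by simpa using memLp_one_iff_integrable.2 hφ)
  rw [ENNReal.ofReal_one] at this
  exact memLp_one_iff_integrable.1 this

theorem integral_integral_pairKernel_mul_le (hN : 1 ≤ N) (hk : 1 ≤ k) {t : ℝ} (ht : 0 < t)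
    {φ : Space N k → ℝ} (hφ : Integrable φ) (h0 : ∀ w, 0 ≤ φ w) :
    ∫ z, ∫ w, pairKernel t z w * φ w ≤ ∫ w, φ w := by
  have h := (isSubMarkov_pairKernel hN hk ht (N := N) (k := k)).eLpNorm_integral_le le_rfl le_rfl
    hφ.aestronglyMeasurable
  simp only [sub_self, ENNReal.rpow_zero, one_mul, ENNReal.ofReal_one,
    eLpNorm_one_eq_lintegral_enorm] at h
  have h1 := ENNReal.toReal_mono hφ.2.ne h
  rw [← integral_norm_eq_lintegral_enorm hφ.1, ← integral_norm_eq_lintegral_enorm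
    (integrable_integral_pairKernel_mul hN hk ht hφ).1] at h1
  simpa only [Real.norm_of_nonneg (h0 _),
    Real.norm_of_nonneg (integral_pairKernel_mul_nonneg hN hk ht h0 _)] using h1

/-- Scheffé's argument with `|a - φ| = (a - φ) + 2(φ - a)⁺`: the first term has nonpositive integral
by the mass bound, and the second is dominated by `φ` because `a ≥ 0`. -/
theorem tendsto_integral_abs_sub (hN : 1 ≤ N) (hk : 1 ≤ k) {φ : Space N k → ℝ}
    (hφ : Continuous φ) (hs : HasCompactSupport φ) (h0 : ∀ w, 0 ≤ φ w) :
    Tendsto (fun t => ∫ z, |(∫ w, pairKernel t z w * φ w) - φ z|) (𝓝[>] 0) (𝓝 0) := by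
  obtain ⟨M, hM⟩ := hs.exists_bound_of_continuous hφ
  have hφi : Integrable φ := hφ.integrable_of_hasCompactSupport hs
  have hpos : Tendsto (fun t => ∫ z, max (φ z - ∫ w, pairKernel t z w * φ w) 0) (𝓝[>] 0)
      (𝓝 (∫ _ : Space N k, (0 : ℝ))) := by
    refine tendsto_integral_filter_of_dominated_convergence φ ?_ ?_ hφi
      (Eventually.of_forall fun z => ?_)
    · filter_upwards [self_mem_nhdsWithin] with t (ht : 0 < t)
      exact ((hφi.sub (integrable_integral_pairKernel_mul hN hk ht hφi)).pos_part).1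
    · filter_upwards [self_mem_nhdsWithin] with t (ht : 0 < t)
      refine Eventually.of_forall fun z => ?_
      have := integral_pairKernel_mul_nonneg hN hk ht h0 z
      rw [Real.norm_of_nonneg (le_max_right _ _)]
      exact max_le (by linarith) (h0 z)
    · have h1 := tendsto_integral_pairKernel_mul hN hk hφ hM z
      simpa using (h1.const_sub (φ z)).max (tendsto_const_nhds (x := (0 : ℝ)))
  rw [integral_zero] at hpos
  have h2 := hpos.const_mul 2
  rw [mul_zero] at h2
  refine squeeze_zero' (Eventually.of_forall fun t => integral_nonneg fun z => abs_nonneg _) ?_ h2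
  filter_upwards [self_mem_nhdsWithin] with t (ht : 0 < t)
  have hai := integrable_integral_pairKernel_mul hN hk ht hφi
  have hle := integral_integral_pairKernel_mul_le hN hk ht hφi h0
  have e : ∀ z, |(∫ w, pairKernel t z w * φ w) - φ z| =
      ((∫ w, pairKernel t z w * φ w) - φ z) +
        2 * max (φ z - ∫ w, pairKernel t z w * φ w) 0 := by
    intro z
    rcases le_total (φ z) (∫ w, pairKernel t z w * φ w) with h | h
    · rw [abs_of_nonneg (by linarith), max_eq_right (by linarith)]; ring
    · rw [abs_of_nonpos (by linarith), max_eq_left (by linarith)]; ring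
  simp only [e]
  have hmi : Integrable fun z => max (φ z - ∫ w, pairKernel t z w * φ w) 0 :=
    (hφi.sub hai).pos_part
  have hdi : Integrable fun z => (∫ w, pairKernel t z w * φ w) - φ z := hai.sub hφi
  rw [integral_add hdi (hmi.const_mul 2), integral_const_mul, integral_sub hai hφi]
  linarith

/-- The difference is bounded by `M`, so its `p`-th power is at most `M^{p-1}` times its absolute
value, and convergence in `L¹` suffices. -/
theorem tendsto_eLpNorm_sub_of_nonneg (hN : 1 ≤ N) (hk : 1 ≤ k) {p : ℝ} (hp : 1 ≤ p)
    {φ : Space N k → ℝ} (hφ : Continuous φ) (hs : HasCompactSupport φ) (h0 : ∀ w, 0 ≤ φ w) :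
    Tendsto (fun t => eLpNorm (fun z => (∫ w, pairKernel t z w * φ w) - φ z)
      (ENNReal.ofReal p) volume) (𝓝[>] 0) (𝓝 0) := by
  have hp0 : 0 < p := by linarith
  obtain ⟨M, hM⟩ := hs.exists_bound_of_continuous hφ
  have hM0 : 0 ≤ M := (norm_nonneg _).trans (hM 0)
  have hφi : Integrable φ := hφ.integrable_of_hasCompactSupport hs
  have h1 := ENNReal.tendsto_ofReal (tendsto_integral_abs_sub hN hk hφ hs h0)
  have h2 : Tendsto (fun t => (ENNReal.ofReal M ^ (p - 1) * ENNReal.ofReal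
      (∫ z, |(∫ w, pairKernel t z w * φ w) - φ z|)) ^ (1 / p)) (𝓝[>] 0) (𝓝 0) := by
    have h3 := ENNReal.Tendsto.const_mul (a := ENNReal.ofReal M ^ (p - 1)) h1
      (Or.inr (ENNReal.rpow_ne_top_of_nonneg (by linarith) ENNReal.ofReal_ne_top))
    have h4 := ((ENNReal.continuous_rpow_const (y := 1 / p)).tendsto _).comp h3
    simpa [hp0, Function.comp_def] using h4
  refine tendsto_of_tendsto_of_tendsto_of_le_of_le' tendsto_const_nhds h2
    (Eventually.of_forall fun _ => zero_le) ?_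
  filter_upwards [self_mem_nhdsWithin] with t (ht : 0 < t)
  have hai := integrable_integral_pairKernel_mul hN hk ht hφi
  rw [eLpNorm_eq_lintegral_rpow_enorm_toReal (by simpa using hp0) ENNReal.ofReal_ne_top,
    ENNReal.toReal_ofReal hp0.le]
  refine ENNReal.rpow_le_rpow ?_ (by positivity)
  have e1 : ENNReal.ofReal (∫ z, |(∫ w, pairKernel t z w * φ w) - φ z|) =
      ∫⁻ z, ‖(∫ w, pairKernel t z w * φ w) - φ z‖ₑ := by
    have hdi : Integrable fun z => (∫ w, pairKernel t z w * φ w) - φ z := hai.sub hφi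
    rw [← ofReal_integral_norm_eq_lintegral_enorm hdi]
    rfl
  rw [e1, ← lintegral_const_mul' _ _
    (ENNReal.rpow_ne_top_of_nonneg (by linarith) ENNReal.ofReal_ne_top)]
  refine lintegral_mono fun z => ?_
  have hb : |(∫ w, pairKernel t z w * φ w) - φ z| ≤ M := by
    have b1 := integral_pairKernel_mul_nonneg hN hk ht h0 z
    have hK := isSubMarkov_pairKernel hN hk ht (N := N) (k := k)
    have hiφ := integrable_pairKernel_mul hN hk ht z hφ hM
    have hi := integrable_pairKernel hN hk ht z
    have b2 : ∫ w, pairKernel t z w * φ w ≤ M := by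
      calc ∫ w, pairKernel t z w * φ w ≤ ∫ w, pairKernel t z w * M :=
            integral_mono hiφ (hi.mul_const M) fun w =>
              mul_le_mul_of_nonneg_left ((le_abs_self _).trans (hM w)) (hK.nonneg z w)
        _ = (∫ w, pairKernel t z w) * M := integral_mul_const _ _
        _ ≤ M := mul_le_of_le_one_left hM0 (integral_pairKernel_le_one hN hk ht z)
    have b3 := (le_abs_self _).trans (hM z)
    rw [abs_le]
    constructor <;> linarith [h0 z]
  have hb' : ‖(∫ w, pairKernel t z w * φ w) - φ z‖ₑ ≤ ENNReal.ofReal M := by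
    rw [← ofReal_norm]
    exact ENNReal.ofReal_le_ofReal hb
  calc ‖(∫ w, pairKernel t z w * φ w) - φ z‖ₑ ^ p
      = ‖(∫ w, pairKernel t z w * φ w) - φ z‖ₑ ^ (p - 1) *
          ‖(∫ w, pairKernel t z w * φ w) - φ z‖ₑ := by
        nth_rewrite 3 [← ENNReal.rpow_one ‖(∫ w, pairKernel t z w * φ w) - φ z‖ₑ]
        rw [← ENNReal.rpow_add_of_nonneg _ _ (by linarith) zero_le_one, sub_add_cancel]
    _ ≤ _ := by gcongr

theorem tendsto_eLpNorm_sub (hN : 1 ≤ N) (hk : 1 ≤ k) {p : ℝ} (hp : 1 ≤ p)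
    {φ : Space N k → ℝ} (hφ : Continuous φ) (hs : HasCompactSupport φ) :
    Tendsto (fun t => eLpNorm (fun z => (∫ w, pairKernel t z w * φ w) - φ z)
      (ENNReal.ofReal p) volume) (𝓝[>] 0) (𝓝 0) := by
  have hc₁ : Continuous fun w => max (φ w) 0 := by fun_prop
  have hc₂ : Continuous fun w => max (-φ w) 0 := by fun_prop
  have hs₁ : HasCompactSupport fun w => max (φ w) 0 := hs.comp_left (g := fun r => max r 0) (by simp)
  have hs₂ : HasCompactSupport fun w => max (-φ w) 0 :=
    hs.comp_left (g := fun r => max (-r) 0) (by simp)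
  have h₁ := tendsto_eLpNorm_sub_of_nonneg hN hk hp hc₁ hs₁ fun w => le_max_right _ _
  have h₂ := tendsto_eLpNorm_sub_of_nonneg hN hk hp hc₂ hs₂ fun w => le_max_right _ _
  have h := h₁.add h₂
  rw [add_zero] at h
  refine tendsto_of_tendsto_of_tendsto_of_le_of_le' tendsto_const_nhds h
    (Eventually.of_forall fun _ => zero_le) ?_
  filter_upwards [self_mem_nhdsWithin] with t (ht : 0 < t)
  obtain ⟨M₁, hM₁⟩ := hs₁.exists_bound_of_continuous hc₁
  obtain ⟨M₂, hM₂⟩ := hs₂.exists_bound_of_continuous hc₂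
  have hsplit : ∀ w, φ w = max (φ w) 0 - max (-φ w) 0 := fun w => by
    rcases le_total (φ w) 0 with h | h
    · rw [max_eq_right h, max_eq_left (by linarith)]; ring
    · rw [max_eq_left h, max_eq_right (by linarith)]; ring
  have e : (fun z => (∫ w, pairKernel t z w * φ w) - φ z) =
      (fun z => (∫ w, pairKernel t z w * max (φ w) 0) - max (φ z) 0) -
      (fun z => (∫ w, pairKernel t z w * max (-φ w) 0) - max (-φ z) 0) := by
    ext z
    have : ∀ w, pairKernel t z w * φ w =
        pairKernel t z w * max (φ w) 0 - pairKernel t z w * max (-φ w) 0 := fun w => by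
      rw [← mul_sub, ← hsplit]
    simp only [Pi.sub_apply, this]
    rw [integral_sub (integrable_pairKernel_mul hN hk ht z hc₁ hM₁)
      (integrable_pairKernel_mul hN hk ht z hc₂ hM₂)]
    linarith [hsplit z]
  have hm : ∀ ψ : Space N k → ℝ, Continuous ψ → AEStronglyMeasurable
      (fun z => (∫ w, pairKernel t z w * ψ w) - ψ z) volume := fun ψ hψ =>
    ((isSubMarkov_pairKernel hN hk ht (N := N) (k := k)).aestronglyMeasurable_integral
      hψ.aestronglyMeasurable).sub hψ.aestronglyMeasurable
  rw [e]
  exact eLpNorm_sub_le (hm _ hc₁) (hm _ hc₂) (by simpa using hp)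

/-- The heat semigroup as a family of operators on `L^p`. -/
noncomputable def heatOp (hN : 1 ≤ N) (hk : 1 ≤ k) {p : ℝ} [Fact (1 ≤ ENNReal.ofReal p)]
    (hp : 1 ≤ p) (t : ℝ) : LpSpace N k p →L[ℝ] LpSpace N k p :=
  if ht : 0 < t then (isSubMarkov_pairKernel hN hk ht).toCLM hp le_rfl
  else ContinuousLinearMap.id ℝ _

/-- The smoothing action of the heat semigroup from `L^p` to `L^q`. -/
noncomputable def smoothOp (hN : 1 ≤ N) (hk : 1 ≤ k) {p q : ℝ} [Fact (1 ≤ ENNReal.ofReal p)]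
    [Fact (1 ≤ ENNReal.ofReal q)] (hp : 1 ≤ p) (hpq : p ≤ q) (t : ℝ) :
    LpSpace N k p →L[ℝ] LpSpace N k q :=
  if ht : 0 < t then (isSubMarkov_pairKernel hN hk ht).toCLM hp hpq else 0

variable {p q : ℝ} [Fact (1 ≤ ENNReal.ofReal p)] [Fact (1 ≤ ENNReal.ofReal q)]

theorem kernelBound_mul_nonneg {t : ℝ} (ht : 0 < t) :
    0 ≤ kernelBound N k * t ^ (-(((N : ℝ) + 2 * k) / 2)) :=
  mul_nonneg (kernelBound_nonneg N k) (by positivity)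

theorem coeFn_heatOp (hN : 1 ≤ N) (hk : 1 ≤ k) (hp : 1 ≤ p) {t : ℝ} (φ : LpSpace N k p) :
    heatOp hN hk hp t φ =ᵐ[volume] semigroup t φ := by
  unfold heatOp semigroup
  split_ifs with ht
  · exact (isSubMarkov_pairKernel hN hk ht).coeFn_toCLM hp le_rfl φ
  · rfl

theorem coeFn_smoothOp (hN : 1 ≤ N) (hk : 1 ≤ k) (hp : 1 ≤ p) (hpq : p ≤ q) {t : ℝ} (ht : 0 < t)
    (φ : LpSpace N k p) : smoothOp (q := q) hN hk hp hpq t φ =ᵐ[volume] semigroup t φ := by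
  unfold smoothOp semigroup
  rw [dif_pos ht, if_pos ht]
  exact (isSubMarkov_pairKernel hN hk ht).coeFn_toCLM hp hpq φ

theorem norm_heatOp_le (hN : 1 ≤ N) (hk : 1 ≤ k) (hp : 1 ≤ p) (t : ℝ) :
    ‖heatOp (N := N) (k := k) (p := p) hN hk hp t‖ ≤ 1 := by
  unfold heatOp
  split_ifs with ht
  · exact (isSubMarkov_pairKernel hN hk ht).norm_toCLM_le_one (kernelBound_mul_nonneg ht) hp
  · exact ContinuousLinearMap.norm_id_le

theorem norm_smoothOp_le (hN : 1 ≤ N) (hk : 1 ≤ k) (hp : 1 ≤ p) (hpq : p ≤ q) {t : ℝ}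
    (ht : 0 < t) : ‖smoothOp (N := N) (k := k) (p := p) (q := q) hN hk hp hpq t‖ ≤
      kernelBound N k ^ (1 / p - 1 / q) *
        t ^ (-(((N : ℝ) + 2 * k) / 2 * (1 / p - 1 / q))) := by
  unfold smoothOp
  rw [dif_pos ht]
  refine ((isSubMarkov_pairKernel hN hk ht).norm_toCLM_le (kernelBound_mul_nonneg ht)
    hp hpq).trans_eq ?_
  rw [Real.mul_rpow (kernelBound_nonneg N k) (by positivity), ← Real.rpow_mul ht.le, neg_mul]

/-- Density of compactly supported continuous functions and contractivity: three errors of size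
`ε/4`. -/
theorem tendsto_heatOp (hN : 1 ≤ N) (hk : 1 ≤ k) (hp : 1 ≤ p) (φ : LpSpace N k p) :
    Tendsto (fun t => heatOp hN hk hp t φ) (𝓝[>] 0) (𝓝 φ) := by
  rw [Metric.tendsto_nhds]
  intro ε hε
  obtain ⟨g, hgs, hg, hgc, hgm⟩ := (Lp.memLp φ).exists_hasCompactSupport_eLpNorm_sub_le
    ENNReal.ofReal_ne_top (ε := ENNReal.ofReal (ε / 4)) (by simpa using hε)
  have h1 : ‖φ - hgm.toLp g‖ ≤ ε / 4 := by
    have : φ - hgm.toLp g = ((Lp.memLp φ).sub hgm).toLp _ := by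
      rw [MemLp.toLp_sub (Lp.memLp φ) hgm, Lp.toLp_coeFn]
    rw [this, Lp.norm_toLp]
    exact ENNReal.toReal_le_of_le_ofReal (by positivity) hg
  have h2 := tendsto_eLpNorm_sub hN hk hp hgc hgs
  filter_upwards [self_mem_nhdsWithin, h2.eventually_lt_const
    (u := ENNReal.ofReal (ε / 4)) (by simpa using hε)] with t (ht : 0 < t) hlt
  have h3 : ‖heatOp hN hk hp t (hgm.toLp g) - hgm.toLp g‖ ≤ ε / 4 := by
    rw [Lp.norm_def]
    refine ENNReal.toReal_le_of_le_ofReal (by positivity) ?_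
    refine (eLpNorm_congr_ae ?_).trans_le hlt.le
    filter_upwards [Lp.coeFn_sub (heatOp hN hk hp t (hgm.toLp g)) (hgm.toLp g),
      coeFn_heatOp hN hk hp (t := t) (hgm.toLp g), hgm.coeFn_toLp] with z hz1 hz2 hz3
    rw [hz1, Pi.sub_apply, hz2, hz3, semigroup, if_pos ht]
    congr 1
    refine integral_congr_ae ?_
    filter_upwards [hgm.coeFn_toLp] with w hw
    rw [hw]
    rfl
  have h4 : ‖heatOp hN hk hp t (φ - hgm.toLp g)‖ ≤ ε / 4 :=
    ((heatOp hN hk hp t).le_of_opNorm_le (norm_heatOp_le hN hk hp t) _).trans (by simpa using h1)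
  rw [dist_eq_norm]
  have e : heatOp hN hk hp t φ - φ = heatOp hN hk hp t (φ - hgm.toLp g) +
      (heatOp hN hk hp t (hgm.toLp g) - hgm.toLp g) - (φ - hgm.toLp g) := by
    rw [map_sub]; abel
  rw [e]
  refine (norm_sub_le _ _).trans_lt ?_
  have := norm_add_le (heatOp hN hk hp t (φ - hgm.toLp g))
    (heatOp hN hk hp t (hgm.toLp g) - hgm.toLp g)
  linarith

theorem heatOp_add (hN : 1 ≤ N) (hk : 1 ≤ k) (hp : 1 ≤ p) {t s : ℝ} (ht : 0 ≤ t) (hs : 0 ≤ s)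
    (φ : LpSpace N k p) : heatOp hN hk hp (t + s) φ = heatOp hN hk hp t (heatOp hN hk hp s φ) := by
  rcases ht.eq_or_lt with rfl | ht
  · simp [heatOp]
  rcases hs.eq_or_lt with rfl | hs
  · simp [heatOp]
  refine Lp.ext ?_
  filter_upwards [coeFn_heatOp hN hk hp (t := t + s) φ,
    coeFn_heatOp hN hk hp (t := t) (heatOp hN hk hp s φ)] with z hz1 hz2
  rw [hz1, hz2, semigroup, semigroup, if_pos ht, if_pos (add_pos ht hs)]
  have h := (isSubMarkov_pairKernel hN hk ht (N := N) (k := k)).integral_integral_mul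
    (isSubMarkov_pairKernel hN hk hs) (isSubMarkov_pairKernel hN hk (add_pos ht hs))
    (lintegral_heatKernel_mul_heatKernel hN hk ht hs) hp (Lp.memLp φ) z
  refine h.symm.trans (integral_congr_ae ?_)
  filter_upwards [coeFn_heatOp hN hk hp (t := s) φ] with w hw
  rw [hw, semigroup, if_pos hs]
  rfl

end HeatSemigroup

/-! ### Convolution in time with singular operator families. -/

section Convolution

variable {E H : Type*} [NormedAddCommGroup E] [NormedSpace ℝ E]
  [NormedAddCommGroup H] [NormedSpace ℝ H]

/-- At least one of `s` and `t - s` is `≥ t/2`, so one of the two singular powers can be frozen at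
`t/2`. This replaces the Beta integral by two elementary ones. -/
theorem rpow_mul_rpow_le {a b t s : ℝ} (ha : 0 ≤ a) (hb : 0 ≤ b) (hs : 0 < s) (hst : s < t) :
    (t - s) ^ (-a) * s ^ (-b) ≤ (t / 2) ^ (-a) * s ^ (-b) + (t / 2) ^ (-b) * (t - s) ^ (-a) := by
  have ht : 0 < t := hs.trans hst
  have hts : 0 < t - s := sub_pos.2 hst
  have p1 : 0 ≤ (t / 2) ^ (-a) * s ^ (-b) := by positivity
  have p2 : 0 ≤ (t / 2) ^ (-b) * (t - s) ^ (-a) := by positivity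
  rcases le_total s (t / 2) with h | h
  · have : (t - s) ^ (-a) ≤ (t / 2) ^ (-a) :=
      Real.rpow_le_rpow_of_nonpos (by positivity) (by linarith) (by linarith)
    have := mul_le_mul_of_nonneg_right this (by positivity : 0 ≤ s ^ (-b))
    linarith
  · have : s ^ (-b) ≤ (t / 2) ^ (-b) :=
      Real.rpow_le_rpow_of_nonpos (by positivity) h (by linarith)
    have := mul_le_mul_of_nonneg_left this (by positivity : 0 ≤ (t - s) ^ (-a))
    linarith

theorem intervalIntegrable_weight {a b : ℝ} (ha1 : a < 1) (hb1 : b < 1) (t c d : ℝ) :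
    IntervalIntegrable (fun s => c * s ^ (-b) + d * (t - s) ^ (-a)) volume 0 t := by
  refine ((intervalIntegral.intervalIntegrable_rpow' (by linarith)).const_mul c).add
    (IntervalIntegrable.const_mul ?_ d)
  have h := (intervalIntegral.intervalIntegrable_rpow' (a := 0) (b := t) (r := -a)
    (by linarith)).comp_sub_left t
  simpa using h.symm

theorem integral_weight {a b : ℝ} (ha1 : a < 1) (hb1 : b < 1) {t : ℝ} (ht : 0 < t) :
    ∫ s in (0 : ℝ)..t, ((t / 2) ^ (-a) * s ^ (-b) + (t / 2) ^ (-b) * (t - s) ^ (-a)) =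
      (2 ^ a / (1 - b) + 2 ^ b / (1 - a)) * t ^ (1 - a - b) := by
  have i1 : IntervalIntegrable (fun s : ℝ => s ^ (-b)) volume 0 t :=
    intervalIntegral.intervalIntegrable_rpow' (by linarith)
  have i2 : IntervalIntegrable (fun s : ℝ => (t - s) ^ (-a)) volume 0 t := by
    simpa using intervalIntegrable_weight ha1 hb1 t 0 1
  rw [intervalIntegral.integral_add (i1.const_mul _) (i2.const_mul _),
    intervalIntegral.integral_const_mul, intervalIntegral.integral_const_mul,
    intervalIntegral.integral_comp_sub_left (fun s => s ^ (-a)), sub_self, sub_zero,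
    integral_rpow (Or.inl (by linarith)), integral_rpow (Or.inl (by linarith)),
    Real.zero_rpow (by linarith), Real.zero_rpow (by linarith), sub_zero, sub_zero,
    Real.div_rpow ht.le zero_le_two, Real.div_rpow ht.le zero_le_two,
    Real.rpow_neg zero_le_two, Real.rpow_neg zero_le_two]
  have e1 : t ^ (1 - a - b) = t ^ (-a) * t ^ (-b + 1) := by
    rw [← Real.rpow_add ht]; congr 1; ring
  have e2 : t ^ (1 - a - b) = t ^ (-b) * t ^ (-a + 1) := by
    rw [← Real.rpow_add ht]; congr 1; ring
  have n1 : 1 - a ≠ 0 := by linarith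
  have n2 : 1 - b ≠ 0 := by linarith
  rw [add_mul]
  nth_rewrite 1 [e1]
  rw [e2, show -b + 1 = 1 - b by ring, show -a + 1 = 1 - a by ring]
  field_simp

/-- A strongly continuous family of operators with `‖P t‖ ≤ C t^{-a}`. -/
structure IsSingularFamily (P : ℝ → E →L[ℝ] H) (a C : ℝ) : Prop where
  nonneg : 0 ≤ a
  lt_one : a < 1
  const_nonneg : 0 ≤ C
  continuousOn : ∀ x, ContinuousOn (fun t => P t x) (Ioi 0)
  norm_le : ∀ t, 0 < t → ‖P t‖ ≤ C * t ^ (-a)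

/-- `t ↦ ∫₀ᵗ P(t-s) g(s) ds`. -/
noncomputable def convolve (P : ℝ → E →L[ℝ] H) (g : ℝ → E) (t : ℝ) : H :=
  ∫ s in (0 : ℝ)..t, P (t - s) (g s)

/-- A continuous function on `(0,T]` with `‖g s‖ ≤ M s^{-b}`. -/
structure IsWeighted (g : ℝ → E) (T b M : ℝ) : Prop where
  continuousOn : ContinuousOn g (Ioc 0 T)
  norm_le : ∀ s ∈ Ioc 0 T, ‖g s‖ ≤ M * s ^ (-b)

namespace IsSingularFamily

variable {P : ℝ → E →L[ℝ] H} {a C : ℝ}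

/-- Strong continuity together with locally bounded operator norms gives joint continuity. -/
theorem continuousOn_uncurry (hP : IsSingularFamily P a C) :
    ContinuousOn (fun q : ℝ × E => P q.1 q.2) (Ioi 0 ×ˢ univ) := by
  rintro ⟨t₀, x₀⟩ ⟨ht₀, -⟩
  have ht₀ : 0 < t₀ := ht₀
  have ho : Ioi (0 : ℝ) ×ˢ (univ : Set E) ∈ 𝓝 (t₀, x₀) :=
    prod_mem_nhds (Ioi_mem_nhds ht₀) univ_mem
  refine ContinuousAt.continuousWithinAt ?_
  have h1 : Tendsto (fun q : ℝ × E => P q.1 x₀) (𝓝 (t₀, x₀)) (𝓝 (P t₀ x₀)) :=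
    ((hP.continuousOn x₀).continuousAt (Ioi_mem_nhds ht₀)).tendsto.comp
      (continuous_fst.tendsto (t₀, x₀))
  have h2 : Tendsto (fun q : ℝ × E => C * q.1 ^ (-a) * ‖q.2 - x₀‖) (𝓝 (t₀, x₀)) (𝓝 0) := by
    have c1 : ContinuousAt (fun q : ℝ × E => C * q.1 ^ (-a) * ‖q.2 - x₀‖) (t₀, x₀) := by
      have : ContinuousAt (fun q : ℝ × E => q.1 ^ (-a)) (t₀, x₀) :=
        continuousAt_fst.rpow_const (Or.inl ht₀.ne')
      fun_prop
    simpa using c1.tendsto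
  have h3 : Tendsto (fun q : ℝ × E => P q.1 (q.2 - x₀)) (𝓝 (t₀, x₀)) (𝓝 0) := by
    refine squeeze_zero_norm' ?_ h2
    filter_upwards [ho] with q hq
    exact (P q.1).le_of_opNorm_le (hP.norm_le q.1 hq.1) _
  have h4 := h3.add h1
  rw [zero_add] at h4
  refine h4.congr fun q => ?_
  rw [map_sub, sub_add_cancel]

variable {g : ℝ → E} {T b M : ℝ}

theorem continuousOn_integrand (hP : IsSingularFamily P a C) (hg : IsWeighted g T b M) {t : ℝ}
    (ht : t ≤ T) : ContinuousOn (fun s => P (t - s) (g s)) (Ioo 0 t) := by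
  refine hP.continuousOn_uncurry.comp (f := fun s => (t - s, g s)) (ContinuousOn.prodMk (by fun_prop)
    (hg.continuousOn.mono fun s hs => ⟨hs.1, hs.2.le.trans ht⟩)) fun s hs => ⟨?_, mem_univ _⟩
  exact sub_pos.2 hs.2

theorem norm_integrand_le (hP : IsSingularFamily P a C) (hg : IsWeighted g T b M) {t s : ℝ}
    (ht : t ≤ T) (hs : s ∈ Ioo 0 t) :
    ‖P (t - s) (g s)‖ ≤ C * M * ((t - s) ^ (-a) * s ^ (-b)) := by
  have h1 := (P (t - s)).le_of_opNorm_le (hP.norm_le (t - s) (sub_pos.2 hs.2)) (g s)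
  have h2 := hg.norm_le s ⟨hs.1, hs.2.le.trans ht⟩
  have h3 : 0 ≤ C * (t - s) ^ (-a) :=
    mul_nonneg hP.const_nonneg (Real.rpow_nonneg (sub_pos.2 hs.2).le _)
  refine h1.trans ((mul_le_mul_of_nonneg_left h2 h3).trans_eq (by ring))

/-- The endpoint `s = t`, where the operator is `P 0` and carries no information, is a null set. -/
theorem _root_.Grushin.ae_restrict_Ioc_of_Ioo {p : ℝ → Prop} {t : ℝ} (h : ∀ s ∈ Ioo 0 t, p s) :
    ∀ᵐ s, s ∈ Ioc 0 t → p s := by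
  have : ∀ᵐ s : ℝ, s ≠ t := Measure.ae_ne volume t
  filter_upwards [this] with s hs hs2
  exact h s ⟨hs2.1, lt_of_le_of_ne hs2.2 hs⟩

theorem aestronglyMeasurable_integrand (hP : IsSingularFamily P a C) (hg : IsWeighted g T b M)
    {t : ℝ} (ht : t ≤ T) :
    AEStronglyMeasurable (fun s => P (t - s) (g s)) (volume.restrict (Ioc 0 t)) := by
  rw [← Measure.restrict_congr_set (Ioo_ae_eq_Ioc (μ := volume) (a := (0 : ℝ)) (b := t))]
  exact (hP.continuousOn_integrand hg ht).aestronglyMeasurable measurableSet_Ioo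

theorem norm_integrand_le_weight (hP : IsSingularFamily P a C) (hb : 0 ≤ b) (hM : 0 ≤ M)
    (hg : IsWeighted g T b M) {t s : ℝ}
    (ht : t ≤ T) (hs : s ∈ Ioo 0 t) :
    ‖P (t - s) (g s)‖ ≤
      C * M * ((t / 2) ^ (-a) * s ^ (-b) + (t / 2) ^ (-b) * (t - s) ^ (-a)) :=
  (hP.norm_integrand_le hg ht hs).trans (mul_le_mul_of_nonneg_left
    (rpow_mul_rpow_le hP.nonneg hb hs.1 hs.2) (mul_nonneg hP.const_nonneg hM))

theorem intervalIntegrable (hP : IsSingularFamily P a C) (hb : 0 ≤ b) (hb1 : b < 1) (hM : 0 ≤ M)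
    (hg : IsWeighted g T b M) {t : ℝ} (ht0 : 0 ≤ t) (ht : t ≤ T) :
    IntervalIntegrable (fun s => P (t - s) (g s)) volume 0 t := by
  refine ((intervalIntegrable_weight hP.lt_one hb1 t ((t / 2) ^ (-a)) ((t / 2) ^ (-b))).const_mul
    (C * M)).mono_fun' ?_ ?_
  · rw [uIoc_of_le ht0]; exact hP.aestronglyMeasurable_integrand hg ht
  · rw [uIoc_of_le ht0]
    exact (ae_restrict_iff' measurableSet_Ioc).2
      (ae_restrict_Ioc_of_Ioo fun s hs => hP.norm_integrand_le_weight hb hM hg ht hs)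

theorem norm_convolve_le (hP : IsSingularFamily P a C) (hb : 0 ≤ b) (hb1 : b < 1) (hM : 0 ≤ M)
    (hg : IsWeighted g T b M) {t : ℝ} (ht0 : 0 < t) (ht : t ≤ T) :
    ‖convolve P g t‖ ≤
      C * M * ((2 ^ a / (1 - b) + 2 ^ b / (1 - a)) * t ^ (1 - a - b)) := by
  rw [← integral_weight hP.lt_one hb1 ht0, ← intervalIntegral.integral_const_mul]
  exact intervalIntegral.norm_integral_le_of_norm_le ht0.le
    (ae_restrict_Ioc_of_Ioo fun s hs => hP.norm_integrand_le_weight hb hM hg ht hs)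
    ((intervalIntegrable_weight hP.lt_one hb1 t _ _).const_mul _)

/-- The substitution `s = tσ` fixes the interval of integration, so that dominated convergence can
yield continuity in `t`. -/
theorem convolve_eq_smul (P : ℝ → E →L[ℝ] H) (g : ℝ → E) (t : ℝ) :
    convolve P g t = t • ∫ σ in (0 : ℝ)..1, P (t - t * σ) (g (t * σ)) := by
  rw [intervalIntegral.smul_integral_comp_mul_left (f := fun s => P (t - s) (g s)), mul_zero,
    mul_one, convolve]

theorem continuousOn_convolve (hP : IsSingularFamily P a C) (hb : 0 ≤ b) (hb1 : b < 1)
    (hM : 0 ≤ M) (hg : IsWeighted g T b M) : ContinuousOn (convolve P g) (Ioc 0 T) := by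
  intro t₀ ht₀
  rw [funext (convolve_eq_smul P g)]
  refine continuousWithinAt_id.smul (f := fun t : ℝ => t) ?_
  -- For `t > t₀/2` the negative powers of `t` are at most those of `t₀/2`, so the majorant is
  -- independent of `t`.
  set D := C * M * ((t₀ / 2) ^ (-a) * (t₀ / 2) ^ (-b)) with hD
  have hD0 : 0 ≤ D := by
    have := hP.const_nonneg
    have := ht₀.1
    positivity
  have hnear : ∀ᶠ t in 𝓝[Ioc 0 T] t₀, t₀ / 2 < t ∧ t ∈ Ioc 0 T :=
    (eventually_nhdsWithin_of_eventually_nhds (eventually_gt_nhds (half_lt_self ht₀.1))).and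
      self_mem_nhdsWithin
  have hmem : ∀ {t σ : ℝ}, 0 < t → σ ∈ Ioo (0 : ℝ) 1 → t * σ ∈ Ioo 0 t := fun ht hσ =>
    ⟨mul_pos ht hσ.1, mul_lt_of_lt_one_right ht hσ.2⟩
  refine intervalIntegral.continuousWithinAt_of_dominated_interval
    (bound := fun σ => D * ((1 / 2) ^ (-a) * σ ^ (-b) + (1 / 2) ^ (-b) * (1 - σ) ^ (-a))) ?_ ?_
    ((intervalIntegrable_weight hP.lt_one hb1 1 _ _).const_mul D) ?_
  · filter_upwards [hnear] with t ht
    rw [uIoc_of_le zero_le_one,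
      ← Measure.restrict_congr_set (Ioo_ae_eq_Ioc (μ := volume) (a := (0 : ℝ)) (b := 1))]
    refine ContinuousOn.aestronglyMeasurable ?_ measurableSet_Ioo
    exact (hP.continuousOn_integrand hg ht.2.2).comp (f := fun σ => t * σ) (by fun_prop)
      fun σ hσ => hmem ht.2.1 hσ
  · filter_upwards [hnear] with t ht
    rw [uIoc_of_le zero_le_one]
    refine ae_restrict_Ioc_of_Ioo fun σ hσ => ?_
    refine (hP.norm_integrand_le hg ht.2.2 (hmem ht.2.1 hσ)).trans ?_
    have e : t - t * σ = t * (1 - σ) := by ring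
    have h1σ : 0 < 1 - σ := sub_pos.2 hσ.2
    rw [e, Real.mul_rpow ht.2.1.le h1σ.le, Real.mul_rpow ht.2.1.le hσ.1.le]
    have hh : 0 < t₀ / 2 := half_pos ht₀.1
    have b1 : t ^ (-a) ≤ (t₀ / 2) ^ (-a) :=
      Real.rpow_le_rpow_of_nonpos hh ht.1.le (by linarith [hP.nonneg])
    have b2 : t ^ (-b) ≤ (t₀ / 2) ^ (-b) :=
      Real.rpow_le_rpow_of_nonpos hh ht.1.le (by linarith)
    have b3 := rpow_mul_rpow_le hP.nonneg hb hσ.1 hσ.2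
    have hCM : 0 ≤ C * M := mul_nonneg hP.const_nonneg hM
    have ht0 := ht.2.1
    have hσ0 := hσ.1
    calc C * M * (t ^ (-a) * (1 - σ) ^ (-a) * (t ^ (-b) * σ ^ (-b)))
        = C * M * (t ^ (-a) * t ^ (-b)) * ((1 - σ) ^ (-a) * σ ^ (-b)) := by ring
      _ ≤ C * M * ((t₀ / 2) ^ (-a) * (t₀ / 2) ^ (-b)) * ((1 - σ) ^ (-a) * σ ^ (-b)) := by gcongr
      _ ≤ _ := mul_le_mul_of_nonneg_left b3 hD0
  · rw [uIoc_of_le zero_le_one]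
    refine ae_restrict_Ioc_of_Ioo fun σ hσ => ?_
    refine ContinuousWithinAt.comp_of_eq (f := fun t : ℝ => (t - t * σ, g (t * σ)))
      (g := fun q : ℝ × E => P q.1 q.2) (t := Ioi 0 ×ˢ univ) (hP.continuousOn_uncurry _ ⟨?_, mem_univ _⟩)
      (ContinuousWithinAt.prodMk (by fun_prop) ?_) (fun t ht => ⟨?_, mem_univ _⟩) rfl
    · exact sub_pos.2 (hmem ht₀.1 hσ).2
    · refine (hg.continuousOn _ ?_).comp (f := fun t : ℝ => t * σ) (by fun_prop) fun t ht => ?_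
      · exact ⟨(hmem ht₀.1 hσ).1, (hmem ht₀.1 hσ).2.le.trans ht₀.2⟩
      · exact ⟨(hmem ht.1 hσ).1, (hmem ht.1 hσ).2.le.trans ht.2⟩
    · exact sub_pos.2 (hmem ht.1 hσ).2

end IsSingularFamily

end Convolution

/-! ### Abstract smoothing systems and estimates of the Duhamel integral. -/

/-- A contraction semigroup `S` on `E` that smooths into `F` with rate `t^{-α}`, together with a
locally Lipschitz nonlinearity `f : F → E` of power growth `ρ`, where `αρ < 1`. The closed subspace
`graph` of `E × F` identifies the elements common to `E` and `F`. -/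
structure SmoothingSystem (E F : Type*) [NormedAddCommGroup E] [NormedSpace ℝ E]
    [NormedAddCommGroup F] [NormedSpace ℝ F] (α ρ : ℝ) where
  S : ℝ → E →L[ℝ] E
  R : ℝ → E →L[ℝ] F
  graph : Submodule ℝ (E × F)
  f : F → E
  C : ℝ
  L : ℝ
  S_zero : S 0 = ContinuousLinearMap.id ℝ E
  S_add : ∀ t s, 0 ≤ t → 0 ≤ s → ∀ x, S (t + s) x = S t (S s x)
  norm_S_le : ∀ t, ‖S t‖ ≤ 1
  tendsto_S : ∀ x, Tendsto (fun t => S t x) (𝓝[>] 0) (𝓝 x)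
  C_nonneg : 0 ≤ C
  L_nonneg : 0 ≤ L
  norm_R_le : ∀ t, 0 < t → ‖R t‖ ≤ C * t ^ (-α)
  isClosed_graph : IsClosed (graph : Set (E × F))
  eq_zero_of_graph : ∀ v, ((0 : E), v) ∈ graph → v = 0
  mem_graph : ∀ t, 0 < t → ∀ x, (S t x, R t x) ∈ graph
  norm_R_le_of_graph : ∀ t, 0 < t → ∀ x v, (x, v) ∈ graph → ‖R t x‖ ≤ ‖v‖
  f_zero : f 0 = 0
  norm_f_sub_le : ∀ v w, ‖f v - f w‖ ≤ L * (‖v‖ ^ (ρ - 1) + ‖w‖ ^ (ρ - 1)) * ‖v - w‖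
  α_nonneg : 0 ≤ α
  one_lt_ρ : 1 < ρ
  mul_lt_one : α * ρ < 1

namespace SmoothingSystem

variable {E F : Type*} [NormedAddCommGroup E] [NormedSpace ℝ E]
  [NormedAddCommGroup F] [NormedSpace ℝ F] {α ρ : ℝ} (A : SmoothingSystem E F α ρ)

theorem α_lt_one (A : SmoothingSystem E F α ρ) : α < 1 := by
  nlinarith [A.α_nonneg, A.one_lt_ρ, A.mul_lt_one]

theorem mul_exponent_nonneg (A : SmoothingSystem E F α ρ) : 0 ≤ α * ρ := mul_nonneg A.α_nonneg (by linarith [A.one_lt_ρ])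

theorem eq_of_graph {x : E} {v w : F} (hv : (x, v) ∈ A.graph) (hw : (x, w) ∈ A.graph) : v = w := by
  have := A.graph.sub_mem hv hw
  rw [Prod.mk_sub_mk, sub_self] at this
  exact sub_eq_zero.1 (A.eq_zero_of_graph _ this)

theorem norm_S_apply_le (t : ℝ) (x : E) : ‖A.S t x‖ ≤ ‖x‖ := by
  simpa using (A.S t).le_of_opNorm_le (A.norm_S_le t) x

theorem norm_R_apply_le {t B : ℝ} (ht : 0 < t) {x : E} (hx : ‖x‖ ≤ B) :
    ‖A.R t x‖ ≤ A.C * B * t ^ (-α) := by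
  have hC := A.C_nonneg
  refine ((A.R t).le_of_opNorm_le (A.norm_R_le t ht) x).trans ?_
  calc A.C * t ^ (-α) * ‖x‖ ≤ A.C * t ^ (-α) * B := by gcongr
    _ = _ := by ring

/-- Contractivity gives `‖S(t)x - S(s)x‖ ≤ ‖S(t - s)x - x‖` for `s ≤ t`, a modulus independent of
the base point; right continuity at zero thus yields two-sided continuity. -/
theorem continuousOn_S (x : E) : ContinuousOn (fun t => A.S t x) (Ici 0) := by
  intro t₀ ht₀
  have h := A.tendsto_S x
  rw [Metric.continuousWithinAt_iff]
  intro ε hε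
  have h1 := Metric.tendsto_nhdsWithin_nhds.1 h ε hε
  obtain ⟨δ, hδ, hd⟩ := h1
  have key : ∀ s t : ℝ, 0 ≤ s → s < t → t - s < δ → dist (A.S t x) (A.S s x) < ε := by
    intro s t hs hst hts
    have e : A.S t x = A.S s (A.S (t - s) x) := by
      rw [← A.S_add s (t - s) hs (by linarith), add_sub_cancel]
    rw [e, dist_eq_norm, ← map_sub]
    refine (A.norm_S_apply_le _ _).trans_lt ?_
    rw [← dist_eq_norm]
    refine hd (sub_pos.2 hst) ?_
    rw [Real.dist_eq, sub_zero, abs_of_pos (sub_pos.2 hst)]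
    exact hts
  refine ⟨δ, hδ, fun t ht htd => ?_⟩
  rw [Real.dist_eq, abs_lt] at htd
  rcases lt_trichotomy t t₀ with h | h | h
  · rw [dist_comm]; exact key t t₀ ht h (by linarith)
  · rw [h, dist_self]; exact hε
  · exact key t₀ t ht₀ h (by linarith)

/-- Both sides are the `F`-representative of the same element `S(t + s)x`, and such a representative
is unique. -/
theorem R_add {t s : ℝ} (ht : 0 < t) (hs : 0 ≤ s) (x : E) : A.R (t + s) x = A.R t (A.S s x) := by
  refine A.eq_of_graph (A.mem_graph (t + s) (by linarith) x) ?_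
  rw [A.S_add t s ht.le hs]
  exact A.mem_graph t ht _

theorem isSingularFamily_S : IsSingularFamily A.S 0 1 where
  nonneg := le_rfl
  lt_one := one_pos
  const_nonneg := zero_le_one
  continuousOn x := (A.continuousOn_S x).mono Ioi_subset_Ici_self
  norm_le t ht := by simpa using A.norm_S_le t

/-- Near `t₀` one factors `R(t) = R(t₀/2) S(t - t₀/2)`, so continuity is inherited from `S`. -/
theorem isSingularFamily_R : IsSingularFamily A.R α A.C where
  nonneg := A.α_nonneg
  lt_one := A.α_lt_one
  const_nonneg := A.C_nonneg
  norm_le := A.norm_R_le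
  continuousOn x := by
    intro t₀ (ht₀ : 0 < t₀)
    refine ContinuousAt.continuousWithinAt ?_
    have h1 : ContinuousAt (fun t => A.R (t₀ / 2) (A.S (t - t₀ / 2) x)) t₀ := by
      refine (A.R (t₀ / 2)).continuous.continuousAt.comp ?_
      have hd : ContinuousAt (fun t => A.S t x) (t₀ - t₀ / 2) :=
        (A.continuousOn_S x).continuousAt (Ici_mem_nhds (by linarith))
      exact ContinuousAt.comp (f := fun t => t - t₀ / 2) (g := fun t => A.S t x) hd (by fun_prop)
    refine h1.congr ?_
    filter_upwards [Ioi_mem_nhds (half_lt_self ht₀)] with t (ht : t₀ / 2 < t)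
    rw [← A.R_add (half_pos ht₀) (by linarith), add_sub_cancel]

theorem norm_f_le (v : F) : ‖A.f v‖ ≤ A.L * ‖v‖ ^ ρ := by
  have h := A.norm_f_sub_le v 0
  have h1 : ρ - 1 ≠ 0 := by linarith [A.one_lt_ρ]
  rw [A.f_zero, sub_zero, sub_zero, norm_zero, Real.zero_rpow h1, add_zero, mul_assoc] at h
  refine h.trans_eq ?_
  congr 1
  rcases eq_or_ne ‖v‖ 0 with hv | hv
  · rw [hv, mul_zero, Real.zero_rpow (by linarith [A.one_lt_ρ])]
  · nth_rewrite 2 [← Real.rpow_one ‖v‖]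
    rw [← Real.rpow_add (lt_of_le_of_ne (norm_nonneg v) hv.symm), sub_add_cancel]

theorem continuous_f : Continuous A.f := by
  rw [continuous_iff_continuousAt]
  intro v
  have hρ : 0 ≤ ρ - 1 := by linarith [A.one_lt_ρ]
  have h1 : Tendsto (fun w => A.L * (‖w‖ ^ (ρ - 1) + ‖v‖ ^ (ρ - 1)) * ‖w - v‖) (𝓝 v) (𝓝 0) := by
    have hc : Continuous fun w : F => A.L * (‖w‖ ^ (ρ - 1) + ‖v‖ ^ (ρ - 1)) * ‖w - v‖ := by
      have : Continuous fun w : F => ‖w‖ ^ (ρ - 1) := continuous_norm.rpow_const fun _ => Or.inr hρ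
      fun_prop
    simpa using hc.tendsto v
  have h2 := squeeze_zero_norm (fun w => A.norm_f_sub_le w v) h1
  have h3 := h2.add_const (A.f v)
  simpa [ContinuousAt] using h3

/-- The mild-solution map `S(t)φ + ∫₀ᵗ S(t-s) f(v(s)) ds`. -/
noncomputable def mild (φ : E) (v : ℝ → F) (t : ℝ) : E :=
  A.S t φ + convolve A.S (fun s => A.f (v s)) t

theorem mild_congr {φ : E} {v w : ℝ → F} {t : ℝ} (ht : 0 ≤ t) (h : EqOn v w (Ioc 0 t)) :
    A.mild φ v t = A.mild φ w t := by
  unfold mild convolve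
  congr 1
  refine intervalIntegral.integral_congr_ae (Eventually.of_forall fun s hs => ?_)
  rw [uIoc_of_le ht] at hs
  simp only [h hs]

/-- The power `ρ` turns the weight `s^{-α}` into `s^{-αρ}`, integrable at zero because `αρ < 1`. -/
theorem isWeighted_f {v : ℝ → F} {T M : ℝ} (hv : IsWeighted v T α M) (hM : 0 ≤ M) :
    IsWeighted (fun s => A.f (v s)) T (α * ρ) (A.L * M ^ ρ) where
  continuousOn := A.continuous_f.comp_continuousOn hv.continuousOn
  norm_le s hs := by
    have hs0 := hs.1
    refine (A.norm_f_le _).trans ?_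
    rw [mul_assoc]
    refine mul_le_mul_of_nonneg_left ?_ A.L_nonneg
    have h0 : 0 ≤ ρ := by linarith [A.one_lt_ρ]
    refine (Real.rpow_le_rpow (norm_nonneg _) (hv.norm_le s hs) h0).trans_eq ?_
    rw [Real.mul_rpow hM (by positivity), ← Real.rpow_mul hs0.le, neg_mul]

theorem isWeighted_f_sub {v w : ℝ → F} {T M K : ℝ} (hv : IsWeighted v T α M)
    (hw : IsWeighted w T α M) (hM : 0 ≤ M) (hvw : IsWeighted (fun s => v s - w s) T α K) :
    IsWeighted (fun s => A.f (v s) - A.f (w s)) T (α * ρ) (2 * A.L * M ^ (ρ - 1) * K) where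
  continuousOn := (A.continuous_f.comp_continuousOn hv.continuousOn).sub
    (A.continuous_f.comp_continuousOn hw.continuousOn)
  norm_le s hs := by
    have hs0 := hs.1
    have hρ : 0 ≤ ρ - 1 := by linarith [A.one_lt_ρ]
    have h1 : ∀ u : ℝ → F, IsWeighted u T α M →
        ‖u s‖ ^ (ρ - 1) ≤ M ^ (ρ - 1) * s ^ (-(α * (ρ - 1))) := fun u hu => by
      refine (Real.rpow_le_rpow (norm_nonneg _) (hu.norm_le s hs) hρ).trans_eq ?_
      rw [Real.mul_rpow hM (by positivity), ← Real.rpow_mul hs0.le, neg_mul]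
    have e : s ^ (-(α * ρ)) = s ^ (-(α * (ρ - 1))) * s ^ (-α) := by
      rw [← Real.rpow_add hs0]; congr 1; ring
    have hL := A.L_nonneg
    calc ‖A.f (v s) - A.f (w s)‖
        ≤ A.L * (‖v s‖ ^ (ρ - 1) + ‖w s‖ ^ (ρ - 1)) * ‖v s - w s‖ := A.norm_f_sub_le _ _
      _ ≤ A.L * (M ^ (ρ - 1) * s ^ (-(α * (ρ - 1))) + M ^ (ρ - 1) * s ^ (-(α * (ρ - 1)))) *
          (K * s ^ (-α)) := by
          gcongr
          · exact h1 v hv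
          · exact h1 w hw
          · exact hvw.norm_le s hs
      _ = _ := by rw [e]; ring

/-- The constant produced by the singular time integrals. -/
noncomputable def κ (_ : SmoothingSystem E F α ρ) : ℝ :=
  2 ^ α / (1 - α * ρ) + 2 ^ (α * ρ) / (1 - α)

theorem κ_nonneg : 0 ≤ A.κ := by
  have h1 : 0 < 1 - α * ρ := sub_pos.2 A.mul_lt_one
  have h2 : 0 < 1 - α := sub_pos.2 A.α_lt_one
  unfold κ
  positivity

/-- This is the contraction estimate: the exponent `1 - α - αρ` splits into the weight `t^{-α}` and
a positive power, which is bounded by `T^{1-αρ}` and makes short times contractive. -/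
theorem norm_convolve_sub_le {v w : ℝ → F} {T M K t : ℝ} (hv : IsWeighted v T α M)
    (hw : IsWeighted w T α M) (hM : 0 ≤ M) (hK : 0 ≤ K)
    (hvw : IsWeighted (fun s => v s - w s) T α K) (ht : t ∈ Ioc 0 T) :
    ‖convolve A.R (fun s => A.f (v s)) t - convolve A.R (fun s => A.f (w s)) t‖ ≤
      2 * A.C * A.L * A.κ * M ^ (ρ - 1) * K * T ^ (1 - α * ρ) * t ^ (-α) := by
  have hP := A.isSingularFamily_R
  have hLM : 0 ≤ A.L * M ^ ρ := mul_nonneg A.L_nonneg (by positivity)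
  have i1 := hP.intervalIntegrable A.mul_exponent_nonneg A.mul_lt_one hLM (A.isWeighted_f hv hM) ht.1.le ht.2
  have i2 := hP.intervalIntegrable A.mul_exponent_nonneg A.mul_lt_one hLM (A.isWeighted_f hw hM) ht.1.le ht.2
  have hL := A.L_nonneg
  have hC := A.C_nonneg
  have hκ := A.κ_nonneg
  have hd := hP.norm_convolve_le A.mul_exponent_nonneg A.mul_lt_one (by positivity)
    (A.isWeighted_f_sub hv hw hM hvw) ht.1 ht.2
  have e : convolve A.R (fun s => A.f (v s)) t - convolve A.R (fun s => A.f (w s)) t =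
      convolve A.R (fun s => A.f (v s) - A.f (w s)) t := by
    unfold convolve
    rw [← intervalIntegral.integral_sub i1 i2]
    simp only [map_sub]
  rw [e]
  refine hd.trans ?_
  have e2 : t ^ (1 - α - α * ρ) = t ^ (1 - α * ρ) * t ^ (-α) := by
    rw [← Real.rpow_add ht.1]; congr 1; ring
  have h3 : t ^ (1 - α * ρ) ≤ T ^ (1 - α * ρ) :=
    Real.rpow_le_rpow ht.1.le ht.2 (by linarith [A.mul_lt_one])
  have ht0 := ht.1
  rw [e2]
  calc _ = 2 * A.C * A.L * A.κ * M ^ (ρ - 1) * K * t ^ (1 - α * ρ) * t ^ (-α) := by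
        unfold κ; ring
    _ ≤ _ := by gcongr

theorem _root_.Grushin.isWeighted_zero {F : Type*} [NormedAddCommGroup F] {T α M : ℝ}
    (hM : 0 ≤ M) : IsWeighted (fun _ => (0 : F)) T α M where
  continuousOn := continuousOn_const
  norm_le s hs := by
    have := hs.1
    rw [norm_zero]; positivity

theorem norm_convolve_f_le {v : ℝ → F} {T M t : ℝ} (hv : IsWeighted v T α M) (hM : 0 ≤ M)
    (ht : t ∈ Ioc 0 T) :
    ‖convolve A.R (fun s => A.f (v s)) t‖ ≤
      2 * A.C * A.L * A.κ * M ^ (ρ - 1) * M * T ^ (1 - α * ρ) * t ^ (-α) := by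
  have h := A.norm_convolve_sub_le hv (isWeighted_zero hM) hM hM (by simpa using hv) ht
  have e : convolve A.R (fun _ => A.f (0 : F)) t = 0 := by
    simp [convolve, A.f_zero]
  rwa [e, sub_zero] at h

/-- The integrand lies in the closed subspace for almost every `s`. Pushed to the quotient by this
subspace it vanishes, and so does its integral. -/
theorem convolve_mem_graph [CompleteSpace E] [CompleteSpace F] {v : ℝ → F} {T M t : ℝ}
    (hv : IsWeighted v T α M) (hM : 0 ≤ M) (ht : t ∈ Ioc 0 T) :
    (convolve A.S (fun s => A.f (v s)) t, convolve A.R (fun s => A.f (v s)) t) ∈ A.graph := by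
  have hLM : 0 ≤ A.L * M ^ ρ := mul_nonneg A.L_nonneg (by positivity)
  have i1 := A.isSingularFamily_S.intervalIntegrable A.mul_exponent_nonneg A.mul_lt_one hLM
    (A.isWeighted_f hv hM) ht.1.le ht.2
  have i2 := A.isSingularFamily_R.intervalIntegrable A.mul_exponent_nonneg A.mul_lt_one hLM
    (A.isWeighted_f hv hM) ht.1.le ht.2
  have : IsClosed (A.graph : Set (E × F)) := A.isClosed_graph
  let π : E × F →L[ℝ] (E × F) ⧸ A.graph := A.graph.mkQL
  let h : ℝ → E × F := fun s => (A.S (t - s) (A.f (v s)), A.R (t - s) (A.f (v s)))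
  have hi : IntervalIntegrable h volume 0 t := by
    rw [intervalIntegrable_iff] at i1 i2 ⊢
    exact i1.prodMk i2
  have h1 : (convolve A.S (fun s => A.f (v s)) t, convolve A.R (fun s => A.f (v s)) t) =
      ∫ s in (0 : ℝ)..t, h s := by
    refine Prod.ext ?_ ?_
    · exact (ContinuousLinearMap.fst ℝ E F).intervalIntegral_comp_comm hi
    · exact (ContinuousLinearMap.snd ℝ E F).intervalIntegral_comp_comm hi
  have h2 : π (∫ s in (0 : ℝ)..t, h s) = 0 := by
    rw [← π.intervalIntegral_comp_comm hi]
    refine intervalIntegral.integral_zero_ae ?_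
    rw [uIoc_of_le ht.1.le]
    refine ae_restrict_Ioc_of_Ioo fun s hs => ?_
    exact (Submodule.Quotient.mk_eq_zero A.graph).2 (A.mem_graph (t - s) (sub_pos.2 hs.2) _)
  rw [h1]
  exact (Submodule.Quotient.mk_eq_zero A.graph).1 h2

end SmoothingSystem

/-! ### Restriction, translation and extension of weighted functions. -/

theorem IsWeighted.mono {E : Type*} [NormedAddCommGroup E] {g : ℝ → E} {T T' b M : ℝ}
    (h : IsWeighted g T b M) (hT : T' ≤ T) : IsWeighted g T' b M where
  continuousOn := h.continuousOn.mono (Ioc_subset_Ioc_right hT)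
  norm_le s hs := h.norm_le s ⟨hs.1, hs.2.trans hT⟩

theorem IsWeighted.mono_const {E : Type*} [NormedAddCommGroup E] {g : ℝ → E} {T b M M' : ℝ}
    (h : IsWeighted g T b M) (hM : M ≤ M') : IsWeighted g T b M' where
  continuousOn := h.continuousOn
  norm_le s hs := (h.norm_le s hs).trans
    (mul_le_mul_of_nonneg_right hM (Real.rpow_nonneg hs.1.le _))

theorem IsWeighted.congr {E : Type*} [NormedAddCommGroup E] {g g' : ℝ → E} {T b M : ℝ}
    (h : IsWeighted g T b M) (hg : EqOn g' g (Ioc 0 T)) : IsWeighted g' T b M where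
  continuousOn := h.continuousOn.congr hg
  norm_le s hs := by rw [hg hs]; exact h.norm_le s hs

theorem IsWeighted.comp_add_left {E : Type*} [NormedAddCommGroup E] {g : ℝ → E} {T b M : ℝ}
    (h : IsWeighted g T b M) (hb : 0 ≤ b) (hM : 0 ≤ M) {t₀ : ℝ} (ht₀ : 0 ≤ t₀) :
    IsWeighted (fun s => g (t₀ + s)) (T - t₀) b M where
  continuousOn := h.continuousOn.comp (f := fun s => t₀ + s) (by fun_prop)
    fun s hs => ⟨by linarith [hs.1], by linarith [hs.2]⟩
  norm_le s hs := (h.norm_le _ ⟨by linarith [hs.1], by linarith [hs.2]⟩).trans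
    (mul_le_mul_of_nonneg_left
      (Real.rpow_le_rpow_of_nonpos hs.1 (by linarith) (by linarith)) hM)

/-- Past `T` the function is bounded on a compact interval, and there `|T'|^b s^{-b} ≥ 1` absorbs
that bound into the weight. -/
theorem IsWeighted.exists_extend {E : Type*} [NormedAddCommGroup E] {g : ℝ → E} {T T' b M : ℝ}
    (h : IsWeighted g T b M) (hT : 0 < T) (hb : 0 ≤ b) (hM : 0 ≤ M)
    (hg : ContinuousOn g (Ioc 0 T')) : ∃ M', 0 ≤ M' ∧ IsWeighted g T' b M' := by
  obtain ⟨B, hB⟩ := isCompact_Icc.exists_bound_of_continuousOn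
    (hg.mono (fun s hs => ⟨hT.trans_le hs.1, hs.2⟩ : Icc T T' ⊆ Ioc 0 T'))
  refine ⟨M + |B| * |T'| ^ b, by positivity, hg, fun s hs => ?_⟩
  have hs0 := hs.1
  rw [add_mul]
  have p1 : 0 ≤ M * s ^ (-b) := by positivity
  have p2 : 0 ≤ |B| * |T'| ^ b * s ^ (-b) := by positivity
  rcases le_total s T with hsT | hsT
  · linarith [h.norm_le s ⟨hs0, hsT⟩]
  · have h1 := (hB s ⟨hsT, hs.2⟩).trans (le_abs_self B)
    have h2 : (1 : ℝ) ≤ |T'| ^ b * s ^ (-b) := by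
      rw [Real.rpow_neg hs0.le, ← div_eq_mul_inv, one_le_div (by positivity)]
      exact Real.rpow_le_rpow hs0.le (hs.2.trans (le_abs_self _)) hb
    have h3 := mul_le_mul_of_nonneg_left h2 (abs_nonneg B)
    rw [mul_one, ← mul_assoc] at h3
    linarith

/-! ### Uniqueness and local existence of abstract solutions. -/

namespace SmoothingSystem

variable {E F : Type*} [NormedAddCommGroup E] [NormedSpace ℝ E]
  [NormedAddCommGroup F] [NormedSpace ℝ F] {α ρ : ℝ}
  (A : SmoothingSystem E F α ρ)

/-- The `F`-valued function `v` on `(0,T]` is bounded by a multiple of `t^{-α}` and solves the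
mild equation with initial value `φ ∈ E`. -/
structure IsSol (φ : E) (T : ℝ) (v : ℝ → F) : Prop where
  pos : 0 < T
  weighted : ∃ M, 0 ≤ M ∧ IsWeighted v T α M
  mem_graph : ∀ t ∈ Ioc 0 T, (A.mild φ v t, v t) ∈ A.graph

variable {A} {φ : E} {T : ℝ} {v w : ℝ → F}

theorem IsSol.mono (h : A.IsSol φ T v) {T' : ℝ} (h0 : 0 < T') (hT : T' ≤ T) :
    A.IsSol φ T' v where
  pos := h0
  weighted := let ⟨M, hM, hv⟩ := h.weighted; ⟨M, hM, hv.mono hT⟩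
  mem_graph t ht := h.mem_graph t ⟨ht.1, ht.2.trans hT⟩

theorem IsSol.congr (h : A.IsSol φ T v) (hw : EqOn w v (Ioc 0 T)) : A.IsSol φ T w where
  pos := h.pos
  weighted := let ⟨M, hM, hv⟩ := h.weighted; ⟨M, hM, hv.congr hw⟩
  mem_graph t ht := by
    rw [A.mild_congr ht.1.le (hw.mono (Ioc_subset_Ioc_right ht.2)), hw ht]
    exact h.mem_graph t ht

-- At `t = 0` the Duhamel term is `O(t^{1-αρ})`, since `S` itself is not singular; elsewhere
-- `continuousOn_convolve` applies.
variable (A) in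
theorem continuousOn_mild {M : ℝ} (hv : IsWeighted v T α M) (hM : 0 ≤ M) (φ : E) :
    ContinuousOn (A.mild φ v) (Icc 0 T) := by
  have hP := A.isSingularFamily_S
  have hLM : 0 ≤ A.L * M ^ ρ := mul_nonneg A.L_nonneg (by positivity)
  refine ((A.continuousOn_S φ).mono Icc_subset_Ici_self).add ?_
  intro t ht
  rcases ht.1.eq_or_lt with rfl | h0
  · have e : convolve A.S (fun s => A.f (v s)) 0 = 0 := by simp [convolve]
    rw [ContinuousWithinAt, e]
    set c := 1 * (A.L * M ^ ρ) * (2 ^ (0 : ℝ) / (1 - α * ρ) + 2 ^ (α * ρ) / (1 - (0 : ℝ)))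
    have hl : Tendsto (fun t : ℝ => c * t ^ (1 - 0 - α * ρ)) (𝓝[Icc 0 T] 0) (𝓝 0) := by
      have hc : ContinuousAt (fun t : ℝ => c * t ^ (1 - 0 - α * ρ)) 0 :=
        continuousAt_const.mul (Real.continuousAt_rpow_const _ _
          (Or.inr (by linarith [A.mul_lt_one])))
      have := hc.tendsto
      rw [Real.zero_rpow (by linarith [A.mul_lt_one]), mul_zero] at this
      exact this.mono_left nhdsWithin_le_nhds
    refine squeeze_zero_norm' ?_ hl
    filter_upwards [self_mem_nhdsWithin] with t ht
    rcases ht.1.eq_or_lt with rfl | h0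
    · rw [e, norm_zero, Real.zero_rpow (by linarith [A.mul_lt_one]), mul_zero]
    · refine (hP.norm_convolve_le A.mul_exponent_nonneg A.mul_lt_one hLM
        (A.isWeighted_f hv hM) h0 ht.2).trans_eq ?_
      ring
  · have h1 := hP.continuousOn_convolve A.mul_exponent_nonneg A.mul_lt_one hLM (A.isWeighted_f hv hM)
      t ⟨h0, ht.2⟩
    refine h1.mono_of_mem_nhdsWithin ?_
    have : Ioi (0 : ℝ) ∈ 𝓝 t := Ioi_mem_nhds h0
    filter_upwards [mem_nhdsWithin_of_mem_nhds this, self_mem_nhdsWithin] with s h1 h2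
    exact ⟨h1, h2.2⟩

theorem exists_small_time (A : SmoothingSystem E F α ρ) (c : ℝ) : ∃ δ : ℝ, 0 < δ ∧ δ ≤ 1 ∧ c * δ ^ (1 - α * ρ) ≤ 1 / 2 := by
  have h0 : 1 - α * ρ ≠ 0 := by linarith [A.mul_lt_one]
  have hc : Tendsto (fun δ : ℝ => c * δ ^ (1 - α * ρ)) (𝓝[>] 0) (𝓝 0) := by
    have hc : ContinuousAt (fun t : ℝ => c * t ^ (1 - α * ρ)) 0 :=
      continuousAt_const.mul (Real.continuousAt_rpow_const _ _
        (Or.inr (by linarith [A.mul_lt_one])))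
    have := hc.tendsto
    rw [Real.zero_rpow h0, mul_zero] at this
    exact this.mono_left nhdsWithin_le_nhds
  have h1 : ∀ᶠ δ in 𝓝[>] (0 : ℝ), δ ∈ Ioc (0 : ℝ) 1 := Ioc_mem_nhdsGT one_pos
  obtain ⟨δ, h1, h2⟩ := (h1.and (hc.eventually_lt_const (by norm_num : (0 : ℝ) < 1 / 2))).exists
  exact ⟨δ, h1.1, h1.2, h2.le⟩

variable [CompleteSpace E]

-- The flow property: the integral is split at `t₀`, `S(t)` is pulled out of the first piece and the
-- second is translated. It allows solutions to be restarted.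
variable (A) in
theorem mild_add {M : ℝ} (hv : IsWeighted v T α M) (hM : 0 ≤ M) (φ : E) {t₀ t : ℝ}
    (ht₀ : 0 ≤ t₀) (ht : 0 ≤ t) (hT : t₀ + t ≤ T) :
    A.mild φ v (t₀ + t) = A.mild (A.mild φ v t₀) (fun s => v (t₀ + s)) t := by
  have hP := A.isSingularFamily_S
  have hLM : 0 ≤ A.L * M ^ ρ := mul_nonneg A.L_nonneg (by positivity)
  have hi := fun r (hr0 : 0 ≤ r) (hr : r ≤ T) =>
    hP.intervalIntegrable A.mul_exponent_nonneg A.mul_lt_one hLM (A.isWeighted_f hv hM) hr0 hr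
  have i1 := hi (t₀ + t) (by linarith) hT
  have i2 := hi t₀ ht₀ (by linarith)
  have hsub : IntervalIntegrable (fun s => A.S (t₀ + t - s) (A.f (v s))) volume 0 t₀ :=
    i1.mono_set (by
      rw [uIcc_of_le ht₀, uIcc_of_le (by linarith)]
      exact Icc_subset_Icc_right (by linarith))
  have hsub2 : IntervalIntegrable (fun s => A.S (t₀ + t - s) (A.f (v s))) volume t₀ (t₀ + t) :=
    i1.mono_set (by
      rw [uIcc_of_le (by linarith), uIcc_of_le (by linarith)]
      exact Icc_subset_Icc_left ht₀)
  have e1 : ∫ s in (0 : ℝ)..t₀, A.S (t₀ + t - s) (A.f (v s)) =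
      A.S t (convolve A.S (fun s => A.f (v s)) t₀) := by
    unfold convolve
    rw [← (A.S t).intervalIntegral_comp_comm i2]
    refine intervalIntegral.integral_congr_ae (Eventually.of_forall fun s hs => ?_)
    rw [uIoc_of_le ht₀] at hs
    rw [← A.S_add t (t₀ - s) ht (by linarith [hs.2])]
    congr 2; ring
  have e2 : ∫ s in t₀..(t₀ + t), A.S (t₀ + t - s) (A.f (v s)) =
      convolve A.S (fun s => A.f (v (t₀ + s))) t := by
    unfold convolve
    have := intervalIntegral.integral_comp_add_left (a := 0) (b := t)
      (fun s => A.S (t₀ + t - s) (A.f (v s))) t₀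
    rw [add_zero] at this
    rw [← this]
    simp only [add_sub_add_left_eq_sub]
  unfold mild
  rw [map_add, ← A.S_add t t₀ ht ht₀, add_comm t t₀, add_assoc]
  congr 1
  rw [← e1, ← e2, intervalIntegral.integral_add_adjacent_intervals hsub hsub2, convolve]

theorem IsSol.comp_add_left (h : A.IsSol φ T v) {t₀ : ℝ} (ht₀ : 0 ≤ t₀) (hT : t₀ < T) :
    A.IsSol (A.mild φ v t₀) (T - t₀) (fun s => v (t₀ + s)) := by
  obtain ⟨M, hM, hv⟩ := h.weighted
  refine ⟨by linarith, ⟨M, hM, hv.comp_add_left A.α_nonneg hM ht₀⟩, fun t ht => ?_⟩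
  rw [← A.mild_add hv hM φ ht₀ ht.1.le (by linarith [ht.2])]
  exact h.mem_graph _ ⟨by linarith [ht.1], by linarith [ht.2]⟩

variable [CompleteSpace F]

theorem mild_mem_graph {M t : ℝ} (hv : IsWeighted v T α M) (hM : 0 ≤ M) (ht : t ∈ Ioc 0 T) :
    (A.mild φ v t, A.R t φ + convolve A.R (fun s => A.f (v s)) t) ∈ A.graph :=
  A.graph.add_mem (A.mem_graph t ht.1 φ) (A.convolve_mem_graph hv hM ht)

/-- The two sides represent the same element of `E`, so the equation in `E` becomes a fixed-point
equation in `F`. -/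
theorem IsSol.eq (h : A.IsSol φ T v) {t : ℝ} (ht : t ∈ Ioc 0 T) :
    v t = A.R t φ + convolve A.R (fun s => A.f (v s)) t := by
  obtain ⟨M, hM, hv⟩ := h.weighted
  exact A.eq_of_graph (h.mem_graph t ht) (mild_mem_graph hv hM ht)

/-- Starting from the trivial bound `2M t^{-α}` for the difference, each use of the fixed-point
equation halves the constant. -/
theorem IsSol.eqOn_of_small (hv : A.IsSol φ T v) (hw : A.IsSol φ T w) {M : ℝ} (hM : 0 ≤ M)
    (wv : IsWeighted v T α M) (ww : IsWeighted w T α M)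
    (hs : 2 * A.C * A.L * A.κ * M ^ (ρ - 1) * T ^ (1 - α * ρ) ≤ 1 / 2) :
    EqOn v w (Ioc 0 T) := by
  have key : ∀ n : ℕ, IsWeighted (fun s => v s - w s) T α (2 * M / 2 ^ n) := by
    intro n
    induction n with
    | zero =>
      refine ⟨wv.continuousOn.sub ww.continuousOn, fun s hs => ?_⟩
      have := norm_sub_le (v s) (w s)
      have h1 := wv.norm_le s hs
      have h2 := ww.norm_le s hs
      rw [pow_zero, div_one]
      linarith
    | succ n ih =>
      refine ⟨ih.continuousOn, fun t ht => ?_⟩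
      rw [hv.eq ht, hw.eq ht, add_sub_add_left_eq_sub]
      have hK : 0 ≤ 2 * M / 2 ^ n := by positivity
      have h0 : 0 ≤ t ^ (-α) := Real.rpow_nonneg ht.1.le _
      refine (A.norm_convolve_sub_le wv ww hM hK ih ht).trans ?_
      refine mul_le_mul_of_nonneg_right ?_ h0
      have := mul_le_mul_of_nonneg_right hs hK
      rw [pow_succ]
      refine (le_of_eq ?_).trans (this.trans_eq ?_) <;> ring
  intro t ht
  have h1 : ∀ n : ℕ, ‖v t - w t‖ ≤ 2 * M * t ^ (-α) * (1 / 2) ^ n := fun n =>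
    ((key n).norm_le t ht).trans_eq (by rw [one_div, inv_pow]; ring)
  have h2 : Tendsto (fun n : ℕ => 2 * M * t ^ (-α) * (1 / 2 : ℝ) ^ n) atTop (𝓝 0) := by
    simpa using (tendsto_pow_atTop_nhds_zero_of_lt_one (by norm_num : (0 : ℝ) ≤ 1 / 2)
      (by norm_num)).const_mul (2 * M * t ^ (-α))
  have h3 : ‖v t - w t‖ ≤ 0 := ge_of_tendsto' h2 h1
  exact sub_eq_zero.1 (norm_le_zero_iff.1 h3)

/-- Uniqueness on intervals of length `δ` is propagated step by step. The same `δ` works throughout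
because translation does not increase `M`: `(t₀ + s)^{-α} ≤ s^{-α}`. -/
theorem IsSol.eqOn (hv : A.IsSol φ T v) (hw : A.IsSol φ T w) : EqOn v w (Ioc 0 T) := by
  obtain ⟨M₁, hM₁, wv⟩ := hv.weighted
  obtain ⟨M₂, hM₂, ww⟩ := hw.weighted
  replace wv := wv.mono_const (le_max_left M₁ M₂)
  replace ww := ww.mono_const (le_max_right M₁ M₂)
  have hM : 0 ≤ max M₁ M₂ := hM₁.trans (le_max_left _ _)
  generalize max M₁ M₂ = M at wv ww hM
  obtain ⟨δ, hδ, -, hs⟩ := A.exists_small_time (2 * A.C * A.L * A.κ * M ^ (ρ - 1))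
  have small : ∀ {φ : E} {T : ℝ} {v w : ℝ → F}, A.IsSol φ T v → A.IsSol φ T w →
      IsWeighted v T α M → IsWeighted w T α M → T ≤ δ → EqOn v w (Ioc 0 T) := by
    intro φ T v w hv hw wv ww hT
    refine hv.eqOn_of_small hw hM wv ww (le_trans ?_ hs)
    have := A.C_nonneg
    have := A.L_nonneg
    have := A.κ_nonneg
    have := hv.pos
    have : T ^ (1 - α * ρ) ≤ δ ^ (1 - α * ρ) :=
      Real.rpow_le_rpow hv.pos.le hT (by linarith [A.mul_lt_one])
    gcongr
  obtain ⟨n, hn⟩ := exists_nat_ge (T / δ)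
  rw [div_le_iff₀ hδ] at hn
  induction n generalizing φ T v w with
  | zero =>
    have := hv.pos
    simp only [Nat.cast_zero, zero_mul] at hn
    linarith
  | succ n ih =>
    rcases le_or_gt T δ with hT | hT
    · exact small hv hw wv ww hT
    · have h1 := small (hv.mono hδ hT.le) (hw.mono hδ hT.le) (wv.mono hT.le) (ww.mono hT.le) le_rfl
      have h2 := hw.comp_add_left hδ.le hT
      rw [← A.mild_congr hδ.le h1] at h2
      push_cast at hn
      have h3 := ih (hv.comp_add_left hδ.le hT) h2 (wv.comp_add_left A.α_nonneg hM hδ.le)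
        (ww.comp_add_left A.α_nonneg hM hδ.le) (by linarith)
      intro t ht
      rcases le_or_gt t δ with h | h
      · exact h1 ⟨ht.1, h⟩
      · simpa using h3 (x := t - δ) ⟨by linarith, by linarith [ht.2]⟩

variable (A) in
/-- Picard iteration: the time of existence depends only on the size of `R(t)φ`. -/
theorem exists_isSol_of_bound {a : ℝ} (ha : 0 ≤ a) : ∃ δ : ℝ, 0 < δ ∧ δ ≤ 1 ∧ ∀ φ : E,
    (∀ t ∈ Ioc 0 δ, ‖A.R t φ‖ ≤ a * t ^ (-α)) → ∃ v, A.IsSol φ δ v := by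
  -- The radius leaves room `a` for the free term and `1` for the Duhamel term.
  set r := a + 1 with hr
  have hr0 : 0 ≤ r := by positivity
  -- The factor `1 + r` secures both `c ≤ 1/2`, for the contraction, and `c r ≤ 1/2`, for invariance
  -- of the ball.
  obtain ⟨δ, hδ, hδ1, hs⟩ :=
    A.exists_small_time (2 * A.C * A.L * A.κ * r ^ (ρ - 1) * (1 + r))
  refine ⟨δ, hδ, hδ1, fun φ hφ => ?_⟩
  set c := 2 * A.C * A.L * A.κ * r ^ (ρ - 1) * δ ^ (1 - α * ρ) with hc
  have hc0 : 0 ≤ c := by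
    have := A.C_nonneg
    have := A.L_nonneg
    have := A.κ_nonneg
    positivity
  have hcr : c * (1 + r) ≤ 1 / 2 := by rw [hc]; refine (le_of_eq ?_).trans hs; ring
  have hc1 : c ≤ 1 / 2 := by nlinarith
  have hc2 : c * r ≤ 1 / 2 := by nlinarith
  let Φ : (ℝ → F) → ℝ → F := fun v t => A.R t φ + convolve A.R (fun s => A.f (v s)) t
  have hΦ : ∀ v, IsWeighted v δ α r → IsWeighted (Φ v) δ α r := by
    intro v hv
    refine ⟨?_, fun t ht => ?_⟩
    · exact ((A.isSingularFamily_R.continuousOn φ).mono fun s hs => hs.1).add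
        (A.isSingularFamily_R.continuousOn_convolve A.mul_exponent_nonneg A.mul_lt_one
          (mul_nonneg A.L_nonneg (by positivity)) (A.isWeighted_f hv hr0))
    · have h1 := A.norm_convolve_f_le hv hr0 ht
      have h0 : 0 ≤ t ^ (-α) := Real.rpow_nonneg ht.1.le _
      have h2 : ‖convolve A.R (fun s => A.f (v s)) t‖ ≤ c * r * t ^ (-α) :=
        h1.trans_eq (by rw [hc]; ring)
      refine (norm_add_le _ _).trans ((add_le_add (hφ t ht) h2).trans ?_)
      rw [← add_mul]
      exact mul_le_mul_of_nonneg_right (by linarith) h0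
  have hΦd : ∀ v w K, IsWeighted v δ α r → IsWeighted w δ α r → 0 ≤ K →
      IsWeighted (fun s => v s - w s) δ α K → ∀ t ∈ Ioc 0 δ, ‖Φ v t - Φ w t‖ ≤
        1 / 2 * K * t ^ (-α) := by
    intro v w K hv hw hK hd t ht
    have h0 : 0 ≤ t ^ (-α) := Real.rpow_nonneg ht.1.le _
    have h1 := A.norm_convolve_sub_le hv hw hr0 hK hd ht
    simp only [Φ, add_sub_add_left_eq_sub]
    refine h1.trans (mul_le_mul_of_nonneg_right ?_ h0)
    refine (le_of_eq ?_).trans (mul_le_mul_of_nonneg_right hc1 hK)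
    rw [hc]; ring
  let u : ℕ → ℝ → F := fun n => Φ^[n] 0
  have hu1 : ∀ n, u (n + 1) = Φ (u n) := fun n => Function.iterate_succ_apply' Φ n 0
  have hu : ∀ n, IsWeighted (u n) δ α r := by
    intro n
    induction n with
    | zero => exact isWeighted_zero hr0
    | succ n ih => rw [hu1]; exact hΦ _ ih
  have hd : ∀ n, IsWeighted (fun s => u n s - u (n + 1) s) δ α (2 * r / 2 ^ n) := by
    intro n
    have hco := (hu n).continuousOn.sub (hu (n + 1)).continuousOn
    induction n with
    | zero =>
      refine ⟨hco, fun t ht => ?_⟩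
      have h1 := (hu 0).norm_le t ht
      have h2 := (hu 1).norm_le t ht
      have h3 := norm_sub_le (u 0 t) (u 1 t)
      rw [pow_zero, div_one]
      simp only [zero_add]
      linarith
    | succ n ih =>
      refine ⟨hco, fun t ht => ?_⟩
      have ih' := ih ((hu n).continuousOn.sub (hu (n + 1)).continuousOn)
      rw [hu1 (n + 1)]
      nth_rewrite 1 [hu1 n]
      refine (hΦd _ _ _ (hu n) (hu (n + 1)) (by positivity) ih' t ht).trans_eq ?_
      rw [pow_succ]; ring
  have hd' : ∀ t ∈ Ioc 0 δ, ∀ n, dist (u n t) (u (n + 1) t) ≤ 4 * r * t ^ (-α) / 2 / 2 ^ n := by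
    intro t ht n
    rw [dist_eq_norm]
    refine ((hd n).norm_le t ht).trans_eq ?_
    ring
  have hlim : ∀ t ∈ Ioc 0 δ, ∃ x, Tendsto (fun n => u n t) atTop (𝓝 x) := fun t ht =>
    cauchySeq_tendsto_of_complete (cauchySeq_of_le_geometric_two (hd' t ht))
  choose! v hv using hlim
  have hdist : ∀ n, ∀ t ∈ Ioc 0 δ, dist (u n t) (v t) ≤ 4 * r * t ^ (-α) / 2 ^ n := fun n t ht =>
    dist_le_of_le_geometric_two_of_tendsto (hd' t ht) (hv t ht) n
  have hpow : ∀ x : ℝ, Tendsto (fun n : ℕ => x / 2 ^ n) atTop (𝓝 0) := fun x => by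
    simpa [div_eq_mul_inv] using (tendsto_pow_atTop_nhds_zero_of_lt_one
      (by norm_num : (0 : ℝ) ≤ 1 / 2) (by norm_num)).const_mul x
  -- The error bound contains `t^{-α}`, so convergence is uniform only away from zero, here on times
  -- above `t/2`.
  have hvc : ContinuousOn v (Ioc 0 δ) := by
    refine TendstoLocallyUniformlyOn.continuousOn (F := u) (p := atTop) ?_
      (Frequently.of_forall fun n => (hu n).continuousOn)
    rw [Metric.tendstoLocallyUniformlyOn_iff]
    intro ε hε t ht
    refine ⟨Ioi (t / 2) ∩ Ioc 0 δ, inter_mem (mem_nhdsWithin_of_mem_nhds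
      (Ioi_mem_nhds (half_lt_self ht.1))) self_mem_nhdsWithin, ?_⟩
    filter_upwards [(hpow (4 * r * (t / 2) ^ (-α))).eventually_lt_const hε] with n hn s hs
    rw [dist_comm]
    refine (hdist n s hs.2).trans_lt (lt_of_le_of_lt ?_ hn)
    have : s ^ (-α) ≤ (t / 2) ^ (-α) :=
      Real.rpow_le_rpow_of_nonpos (half_pos ht.1) hs.1.le (by linarith [A.α_nonneg])
    gcongr
  have hvw : IsWeighted v δ α r := ⟨hvc, fun t ht =>
    le_of_tendsto' (hv t ht).norm fun n => (hu n).norm_le t ht⟩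
  refine ⟨v, hδ, ⟨r, hr0, hvw⟩, fun t ht => ?_⟩
  have hfix : v t = Φ v t := by
    refine tendsto_nhds_unique ((tendsto_add_atTop_iff_nat 1).2 (hv t ht)) ?_
    rw [tendsto_iff_norm_sub_tendsto_zero]
    refine squeeze_zero (fun n => norm_nonneg _) (fun n => ?_) (hpow (1 / 2 * (4 * r) * t ^ (-α)))
    rw [hu1 n]
    refine (hΦd (u n) v (4 * r / 2 ^ n) (hu n) hvw (by positivity)
      ⟨(hu n).continuousOn.sub hvc, fun s hs => ?_⟩ t ht).trans_eq (by ring)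
    rw [← dist_eq_norm]
    exact (hdist n s hs).trans_eq (by ring)
  rw [hfix]
  exact mild_mem_graph hvw hr0 ht

end SmoothingSystem

/-! ### Continuation, lifespan and blow-up. -/

namespace SmoothingSystem

variable {E F : Type*} [NormedAddCommGroup E] [NormedSpace ℝ E] [CompleteSpace E]
  [NormedAddCommGroup F] [NormedSpace ℝ F] [CompleteSpace F] {α ρ : ℝ}
  {A : SmoothingSystem E F α ρ} {φ : E} {T : ℝ} {v w : ℝ → F}

/-- A solution can be prolonged by a solution issuing from one of its intermediate values. -/
theorem IsSol.glue (hv : A.IsSol φ T v) {t₀ δ : ℝ} (ht₀ : 0 < t₀) (hT : t₀ < T)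
    (hw : A.IsSol (A.mild φ v t₀) δ w) (hδ : T < t₀ + δ) : ∃ V, A.IsSol φ (t₀ + δ) V := by
  set V : ℝ → F := fun t => if t ≤ t₀ then v t else w (t - t₀) with hV
  have hsub : T - t₀ ≤ δ := by linarith
  have hT0 : 0 < T - t₀ := by linarith
  -- The restarted solution agrees with `v` on the overlap `(t₀, T]`. Hence `V` equals `v` up to `T`
  -- and the translate of `w` after `t₀`; these ranges overlap, so continuity is checked without a
  -- seam.
  have hvw := (hv.comp_add_left ht₀.le hT).eqOn (hw.mono hT0 hsub)
  have hVv : EqOn V v (Ioc 0 T) := by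
    intro t ht
    rcases le_or_gt t t₀ with h | h
    · simp [hV, h]
    · simp only [hV, h.not_ge, if_false]
      have := hvw (x := t - t₀) ⟨by linarith, by linarith [ht.2]⟩
      rw [← this]
      simp
  have hVw : ∀ t, t₀ < t → V t = w (t - t₀) := fun t ht => by simp [hV, ht.not_ge]
  obtain ⟨M, hM, wv⟩ := hv.weighted
  obtain ⟨M', hM', ww⟩ := hw.weighted
  have hc : ContinuousOn V (Ioc 0 (t₀ + δ)) := by
    intro t ht
    rcases lt_or_ge t T with h | h
    · have h1 : Ioo 0 T ∈ 𝓝 t := Ioo_mem_nhds ht.1 h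
      refine ContinuousAt.continuousWithinAt ?_
      refine ((wv.continuousOn.continuousAt (mem_of_superset h1 Ioo_subset_Ioc_self))).congr ?_
      filter_upwards [h1] with s hs
      exact (hVv ⟨hs.1, hs.2.le⟩).symm
    · have h1 : Ioi t₀ ∈ 𝓝 t := Ioi_mem_nhds (by linarith)
      have h2 : ContinuousWithinAt (fun s => w (s - t₀)) (Ioc t₀ (t₀ + δ)) t :=
        (ww.continuousOn (t - t₀) ⟨by linarith, by linarith [ht.2]⟩).comp (f := fun s => s - t₀)
          (by fun_prop) fun s hs => ⟨by linarith [hs.1], by linarith [hs.2]⟩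
      have h3 : ContinuousWithinAt V (Ioc t₀ (t₀ + δ)) t :=
        h2.congr (fun s hs => hVw s hs.1) (hVw t (by linarith))
      refine h3.mono_of_mem_nhdsWithin ?_
      filter_upwards [mem_nhdsWithin_of_mem_nhds h1, self_mem_nhdsWithin] with s h1 h2
      exact ⟨h1, h2.2⟩
  obtain ⟨M'', hM'', wV⟩ := (wv.congr hVv).exists_extend hv.pos A.α_nonneg hM hc
  refine ⟨V, by linarith, ⟨M'', hM'', wV⟩, fun t ht => ?_⟩
  rcases le_or_gt t T with h | h
  · exact (hv.congr hVv).mem_graph t ⟨ht.1, h⟩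
  · have h1 := A.mild_add wV hM'' φ ht₀.le (t := t - t₀) (by linarith) (by linarith [ht.2])
    have h2 := hw.mem_graph (t - t₀) ⟨by linarith, by linarith [ht.2]⟩
    rw [add_sub_cancel] at h1
    rw [h1, hVw t (by linarith),
      A.mild_congr ht₀.le (hVv.mono (Ioc_subset_Ioc_right hT.le)),
      A.mild_congr (w := w) (by linarith) fun s hs => ?_]
    · exact h2
    · rw [hVw _ (by linarith [hs.1]), add_sub_cancel_left]

variable (A) in
/-- A solution extends a fixed time beyond every `t₀` at which `R(t)` applied to the current value
is under control. -/
theorem exists_extension {a : ℝ} (ha : 0 ≤ a) : ∃ δ : ℝ, 0 < δ ∧ δ ≤ 1 ∧ ∀ φ T v t₀,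
    A.IsSol φ T v → 0 < t₀ → t₀ < T → T < t₀ + δ →
    (∀ t ∈ Ioc (0 : ℝ) 1, ‖A.R t (A.mild φ v t₀)‖ ≤ a * t ^ (-α)) →
    ∃ V, A.IsSol φ (t₀ + δ) V := by
  obtain ⟨δ, h0, h1, h⟩ := A.exists_isSol_of_bound ha
  refine ⟨δ, h0, h1, fun φ T v t₀ hv ht₀ hT hδ hb => ?_⟩
  obtain ⟨w, hw⟩ := h _ fun t ht => hb t ⟨ht.1, ht.2.trans h1⟩
  exact hv.glue ht₀ hT hw hδ

/-- The mild solution is bounded in `E` on the compact interval `[0, T]`, so one extension time `δ`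
serves every restarting point. -/
theorem IsSol.exists_gt (hv : A.IsSol φ T v) : ∃ T' V, T < T' ∧ A.IsSol φ T' V := by
  obtain ⟨M, hM, wv⟩ := hv.weighted
  obtain ⟨B, hB⟩ := isCompact_Icc.exists_bound_of_continuousOn (A.continuousOn_mild wv hM φ)
  have hB0 : 0 ≤ B := (norm_nonneg _).trans (hB 0 ⟨le_rfl, hv.pos.le⟩)
  obtain ⟨δ, h0, -, h⟩ := A.exists_extension (mul_nonneg A.C_nonneg hB0)
  have hpos := hv.pos
  -- A positive time closer to `T` than `δ`; `T / 2` only ensures positivity.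
  set t₀ := max (T / 2) (T - δ / 2)
  have h1 : 0 < t₀ := lt_max_of_lt_left (by linarith)
  have h2 : t₀ < T := max_lt (by linarith) (by linarith)
  have h3 : T < t₀ + δ := by linarith [le_max_right (T / 2) (T - δ / 2)]
  obtain ⟨V, hV⟩ := h φ T v t₀ hv h1 h2 h3 fun t ht =>
    A.norm_R_apply_le ht.1 (hB t₀ ⟨h1.le, h2.le⟩)
  exact ⟨_, V, h3, hV⟩

variable (A)

theorem exists_isSol (φ : E) : ∃ T v, A.IsSol φ T v := by
  obtain ⟨δ, -, -, h⟩ := A.exists_isSol_of_bound (mul_nonneg A.C_nonneg (norm_nonneg φ))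
  obtain ⟨v, hv⟩ := h φ fun t ht => A.norm_R_apply_le ht.1 le_rfl
  exact ⟨δ, v, hv⟩

/-- The supremum of the existence times. -/
noncomputable def lifespan (φ : E) : EReal :=
  sSup {x : EReal | ∃ T v, A.IsSol φ T v ∧ x = (T : EReal)}

open Classical in
/-- The union of all solutions with initial value `φ`. -/
noncomputable def flow (φ : E) (t : ℝ) : F :=
  if h : ∃ T v, A.IsSol φ T v ∧ t ≤ T then h.choose_spec.choose t else 0

variable {A}

theorem IsSol.eqOn_flow (hv : A.IsSol φ T v) : EqOn (A.flow φ) v (Ioc 0 T) := by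
  intro t ht
  have h : ∃ T v, A.IsSol φ T v ∧ t ≤ T := ⟨T, v, hv, ht.2⟩
  rw [flow, dif_pos h]
  have hs := h.choose_spec.choose_spec
  exact (hs.1.mono ht.1 hs.2).eqOn (hv.mono ht.1 ht.2) ⟨ht.1, le_rfl⟩

/-- Every solution can be prolonged, so the supremum of the existence times is not attained. -/
theorem IsSol.lt_lifespan (hv : A.IsSol φ T v) : (T : EReal) < A.lifespan φ := by
  obtain ⟨T', V, hT, hV⟩ := hv.exists_gt
  exact (EReal.coe_lt_coe_iff.2 hT).trans_le (le_sSup ⟨T', V, hV, rfl⟩)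

theorem isSol_flow (hT : 0 < T) (h : (T : EReal) < A.lifespan φ) : A.IsSol φ T (A.flow φ) := by
  obtain ⟨-, ⟨T', v, hv, rfl⟩, hlt⟩ := lt_sSup_iff.1 h
  have hle := (EReal.coe_lt_coe_iff.1 hlt).le
  exact (hv.mono hT hle).congr (hv.eqOn_flow.mono (Ioc_subset_Ioc_right hle))

variable (A) in
theorem lifespan_pos (φ : E) : 0 < A.lifespan φ := by
  obtain ⟨T, v, hv⟩ := A.exists_isSol φ
  exact (EReal.coe_lt_coe_iff.2 hv.pos).trans hv.lt_lifespan

/-- Near a finite lifespan `R(t)` applied to the solution cannot stay under control. -/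
theorem exists_not_bound {τ : ℝ} (hτ : A.lifespan φ = τ) {a : ℝ} (ha : 0 ≤ a) :
    ∃ δ > 0, ∀ t₀, 0 < t₀ → τ - δ < t₀ → t₀ < τ →
      ¬ ∀ t ∈ Ioc (0 : ℝ) 1, ‖A.R t (A.mild φ (A.flow φ) t₀)‖ ≤ a * t ^ (-α) := by
  obtain ⟨δ, h0, -, h⟩ := A.exists_extension ha
  refine ⟨δ, h0, fun t₀ ht₀ h1 h2 hb => ?_⟩
  obtain ⟨T, hT1, hT2⟩ := exists_between h2
  have hs : A.IsSol φ T (A.flow φ) :=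
    isSol_flow (ht₀.trans hT1) (by rw [hτ]; exact EReal.coe_lt_coe_iff.2 hT2)
  obtain ⟨V, hV⟩ := h φ T _ t₀ hs ht₀ hT1 (by linarith) hb
  have := hV.lt_lifespan
  rw [hτ, EReal.coe_lt_coe_iff] at this
  linarith

theorem lifespan_eq_coe_pos {τ : ℝ} (hτ : A.lifespan φ = τ) : 0 < τ := by
  have := A.lifespan_pos φ
  rw [hτ] at this
  exact_mod_cast this

/-- If `‖v(t)‖ ≤ b` in `F` at a time close to `τ`, then `‖R(s)u(t)‖ ≤ ‖v(t)‖ ≤ |b| s^{-α}` for `s ≤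
1`, where `u(t)` is the mild value in `E`, and `exists_not_bound` is violated. Thus the norm tends
to infinity, not merely along a sequence. -/
theorem tendsto_norm_flow {τ : ℝ} (hτ : A.lifespan φ = τ) :
    Tendsto (fun t => ‖A.flow φ t‖) (𝓝[<] τ) atTop := by
  have hτ0 := lifespan_eq_coe_pos hτ
  refine tendsto_atTop.2 fun b => ?_
  obtain ⟨δ, hδ, h⟩ := exists_not_bound hτ (abs_nonneg b)
  filter_upwards [Ioo_mem_nhdsLT (max_lt hτ0 (by linarith : τ - δ < τ))] with t ht
  have ht0 : 0 < t := (le_max_left _ _).trans_lt ht.1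
  by_contra! hb
  refine h t ht0 ((le_max_right _ _).trans_lt ht.1) ht.2 fun s hs => ?_
  have hsol : A.IsSol φ t (A.flow φ) :=
    isSol_flow ht0 (by rw [hτ]; exact EReal.coe_lt_coe_iff.2 ht.2)
  refine (A.norm_R_le_of_graph s hs.1 _ _ (hsol.mem_graph t ⟨ht0, le_rfl⟩)).trans ?_
  have h1 : 1 ≤ s ^ (-α) :=
    Real.one_le_rpow_of_pos_of_le_one_of_nonpos hs.1 hs.2 (by linarith [A.α_nonneg])
  calc ‖A.flow φ t‖ ≤ |b| := hb.le.trans (le_abs_self b)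
    _ ≤ |b| * s ^ (-α) := le_mul_of_one_le_right (abs_nonneg b) h1

/-- A limit in `E` bounds the `E`-norm near `τ`, and smoothing turns this into the forbidden bound
on `R`. No `L^{ρp}` information about an extension is required. -/
theorem not_tendsto_mild_flow {τ : ℝ} (hτ : A.lifespan φ = τ) (x : E) :
    ¬ Tendsto (A.mild φ (A.flow φ)) (𝓝[<] τ) (𝓝 x) := by
  intro hx
  have hτ0 := lifespan_eq_coe_pos hτ
  have hb : ∀ᶠ t in 𝓝[<] τ, ‖A.mild φ (A.flow φ) t‖ < ‖x‖ + 1 :=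
    hx.norm.eventually_lt_const (by linarith)
  obtain ⟨δ, hδ, h⟩ := exists_not_bound hτ (a := A.C * (‖x‖ + 1))
    (mul_nonneg A.C_nonneg (by positivity))
  obtain ⟨t, ht, htb⟩ :=
    ((eventually_mem_set.2 (Ioo_mem_nhdsLT (max_lt hτ0 (by linarith : τ - δ < τ)))).and hb).exists
  exact h t ((le_max_left _ _).trans_lt ht.1) ((le_max_right _ _).trans_lt ht.1) ht.2
    fun s hs => A.norm_R_apply_le hs.1 htb.le

end SmoothingSystem

/-! ### The power nonlinearity as a locally Lipschitz map from `L^{ρp}` to `L^p`. -/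

section Nonlinearity

theorem continuous_nonlin {ρ : ℝ} (hρ : 1 < ρ) : Continuous (nonlin ρ) := by
  unfold nonlin
  exact (continuous_abs.rpow_const fun _ => Or.inr (by linarith)).mul continuous_id

theorem abs_nonlin {ρ : ℝ} (hρ : 1 < ρ) (r : ℝ) : |nonlin ρ r| = |r| ^ ρ := by
  rw [nonlin, abs_mul, abs_of_nonneg (by positivity)]
  rcases eq_or_ne |r| 0 with hr | hr
  · rw [hr, mul_zero, Real.zero_rpow (by linarith)]
  · nth_rewrite 2 [← Real.rpow_one |r|]
    rw [← Real.rpow_add (lt_of_le_of_ne (abs_nonneg r) hr.symm), sub_add_cancel]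

/-- The graph of `x^ρ` lies above its tangent at `a`; this is Bernoulli's inequality at `b/a`. -/
theorem rpow_sub_rpow_le {ρ a b : ℝ} (hρ : 1 ≤ ρ) (ha : 0 ≤ a) (hb : 0 ≤ b) :
    a ^ ρ - b ^ ρ ≤ ρ * a ^ (ρ - 1) * (a - b) := by
  rcases ha.eq_or_lt with rfl | ha
  · rw [Real.zero_rpow (by linarith)]
    rcases hρ.eq_or_lt with rfl | hρ
    · simp
    · rw [Real.zero_rpow (by linarith), mul_zero, zero_mul]
      linarith [Real.rpow_nonneg hb ρ]
  · have h := one_add_mul_self_le_rpow_one_add (s := b / a - 1)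
      (by linarith [div_nonneg hb ha.le]) hρ
    rw [add_sub_cancel, Real.div_rpow hb ha.le, le_div_iff₀ (by positivity)] at h
    have e : a ^ ρ = a ^ (ρ - 1) * a := by
      nth_rewrite 3 [← Real.rpow_one a]
      rw [← Real.rpow_add ha, sub_add_cancel]
    have e2 : (1 + ρ * (b / a - 1)) * a ^ ρ = a ^ ρ + ρ * a ^ (ρ - 1) * (b - a) := by
      rw [add_mul, one_mul]
      congr 1
      rw [e]
      field_simp
    linarith

/-- For `|b| ≤ |a|` the difference is `|a|^{ρ-1}(a - b) + (|a|^{ρ-1} - |b|^{ρ-1})b`. The first term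
gives the constant 1; the second is at most `|a|^ρ - |b|^ρ` and gives `ρ` by convexity. -/
theorem abs_nonlin_sub_le {ρ : ℝ} (hρ : 1 < ρ) (a b : ℝ) :
    |nonlin ρ a - nonlin ρ b| ≤ (1 + ρ) * ((|a| ^ (ρ - 1) + |b| ^ (ρ - 1)) * |a - b|) := by
  have key : ∀ a b : ℝ, |b| ≤ |a| →
      |nonlin ρ a - nonlin ρ b| ≤ (1 + ρ) * (|a| ^ (ρ - 1) * |a - b|) := by
    intro a b hab
    have hm : |b| ^ (ρ - 1) ≤ |a| ^ (ρ - 1) :=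
      Real.rpow_le_rpow (abs_nonneg b) hab (by linarith)
    have e : nonlin ρ a - nonlin ρ b =
        |a| ^ (ρ - 1) * (a - b) + (|a| ^ (ρ - 1) - |b| ^ (ρ - 1)) * b := by
      unfold nonlin; ring
    have h1 : (|a| ^ (ρ - 1) - |b| ^ (ρ - 1)) * |b| ≤ |a| ^ ρ - |b| ^ ρ := by
      rw [← abs_nonlin hρ, ← abs_nonlin hρ, nonlin, nonlin, abs_mul, abs_mul,
        abs_of_nonneg (by positivity : 0 ≤ |a| ^ (ρ - 1)),
        abs_of_nonneg (by positivity : 0 ≤ |b| ^ (ρ - 1)), sub_mul]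
      have : |a| ^ (ρ - 1) * |b| ≤ |a| ^ (ρ - 1) * |a| := by gcongr
      linarith
    have h2 := rpow_sub_rpow_le hρ.le (abs_nonneg a) (abs_nonneg b)
    have h3 : ρ * |a| ^ (ρ - 1) * (|a| - |b|) ≤ ρ * |a| ^ (ρ - 1) * |a - b| :=
      mul_le_mul_of_nonneg_left (abs_sub_abs_le_abs_sub a b) (by positivity)
    rw [e]
    refine (abs_add_le _ _).trans ?_
    rw [abs_mul, abs_mul, abs_of_nonneg (by positivity : 0 ≤ |a| ^ (ρ - 1)),
      abs_of_nonneg (sub_nonneg.2 hm)]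
    linarith
  have pa : 0 ≤ |a| ^ (ρ - 1) := by positivity
  have pb : 0 ≤ |b| ^ (ρ - 1) := by positivity
  rcases le_total |b| |a| with h | h
  · refine (key a b h).trans ?_
    gcongr
    linarith
  · rw [abs_sub_comm, abs_sub_comm a b]
    refine (key b a h).trans ?_
    gcongr
    linarith

variable {X : Type*} [MeasurableSpace X] {μ : Measure X} {ρ p : ℝ}

theorem ofReal_mul_comm (hρ : 0 ≤ ρ) :
    ENNReal.ofReal p * ENNReal.ofReal ρ = ENNReal.ofReal (ρ * p) := by
  rw [ENNReal.ofReal_mul hρ, mul_comm]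

theorem memLp_nonlin (hρ : 1 < ρ) {v : X → ℝ} (hv : MemLp v (ENNReal.ofReal (ρ * p)) μ) :
    MemLp (fun x => nonlin ρ (v x)) (ENNReal.ofReal p) μ := by
  refine ⟨(continuous_nonlin hρ).comp_aestronglyMeasurable hv.1, ?_⟩
  have hρ0 : 0 < ρ := by linarith
  have e : eLpNorm (fun x => nonlin ρ (v x)) (ENNReal.ofReal p) μ =
      eLpNorm (fun x => ‖v x‖ ^ ρ) (ENNReal.ofReal p) μ := by
    refine eLpNorm_congr_norm_ae (Eventually.of_forall fun x => ?_)
    rw [Real.norm_eq_abs, abs_nonlin hρ, Real.norm_of_nonneg (by positivity), Real.norm_eq_abs]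
  rw [e, eLpNorm_norm_rpow _ hρ0, ofReal_mul_comm hρ0.le]
  exact ENNReal.rpow_lt_top_of_nonneg hρ0.le hv.2.ne

theorem holderTriple_ofReal (hρ : 1 < ρ) (hp : 0 < p) : ENNReal.HolderTriple
    (ENNReal.ofReal (ρ * p / (ρ - 1))) (ENNReal.ofReal (ρ * p)) (ENNReal.ofReal p) := by
  have h1 : 0 < ρ - 1 := by linarith
  have h2 : 0 < ρ := by linarith
  refine ⟨?_⟩
  rw [← ENNReal.ofReal_inv_of_pos (by positivity), ← ENNReal.ofReal_inv_of_pos (by positivity),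
    ← ENNReal.ofReal_inv_of_pos (by positivity), ← ENNReal.ofReal_add (by positivity)
    (by positivity)]
  congr 1
  field_simp
  ring

theorem eLpNorm_abs_rpow (hρ : 1 < ρ) (v : X → ℝ) :
    eLpNorm (fun x => |v x| ^ (ρ - 1)) (ENNReal.ofReal (ρ * p / (ρ - 1))) μ =
      eLpNorm v (ENNReal.ofReal (ρ * p)) μ ^ (ρ - 1) := by
  have h1 : 0 < ρ - 1 := by linarith
  have := eLpNorm_norm_rpow (p := ENNReal.ofReal (ρ * p / (ρ - 1))) (μ := μ) v h1
  rw [ofReal_mul_comm h1.le, mul_div_cancel₀ _ h1.ne'] at this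
  exact this

/-- Hölder's inequality with `(ρ - 1)/(ρp) + 1/(ρp) = 1/p`, applied to the pointwise Lipschitz
bound. -/
theorem eLpNorm_nonlin_sub_le (hρ : 1 < ρ) (hp : 1 ≤ p) {v w : X → ℝ}
    (hv : AEStronglyMeasurable v μ) (hw : AEStronglyMeasurable w μ) :
    eLpNorm (fun x => nonlin ρ (v x) - nonlin ρ (w x)) (ENNReal.ofReal p) μ ≤
      ENNReal.ofReal (1 + ρ) * ((eLpNorm v (ENNReal.ofReal (ρ * p)) μ ^ (ρ - 1) +
        eLpNorm w (ENNReal.ofReal (ρ * p)) μ ^ (ρ - 1)) *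
          eLpNorm (fun x => v x - w x) (ENNReal.ofReal (ρ * p)) μ) := by
  have h1 : 0 < ρ - 1 := by linarith
  have hm : ∀ u : X → ℝ, AEStronglyMeasurable u μ →
      AEStronglyMeasurable (fun x => |u x| ^ (ρ - 1)) μ := fun u hu =>
    (continuous_abs.rpow_const fun _ => Or.inr h1.le).comp_aestronglyMeasurable hu
  have hq : 1 ≤ ENNReal.ofReal (ρ * p / (ρ - 1)) := by
    rw [ENNReal.one_le_ofReal, le_div_iff₀ h1]
    nlinarith
  have := holderTriple_ofReal hρ (by linarith : 0 < p)
  have b1 := eLpNorm_le_mul_eLpNorm_of_ae_le_mul (p := ENNReal.ofReal p) (μ := μ) (c := 1 + ρ)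
    (f := fun x => nonlin ρ (v x) - nonlin ρ (w x))
    (g := fun x => (|v x| ^ (ρ - 1) + |w x| ^ (ρ - 1)) * (v x - w x))
    (Eventually.of_forall fun x => by
      rw [norm_mul, Real.norm_eq_abs, Real.norm_eq_abs, Real.norm_eq_abs,
        abs_of_nonneg (by positivity : 0 ≤ |v x| ^ (ρ - 1) + |w x| ^ (ρ - 1))]
      exact abs_nonlin_sub_le hρ (v x) (w x))
  refine b1.trans (mul_le_mul_right ?_ _)
  have b2 := eLpNorm_smul_le_mul_eLpNorm (p := ENNReal.ofReal (ρ * p / (ρ - 1)))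
    (q := ENNReal.ofReal (ρ * p)) (r := ENNReal.ofReal p) (hv.sub hw) ((hm v hv).add (hm w hw))
  refine b2.trans (mul_le_mul_left ?_ _)
  rw [← eLpNorm_abs_rpow hρ, ← eLpNorm_abs_rpow hρ]
  exact eLpNorm_add_le (hm v hv) (hm w hw) hq

/-- `v ↦ |v|^{ρ-1} v` as a map from `L^{ρp}` to `L^p`. -/
noncomputable def nonlinLp (hρ : 1 < ρ) (v : Lp ℝ (ENNReal.ofReal (ρ * p)) μ) :
    Lp ℝ (ENNReal.ofReal p) μ :=
  (memLp_nonlin hρ (Lp.memLp v)).toLp _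

theorem coeFn_nonlinLp (hρ : 1 < ρ) (v : Lp ℝ (ENNReal.ofReal (ρ * p)) μ) :
    nonlinLp hρ v =ᵐ[μ] fun x => nonlin ρ (v x) := MemLp.coeFn_toLp _

theorem nonlinLp_zero (hρ : 1 < ρ) : nonlinLp hρ (0 : Lp ℝ (ENNReal.ofReal (ρ * p)) μ) = 0 := by
  refine Lp.ext ?_
  filter_upwards [coeFn_nonlinLp hρ (0 : Lp ℝ (ENNReal.ofReal (ρ * p)) μ),
    Lp.coeFn_zero ℝ (ENNReal.ofReal (ρ * p)) μ, Lp.coeFn_zero ℝ (ENNReal.ofReal p) μ]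
    with x h1 h2 h3
  rw [h1, h2, h3]
  simp [nonlin]

theorem norm_nonlinLp_sub_le [Fact (1 ≤ ENNReal.ofReal p)] [Fact (1 ≤ ENNReal.ofReal (ρ * p))]
    (hρ : 1 < ρ) (hp : 1 ≤ p)
    (v w : Lp ℝ (ENNReal.ofReal (ρ * p)) μ) :
    ‖nonlinLp hρ v - nonlinLp hρ w‖ ≤
      (1 + ρ) * (‖v‖ ^ (ρ - 1) + ‖w‖ ^ (ρ - 1)) * ‖v - w‖ := by
  have h1 : 0 ≤ ρ - 1 := by linarith
  have h0 : 0 ≤ (1 + ρ) * (‖v‖ ^ (ρ - 1) + ‖w‖ ^ (ρ - 1)) * ‖v - w‖ := by positivity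
  have e : ENNReal.ofReal (‖v‖ ^ (ρ - 1) + ‖w‖ ^ (ρ - 1)) = ‖v‖ₑ ^ (ρ - 1) + ‖w‖ₑ ^ (ρ - 1) := by
    rw [ENNReal.ofReal_add (by positivity) (by positivity),
      ← ENNReal.ofReal_rpow_of_nonneg (norm_nonneg v) h1,
      ← ENNReal.ofReal_rpow_of_nonneg (norm_nonneg w) h1, ofReal_norm, ofReal_norm]
  rw [← ENNReal.ofReal_le_ofReal_iff h0, ofReal_norm, mul_assoc,
    ENNReal.ofReal_mul (by linarith), ENNReal.ofReal_mul (by positivity), e, ofReal_norm,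
    Lp.enorm_def, Lp.enorm_def, Lp.enorm_def, Lp.enorm_def]
  refine (le_of_eq ?_).trans ((eLpNorm_nonlin_sub_le hρ hp (Lp.aestronglyMeasurable v)
    (Lp.aestronglyMeasurable w)).trans (le_of_eq ?_))
  · refine eLpNorm_congr_ae ?_
    filter_upwards [Lp.coeFn_sub (nonlinLp hρ v) (nonlinLp hρ w), coeFn_nonlinLp hρ v,
      coeFn_nonlinLp hρ w] with x h1 h2 h3
    rw [h1, Pi.sub_apply, h2, h3]
  · rw [eLpNorm_congr_ae (Lp.coeFn_sub v w)]
    rfl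

end Nonlinearity

/-! ### Identification of elements common to two Lebesgue spaces. -/

section AeEq

variable {X : Type*} [MeasurableSpace X] {μ : Measure X} {p q : ℝ≥0∞}

/-- The pairs in `L^p × L^q` whose components are the same function. -/
noncomputable def aeEqSubmodule (μ : Measure X) (p q : ℝ≥0∞) :
    Submodule ℝ (Lp ℝ p μ × Lp ℝ q μ) where
  carrier := {x | x.1 =ᵐ[μ] x.2}
  add_mem' {x y} hx hy := by
    filter_upwards [hx, hy, Lp.coeFn_add x.1 y.1, Lp.coeFn_add x.2 y.2] with z h1 h2 h3 h4
    rw [Prod.fst_add, Prod.snd_add, h3, h4, Pi.add_apply, Pi.add_apply, h1, h2]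
  zero_mem' := by
    filter_upwards [Lp.coeFn_zero ℝ p μ, Lp.coeFn_zero ℝ q μ] with z h1 h2
    rw [Prod.fst_zero, Prod.snd_zero, h1, h2]
  smul_mem' c x hx := by
    filter_upwards [hx, Lp.coeFn_smul c x.1, Lp.coeFn_smul c x.2] with z h1 h2 h3
    rw [Prod.smul_fst, Prod.smul_snd, h2, h3, Pi.smul_apply, Pi.smul_apply, h1]

theorem mem_aeEqSubmodule {x : Lp ℝ p μ} {y : Lp ℝ q μ} :
    (x, y) ∈ aeEqSubmodule μ p q ↔ x =ᵐ[μ] y := Iff.rfl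

/-- Norm convergence in either space implies convergence in measure, whose limits are unique almost
everywhere. -/
theorem isClosed_aeEqSubmodule [Fact (1 ≤ p)] [Fact (1 ≤ q)] :
    IsClosed (aeEqSubmodule μ p q : Set (Lp ℝ p μ × Lp ℝ q μ)) := by
  refine IsSeqClosed.isClosed fun x y hx hy => ?_
  have h1 := tendstoInMeasure_of_tendsto_Lp ((continuous_fst.tendsto y).comp hy)
  have h2 := tendstoInMeasure_of_tendsto_Lp ((continuous_snd.tendsto y).comp hy)
  refine tendstoInMeasure_ae_unique h1 (h2.congr_left fun n => ?_)
  have h : (x n).1 =ᵐ[μ] (x n).2 := hx n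
  exact h.symm

end AeEq

/-! ### The Grushin semigroup as a smoothing system. -/

section System

variable {N k : ℕ} {ρ p : ℝ}

theorem semigroup_congr {t : ℝ} (ht : 0 < t) {φ ψ : Space N k → ℝ} (h : φ =ᵐ[volume] ψ) :
    semigroup t φ = semigroup t ψ := by
  unfold semigroup
  rw [if_pos ht, if_pos ht]
  funext z
  refine integral_congr_ae ?_
  filter_upwards [h] with w hw
  rw [hw]

/-- This identifies `α` with the smoothing exponent from `L^p` to `L^{ρp}`. -/
theorem alpha_eq (hρ : 1 < ρ) (hp : 0 < p) :
    alpha N k ρ p = ((N : ℝ) + 2 * k) / 2 * (1 / p - 1 / (ρ * p)) := by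
  have : 0 < ρ := by linarith
  unfold alpha
  field_simp

theorem alpha_nonneg (hρ : 1 < ρ) (hp : 0 < p) : 0 ≤ alpha N k ρ p := by
  have : 0 < ρ - 1 := by linarith
  unfold alpha
  positivity

/-- The product `αρ` is `((N + 2k)/2)(ρ - 1)/p`; this is where the lower bound on `p` enters. -/
theorem alpha_mul_lt_one (hρ : 1 < ρ) (hp : 0 < p)
    (h : ((N : ℝ) + 2 * k) / 2 * (ρ - 1) < p) : alpha N k ρ p * ρ < 1 := by
  have : 0 < ρ := by linarith
  have e : alpha N k ρ p * ρ = ((N : ℝ) + 2 * k) / 2 * (ρ - 1) / p := by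
    unfold alpha
    field_simp
  rwa [e, div_lt_one hp]

/-- The Grushin heat semigroup and the power nonlinearity in the pair `L^p`, `L^{ρp}`. -/
noncomputable def grushinSystem [Fact (1 ≤ ENNReal.ofReal p)] [Fact (1 ≤ ENNReal.ofReal (ρ * p))]
    (hN : 1 ≤ N) (hk : 1 ≤ k) (hρ : 1 < ρ) (hp1 : 1 ≤ p) (hpρ : p ≤ ρ * p)
    (hp : ((N : ℝ) + 2 * k) / 2 * (ρ - 1) < p) :
    SmoothingSystem (LpSpace N k p) (LpSpace N k (ρ * p)) (alpha N k ρ p) ρ where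
  S := heatOp hN hk hp1
  R := smoothOp hN hk hp1 hpρ
  graph := aeEqSubmodule _ _ _
  f := nonlinLp hρ
  C := kernelBound N k ^ (1 / p - 1 / (ρ * p))
  L := 1 + ρ
  S_zero := by simp [heatOp]
  S_add t s ht hs x := heatOp_add hN hk hp1 ht hs x
  norm_S_le := norm_heatOp_le hN hk hp1
  tendsto_S := tendsto_heatOp hN hk hp1
  C_nonneg := Real.rpow_nonneg (kernelBound_nonneg N k) _
  L_nonneg := by linarith
  norm_R_le t ht := by
    rw [alpha_eq hρ (by linarith)]
    exact norm_smoothOp_le hN hk hp1 hpρ ht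
  isClosed_graph := isClosed_aeEqSubmodule
  eq_zero_of_graph v hv := by
    refine Lp.ext ?_
    exact (mem_aeEqSubmodule.1 hv).symm.trans
      ((Lp.coeFn_zero _ _ _).trans (Lp.coeFn_zero _ _ _).symm)
  mem_graph t ht x := mem_aeEqSubmodule.2
    ((coeFn_heatOp hN hk hp1 x).trans (coeFn_smoothOp hN hk hp1 hpρ ht x).symm)
  norm_R_le_of_graph t ht x v hxv := by
    have hq : 1 ≤ ρ * p := hp1.trans hpρ
    -- On a function lying in both spaces the smoothing operator acts as the heat operator of
    -- `L^{ρp}`, which is a contraction.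
    have e : smoothOp hN hk hp1 hpρ t x = heatOp hN hk hq t v := by
      refine Lp.ext ((coeFn_smoothOp hN hk hp1 hpρ ht x).trans ?_)
      rw [semigroup_congr ht (mem_aeEqSubmodule.1 hxv)]
      exact (coeFn_heatOp hN hk hq v).symm
    rw [e]
    simpa using (heatOp hN hk hq t).le_of_opNorm_le (norm_heatOp_le hN hk hq t) v
  f_zero := nonlinLp_zero hρ
  norm_f_sub_le := norm_nonlinLp_sub_le hρ hp1
  α_nonneg := alpha_nonneg hρ (by linarith)
  one_lt_ρ := hρ
  mul_lt_one := alpha_mul_lt_one hρ (by linarith) hp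

end System

/-! ### Translation between concrete and abstract solutions. -/

section Bridge

variable {N k : ℕ} {ρ p : ℝ} [Fact (1 ≤ ENNReal.ofReal p)] {u₀ : LpSpace N k p} {T : ℝ}

/-- An infinite norm times the positive weight `t^α` would be infinite, contradicting the bound in
`MemX`. -/
theorem IsSolution.memLp {u : ℝ → LpSpace N k p} (h : IsSolution ρ p u₀ T u) {t : ℝ}
    (ht : t ∈ Ioc 0 T) : MemLp (u t) (ENNReal.ofReal (ρ * p)) volume := by
  refine ⟨Lp.aestronglyMeasurable _, ?_⟩
  obtain ⟨M, hM⟩ := h.memX.bound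
  have ht0 := ht.1
  by_contra! hc
  have := hM t ht
  rw [top_le_iff.1 hc, ENNReal.mul_top (by simpa using Real.rpow_pos_of_pos ht0 _), top_le_iff]
    at this
  exact ENNReal.ofReal_ne_top this

open Classical in
/-- The `L^q` class of `u(t)`, where it exists. -/
noncomputable def classIn (q : ℝ) (u : ℝ → LpSpace N k p) (t : ℝ) : LpSpace N k q :=
  if h : MemLp (u t) (ENNReal.ofReal q) volume then h.toLp _ else 0

theorem IsSolution.coeFn_classIn {u : ℝ → LpSpace N k p} (h : IsSolution ρ p u₀ T u) {t : ℝ}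
    (ht : t ∈ Ioc 0 T) : classIn (ρ * p) u t =ᵐ[volume] u t := by
  rw [classIn, dif_pos (h.memLp ht)]
  exact MemLp.coeFn_toLp _

variable [Fact (1 ≤ ENNReal.ofReal (ρ * p))]
  (hN : 1 ≤ N) (hk : 1 ≤ k) (hρ : 1 < ρ) (hp1 : 1 ≤ p) (hpρ : p ≤ ρ * p)
  (hp : ((N : ℝ) + 2 * k) / 2 * (ρ - 1) < p)

/-- The integrand `g` of `MildEqAt` is forced on `(0, t)` by its almost-everywhere formula, so its
integral is the abstract Duhamel term; conversely the weighted bound makes that term an admissible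
choice. -/
theorem mildEqAt_iff {u : ℝ → LpSpace N k p} {v : ℝ → LpSpace N k (ρ * p)} {M t : ℝ}
    (hv : IsWeighted v T (alpha N k ρ p) M) (hM : 0 ≤ M) (ht : t ∈ Icc 0 T)
    (huv : ∀ s ∈ Ioo 0 t, u s =ᵐ[volume] v s) :
    MildEqAt ρ p u₀ u t ↔ u t = (grushinSystem hN hk hρ hp1 hpρ hp).mild u₀ v t := by
  set A := grushinSystem hN hk hρ hp1 hpρ hp with hA
  have hgs : ∀ s ∈ Ioo 0 t, A.S (t - s) (A.f (v s)) =ᵐ[volume]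
      semigroup (t - s) (fun w => nonlin ρ (u s w)) := by
    intro s hs
    refine (coeFn_heatOp hN hk hp1 (t := t - s) _).trans (EventuallyEq.of_eq ?_)
    refine semigroup_congr (sub_pos.2 hs.2) ?_
    filter_upwards [coeFn_nonlinLp hρ (v s), huv s hs] with w h1 h2
    rw [h2]
    exact h1
  have hint : IntervalIntegrable (fun s => A.S (t - s) (A.f (v s))) volume 0 t :=
    A.isSingularFamily_S.intervalIntegrable A.mul_exponent_nonneg A.mul_lt_one
      (mul_nonneg A.L_nonneg (by positivity)) (A.isWeighted_f hv hM) ht.1 ht.2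
  have hmild : A.mild u₀ v t =ᵐ[volume] semigroup t u₀ +
      ((∫ s in (0 : ℝ)..t, A.S (t - s) (A.f (v s)) : LpSpace N k p) : Space N k → ℝ) := by
    filter_upwards [Lp.coeFn_add (A.S t u₀) (convolve A.S (fun s => A.f (v s)) t),
      coeFn_heatOp hN hk hp1 (t := t) u₀] with z h1 h2
    rw [Pi.add_apply, ← h2]
    exact h1
  constructor
  · rintro ⟨g, hg, -, h⟩
    refine Lp.ext (h.trans ?_)
    have e : ∫ s in (0 : ℝ)..t, g s = ∫ s in (0 : ℝ)..t, A.S (t - s) (A.f (v s)) := by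
      refine intervalIntegral.integral_congr_ae ?_
      rw [uIoc_of_le ht.1]
      exact ae_restrict_Ioc_of_Ioo fun s hs => Lp.ext ((hg s hs).2.trans (hgs s hs).symm)
    rw [e]
    exact hmild.symm
  · intro h
    refine ⟨fun s => A.S (t - s) (A.f (v s)), fun s hs => ⟨Eventually.of_forall fun z => ?_,
      hgs s hs⟩, hint, ?_⟩
    · refine (isSubMarkov_pairKernel hN hk (sub_pos.2 hs.2)).integrable_mul hp1
        (memLp_nonlin hρ ?_) z
      exact (memLp_congr_ae (huv s hs)).2 (Lp.memLp (v s))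
    · rw [h]
      exact hmild

theorem isSolution_mild {v : ℝ → LpSpace N k (ρ * p)}
    (h : (grushinSystem hN hk hρ hp1 hpρ hp).IsSol u₀ T v) :
    IsSolution ρ p u₀ T ((grushinSystem hN hk hρ hp1 hpρ hp).mild u₀ v) := by
  obtain ⟨M, hM, hv⟩ := h.weighted
  have hae : ∀ t ∈ Ioc 0 T,
      (grushinSystem hN hk hρ hp1 hpρ hp).mild u₀ v t =ᵐ[volume] v t := fun t ht =>
    mem_aeEqSubmodule.1 (h.mem_graph t ht)
  refine ⟨h.pos, ⟨SmoothingSystem.continuousOn_mild _ hv hM u₀, fun t ht => ?_⟩, ?_, M, ?_⟩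
  · exact (mildEqAt_iff hN hk hρ hp1 hpρ hp hv hM ht
      fun s hs => hae s ⟨hs.1, hs.2.le.trans ht.2⟩).2 rfl
  · intro t₀ ht₀
    have h1 : Tendsto (fun t => ‖v t - v t₀‖ₑ) (𝓝[Ioc 0 T] t₀) (𝓝 0) := by
      have := ((hv.continuousOn t₀ ht₀).tendsto.sub_const (v t₀)).enorm
      simpa using this
    refine h1.congr' ?_
    filter_upwards [self_mem_nhdsWithin] with t ht
    rw [Lp.enorm_def]
    refine eLpNorm_congr_ae ?_
    filter_upwards [Lp.coeFn_sub (v t) (v t₀), hae t ht, hae t₀ ht₀] with z h1 h2 h3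
    rw [h1, h2, h3, Pi.sub_apply]
  · intro t ht
    have ht0 := ht.1
    rw [eLpNorm_congr_ae (hae t ht), ← Lp.enorm_def, ← ofReal_norm,
      ← ENNReal.ofReal_mul (by positivity)]
    refine ENNReal.ofReal_le_ofReal ?_
    have := mul_le_mul_of_nonneg_left (hv.norm_le t ht)
      (by positivity : 0 ≤ t ^ alpha N k ρ p)
    refine this.trans_eq ?_
    rw [mul_left_comm, ← Real.rpow_add ht0, add_neg_cancel, Real.rpow_zero, mul_one]

theorem IsSolution.exists_isWeighted {u : ℝ → LpSpace N k p} (h : IsSolution ρ p u₀ T u) :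
    ∃ M, 0 ≤ M ∧ IsWeighted (classIn (ρ * p) u) T (alpha N k ρ p) M := by
  obtain ⟨M, hM⟩ := h.memX.bound
  refine ⟨max M 0, le_max_right _ _, fun t₀ ht₀ => ?_, fun t ht => ?_⟩
  · rw [ContinuousWithinAt, tendsto_iff_edist_tendsto_0]
    refine (h.memX.tendsto t₀ ht₀).congr' ?_
    filter_upwards [self_mem_nhdsWithin] with t ht
    rw [Lp.edist_def]
    refine eLpNorm_congr_ae ?_
    filter_upwards [h.coeFn_classIn ht, h.coeFn_classIn ht₀] with z h1 h2
    rw [Pi.sub_apply, h1, h2]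
  · have ht0 := ht.1
    have h1 := hM t ht
    rw [← eLpNorm_congr_ae (h.coeFn_classIn ht), ← Lp.enorm_def, ← ofReal_norm,
      ← ENNReal.ofReal_mul (by positivity)] at h1
    have h2 := (h1.trans (ENNReal.ofReal_le_ofReal (le_max_left M 0)))
    rw [ENNReal.ofReal_le_ofReal_iff (le_max_right _ _)] at h2
    rw [Real.rpow_neg ht0.le, ← div_eq_mul_inv, le_div_iff₀ (by positivity), mul_comm]
    exact h2

theorem IsSolution.eqOn_mild_classIn {u : ℝ → LpSpace N k p} (h : IsSolution ρ p u₀ T u) :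
    EqOn u ((grushinSystem hN hk hρ hp1 hpρ hp).mild u₀ (classIn (ρ * p) u)) (Icc 0 T) := by
  obtain ⟨M, hM, hv⟩ := h.exists_isWeighted
  intro t ht
  exact (mildEqAt_iff hN hk hρ hp1 hpρ hp hv hM ht fun s hs =>
    (h.coeFn_classIn ⟨hs.1, hs.2.le.trans ht.2⟩).symm).1 (h.mild.eq t ht)

theorem IsSolution.isSol_classIn {u : ℝ → LpSpace N k p} (h : IsSolution ρ p u₀ T u) :
    (grushinSystem hN hk hρ hp1 hpρ hp).IsSol u₀ T (classIn (ρ * p) u) where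
  pos := h.pos
  weighted := h.exists_isWeighted
  mem_graph t ht := by
    rw [← h.eqOn_mild_classIn hN hk hρ hp1 hpρ hp ⟨ht.1.le, ht.2⟩]
    exact (h.coeFn_classIn ht).symm

theorem IsSolution.eqOn_mild_flow {u : ℝ → LpSpace N k p} (h : IsSolution ρ p u₀ T u) :
    EqOn u ((grushinSystem hN hk hρ hp1 hpρ hp).mild u₀
      ((grushinSystem hN hk hρ hp1 hpρ hp).flow u₀)) (Icc 0 T) := by
  intro t ht
  rw [h.eqOn_mild_classIn hN hk hρ hp1 hpρ hp ht]
  refine SmoothingSystem.mild_congr _ ht.1 fun s hs => ?_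
  exact ((h.isSol_classIn hN hk hρ hp1 hpρ hp).eqOn_flow ⟨hs.1, hs.2.trans ht.2⟩).symm

/-- A mild solution reaching a finite lifespan would, by continuity in `L^p`, give the flow a left
limit there, contradicting `not_tendsto_mild_flow`. -/
theorem isMaximalSolution_mild_flow (u₀ : LpSpace N k p) :
    IsMaximalSolution ρ p u₀ ((grushinSystem hN hk hρ hp1 hpρ hp).lifespan u₀)
      ((grushinSystem hN hk hρ hp1 hpρ hp).mild u₀
        ((grushinSystem hN hk hρ hp1 hpρ hp).flow u₀)) := by
  set A := grushinSystem hN hk hρ hp1 hpρ hp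
  refine ⟨A.lifespan_pos u₀, fun T hT hlt => isSolution_mild hN hk hρ hp1 hpρ hp
    (SmoothingSystem.isSol_flow hT hlt), ?_⟩
  rintro ⟨T', v, hle, hv, heq⟩
  -- The lifespan is positive and at most the real number `T'`, hence neither infinite value.
  obtain ⟨τ, hτ⟩ : ∃ τ : ℝ, A.lifespan u₀ = τ :=
    ⟨_, (EReal.coe_toReal (hle.trans_lt (EReal.coe_lt_top T')).ne
      (EReal.bot_lt_zero.trans (A.lifespan_pos u₀)).ne').symm⟩
  have hτ0 := SmoothingSystem.lifespan_eq_coe_pos hτ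
  rw [hτ] at heq hle
  have hτT : τ ≤ T' := EReal.coe_le_coe_iff.1 hle
  refine SmoothingSystem.not_tendsto_mild_flow hτ (v τ) ?_
  have h1 : Tendsto v (𝓝[Ico 0 τ] τ) (𝓝 (v τ)) :=
    (hv.continuousOn τ ⟨hτ0.le, hτT⟩).mono fun s hs => ⟨hs.1, hs.2.le.trans hτT⟩
  rw [nhdsWithin_Ico_eq_nhdsLT hτ0] at h1
  refine h1.congr' ?_
  filter_upwards [Ico_mem_nhdsLT hτ0] with t ht
  exact heq ⟨ht.1, EReal.coe_lt_coe_iff.2 ht.2⟩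

theorem IsSolution.lt_lifespan {u : ℝ → LpSpace N k p} (h : IsSolution ρ p u₀ T u) :
    (T : EReal) < (grushinSystem hN hk hρ hp1 hpρ hp).lifespan u₀ :=
  (h.isSol_classIn hN hk hρ hp1 hpρ hp).lt_lifespan

theorem IsMaximalSolution.eqOn_mild_flow {Tm : EReal} {U : ℝ → LpSpace N k p}
    (h : IsMaximalSolution ρ p u₀ Tm U) :
    EqOn U ((grushinSystem hN hk hρ hp1 hpρ hp).mild u₀
      ((grushinSystem hN hk hρ hp1 hpρ hp).flow u₀)) {t : ℝ | 0 ≤ t ∧ (t : EReal) < Tm} := by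
  rintro t ⟨ht0, ht⟩
  obtain ⟨r, h1, h2⟩ := EReal.lt_iff_exists_real_btwn.1 ht
  have hr : t < r := EReal.coe_lt_coe_iff.1 h1
  exact (h.sol r (ht0.trans_lt hr) h2).eqOn_mild_flow hN hk hρ hp1 hpρ hp ⟨ht0, hr.le⟩

/-- A smaller `Tm` would let the flow extend the solution to `Tm`, against maximality; a larger one
would make it a solution up to a time beyond the lifespan. -/
theorem IsMaximalSolution.eq_lifespan {Tm : EReal} {U : ℝ → LpSpace N k p}
    (h : IsMaximalSolution ρ p u₀ Tm U) :
    Tm = (grushinSystem hN hk hρ hp1 hpρ hp).lifespan u₀ := by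
  set A := grushinSystem hN hk hρ hp1 hpρ hp
  rcases lt_trichotomy Tm (A.lifespan u₀) with hlt | heq | hlt
  · exfalso
    obtain ⟨τ, rfl⟩ : ∃ τ : ℝ, Tm = τ :=
      ⟨_, (EReal.coe_toReal (hlt.trans_le le_top).ne (EReal.bot_lt_zero.trans h.pos).ne').symm⟩
    have hτ : 0 < τ := by exact_mod_cast h.pos
    exact h.maximal ⟨τ, A.mild u₀ (A.flow u₀), le_rfl,
      ((isMaximalSolution_mild_flow hN hk hρ hp1 hpρ hp u₀).sol τ hτ hlt).mild,
      (h.eqOn_mild_flow hN hk hρ hp1 hpρ hp).symm⟩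
  · exact heq
  · exfalso
    obtain ⟨r, h1, h2⟩ := EReal.lt_iff_exists_real_btwn.1 hlt
    have hr : 0 < r := by exact_mod_cast (A.lifespan_pos u₀).trans h1
    exact ((h.sol r hr h2).lt_lifespan hN hk hρ hp1 hpρ hp).not_gt h1

theorem tendsto_eLpNorm_mild_flow {τ : ℝ}
    (hτ : (grushinSystem hN hk hρ hp1 hpρ hp).lifespan u₀ = τ) :
    Tendsto (fun t => eLpNorm ((grushinSystem hN hk hρ hp1 hpρ hp).mild u₀
      ((grushinSystem hN hk hρ hp1 hpρ hp).flow u₀) t) (ENNReal.ofReal (ρ * p)) volume)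
      (𝓝[<] τ) (𝓝 ∞) := by
  have hτ0 := SmoothingSystem.lifespan_eq_coe_pos hτ
  refine (ENNReal.tendsto_ofReal_nhds_top.2
    (SmoothingSystem.tendsto_norm_flow hτ)).congr' ?_
  filter_upwards [Ioo_mem_nhdsLT hτ0] with t ht
  have hs := SmoothingSystem.isSol_flow ht.1 (by rw [hτ]; exact EReal.coe_lt_coe_iff.2 ht.2)
  rw [ofReal_norm, Lp.enorm_def]
  exact (eLpNorm_congr_ae (mem_aeEqSubmodule.1 (hs.mem_graph t ⟨ht.1, le_rfl⟩))).symm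

end Bridge

end Grushin

/-! ### The main theorem. -/

theorem theorem3p3 (N k : ℕ) (hN : 1 ≤ N) (hk : 1 ≤ k) (ρ p : ℝ)
    [Fact (1 ≤ ENNReal.ofReal p)] (hρ : 1 < ρ)
    (hp : ((N : ℝ) + 2 * k) / 2 * (ρ - 1) < p)
    (u₀ : Grushin.LpSpace N k p) :
    -- there is a local solution, unique on its interval
    (∃ (T : ℝ) (u : ℝ → Grushin.LpSpace N k p), Grushin.IsSolution ρ p u₀ T u ∧
      ∀ v, Grushin.IsSolution ρ p u₀ T v → EqOn v u (Icc 0 T)) ∧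
    ∀ (T : ℝ) (u : ℝ → Grushin.LpSpace N k p), Grushin.IsSolution ρ p u₀ T u →
      -- it has a continuation
      (∃ (T' : ℝ) (v : ℝ → Grushin.LpSpace N k p),
        Grushin.IsContinuation ρ p u₀ T u T' v) ∧
      -- continuations are unique
      (∀ (T₁ T₂ : ℝ) (v₁ v₂ : ℝ → Grushin.LpSpace N k p),
        Grushin.IsContinuation ρ p u₀ T u T₁ v₁ → Grushin.IsContinuation ρ p u₀ T u T₂ v₂ →
        EqOn v₁ v₂ (Icc 0 (min T₁ T₂))) ∧
      -- it extends to a maximal solution, which is unique and satisfies the blow-up alternative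
      ∃ (Tm : EReal) (U : ℝ → Grushin.LpSpace N k p),
        (T : EReal) < Tm ∧ EqOn U u (Icc 0 T) ∧
        Grushin.IsMaximalSolution ρ p u₀ Tm U ∧
        (∀ (Tm' : EReal) (V : ℝ → Grushin.LpSpace N k p),
          (T : EReal) < Tm' → EqOn V u (Icc 0 T) → Grushin.IsMaximalSolution ρ p u₀ Tm' V →
          Tm' = Tm ∧ EqOn V U {t : ℝ | 0 ≤ t ∧ (t : EReal) < Tm}) ∧
        (∀ τ : ℝ, Tm = (τ : EReal) →
          Tendsto (fun t => eLpNorm (U t) (ENNReal.ofReal (ρ * p)) volume)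
            (𝓝[<] τ) (𝓝 ∞)) := by
  have hp1 : 1 ≤ p := ENNReal.one_le_ofReal.1 Fact.out
  have hpρ : p ≤ ρ * p := le_mul_of_one_le_left (by linarith) hρ.le
  have : Fact (1 ≤ ENNReal.ofReal (ρ * p)) := ⟨ENNReal.one_le_ofReal.2 (hp1.trans hpρ)⟩
  set A := Grushin.grushinSystem hN hk hρ hp1 hpρ hp
  set U := A.mild u₀ (A.flow u₀)
  have hU := Grushin.isMaximalSolution_mild_flow hN hk hρ hp1 hpρ hp u₀
  -- Every solution is a restriction of the single function `U`, which reduces all the uniqueness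
  -- claims to comparison with `U`.
  have huniq : ∀ {T u}, Grushin.IsSolution ρ p u₀ T u → EqOn u U (Icc 0 T) := fun h =>
    h.eqOn_mild_flow hN hk hρ hp1 hpρ hp
  refine ⟨?_, fun T u hu => ⟨?_, ?_, A.lifespan u₀, U, ?_, (huniq hu).symm, hU, ?_, ?_⟩⟩
  · obtain ⟨T, v, hv⟩ := A.exists_isSol u₀
    exact ⟨T, U, hU.sol T hv.pos hv.lt_lifespan, fun v hv => huniq hv⟩
  · obtain ⟨T', h1, h2⟩ :=
      EReal.lt_iff_exists_real_btwn.1 (hu.lt_lifespan hN hk hρ hp1 hpρ hp)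
    have hT : T < T' := EReal.coe_lt_coe_iff.1 h1
    exact ⟨T', U, hT, hU.sol T' (hu.pos.trans hT) h2, (huniq hu).symm⟩
  · intro T₁ T₂ v₁ v₂ h₁ h₂ t ht
    rw [huniq h₁.sol ⟨ht.1, ht.2.trans (min_le_left _ _)⟩,
      huniq h₂.sol ⟨ht.1, ht.2.trans (min_le_right _ _)⟩]
  · exact hu.lt_lifespan hN hk hρ hp1 hpρ hp
  · intro Tm' V _ _ hV
    have he := hV.eq_lifespan hN hk hρ hp1 hpρ hp
    have hE := hV.eqOn_mild_flow hN hk hρ hp1 hpρ hp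
    rw [he] at hE
    exact ⟨he, hE⟩
  · exact fun τ hτ => Grushin.tendsto_eLpNorm_mild_flow hN hk hρ hp1 hpρ hp hτ
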